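/- Let $\theta\in\mathbb R$ be irrational, $\Theta=\begin{pmatrix}0&\theta\\-\theta&0\end{pmatrix}$, and $\sigma_\Theta(x,y)=e^{-\pi i\langle x,\Theta y\rangle}$ for $x,y\in\mathbb Z^2$. Let $B$ be the quantum torus $\mathbb C\rtimes^{\sigma_\Theta}\mathbb Z^2$, i.e. the C*-algebra generated by unitaries $W_x$ ($x\in\mathbb Z^2$) with $W_x^*=W_{-x}$ and $W_xW_y=\sigma_\Theta(x,y)W_{x+y}$. Let $\tau_B$ be its trace, $\tau_B(W_x)=\delta_{x,0}$, let $L^2(B,\tau_B)$ be its GNS space with GNS representation $\pi_{\tau_B}$ and canonical map $\iota_B:B\to L^2(B,\tau_B)$, and let $\mathcal T_B=\{\sum_r\alpha_rW_r:\ \sup_r(1+r_1^2+r_2^2)^k|\alpha_r|^2<\infty\ \ \forall k\in\mathbb N\}$. Let $\delta_j^B$ ($j=1,2$) be the derivation with domain $\iota_B(\mathcal T_B)$ and $\delta^B_j(\iota_B(W_r))=2\pi i\,r_j\,\iota_B(W_r)$, and let $D^{\pm}$ be the closure of $-i(\delta_1^B\pm i\delta_2^B)$; so $\begin{pmatrix}0&D^-\\D^+&0\end{pmatrix}$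 is the standard (even) Dirac operator of $B$ on $L^2(B,\tau_B)\oplus L^2(B,\tau_B)$. Let $M\in M_2(\mathbb Z)$ with $\det M>1$, $\widehat M=(M^{-1})^T$, $G=\mathbb Z^2/M\mathbb Z^2$. The group $G$ acts on $B$ by $\gamma_{t+M\mathbb Z^2}(W_x)=e^{2\pi i\langle M^{-1}t,x\rangle}W_x$; let $A=B^\gamma$ be the fixed-point algebra and $\mathcal T_A=A\cap\mathcal T_B$. The dual group is $\widehat G=\widehat M\mathbb Z^2/\mathbb Z^2\cong\mathbb Z^2/M^T\mathbb Z^2$; for $\widehat g\in\widehat G$ let $\zeta(\widehat g)\in[0,1)^2$ be its representative and $s(\widehat g)=M^T\zeta(\widehat g)\in\mathbb Z^2$. Put $\mu_{\widehat g}=W_{s(\widehat g)}$, $\rho_j(a)=\mu_ja\mu_j^*$ and $\sigma_{j,k}=\mu_j\mu_k\mu_{j+k}^*$ for $j,k\in\widehat G$, $a\in A$. Then $(\rho,\sigma)$ is a twisted action of $\widehat G$ on $A$. Let $A\rtimes_r^{\rho,\sigma}\widehat G$ be the reduced twisted crossed product, with elements $\sum_j a_j\delta_j$ and $(a\delta_j)(b\delta_k)=a\rho_j(b)\sigma_{j,k}\delta_{j+k}$,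 defined by the left regular representation induced by any faithful representation of $A$, and let $C(\widehat G,\mathcal T_A)=\{\sum_j a_j\delta_j:\ a_j\in\mathcal T_A\}$. Let $V=\mathbb C^2$, $\boldsymbol\ell(\widehat g)=\begin{pmatrix}0&s_1-is_2\\s_1+is_2&0\end{pmatrix}$ with $(s_1,s_2)=s(\widehat g)$, and $M_{\boldsymbol\ell}(\delta_{\widehat g}\otimes v)=\delta_{\widehat g}\otimes\boldsymbol\ell(\widehat g)v$ on $\ell^2(\widehat G)\otimes V$. Put $\widetilde H=(L^2(B,\tau_B)\otimes\ell^2(\widehat G)\otimes V)\oplus(L^2(B,\tau_B)\otimes\ell^2(\widehat G)\otimes V)$ and $$\widetilde D=\begin{pmatrix}I\otimes M_{\boldsymbol\ell}&D^-\otimes I\otimes I\\ D^+\otimes I\otimes I&-I\otimes M_{\boldsymbol\ell}\end{pmatrix}.$$ Then $\Phi(a\delta_j)=a\mu_j$ defines a $*$-isomorphism $\Phi:A\rtimes_r^{\rho,\sigma}\widehat G\to B$. Moreover there is a representation $\hat\pi\times\hat L:A\rtimes_r^{\rho,\sigma}\widehat G\to\mathbb B(\widetilde H)$ such that $(\hat\pi\times\hat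 L)(a\delta_j)$ acts on each of the two summands by $\xi\otimes\delta_g\otimes v\mapsto\pi_{\tau_B}(a)\pi_{\tau_B}(\mu_j)\xi\otimes\delta_{j+g}\otimes v$ for all $a\in A$, $j\in\widehat G$. It is determined by the formula $$(\hat\pi\times\hat L)(W_{M^Tx}\delta_j)\begin{pmatrix}\iota_B(W_m)\otimes\delta_g\otimes v\\ \iota_B(W_n)\otimes\delta_h\otimes w\end{pmatrix}=\begin{pmatrix}e^{-\pi i[\langle M^Tx,\Theta s(j)\rangle+\langle M^Tx+s(j),\Theta m\rangle]}\,\iota_B(W_{m+M^Tx+s(j)})\otimes\delta_{j+g}\otimes v\\ e^{-\pi i[\langle M^Tx,\Theta s(j)\rangle+\langle M^Tx+s(j),\Theta n\rangle]}\,\iota_B(W_{n+M^Tx+s(j)})\otimes\delta_{j+h}\otimes w\end{pmatrix}$$ for $x,m,n\in\mathbb Z^2$, $j,g,h\in\widehat G$, $v,w\in V$. The operator $\widetilde D$ is self-adjoint and $$\widetilde D\begin{pmatrix}\iota_B(W_m)\otimes\delta_g\otimes v\\ \iota_B(W_n)\otimes\delta_h\otimes w\end{pmatrix}=\begin{pmatrix}\iota_B(W_m)\otimes\delta_g\otimes\boldsymbol\ell(g)v+2\pi(n_1-in_2)\,\iota_B(W_n)\otimes\delta_h\otimes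 w\\ 2\pi(m_1+im_2)\,\iota_B(W_m)\otimes\delta_g\otimes v-\iota_B(W_n)\otimes\delta_h\otimes\boldsymbol\ell(h)w\end{pmatrix}.$$ Finally, $(C(\widehat G,\mathcal T_A),\hat\pi\times\hat L,\widetilde H,\widetilde D)$ is an odd spectral triple on $A\rtimes_r^{\rho,\sigma}\widehat G$: $C(\widehat G,\mathcal T_A)$ is a dense $*$-subalgebra, $(1+\widetilde D^2)^{-1/2}$ is compact, and every element of $C(\widehat G,\mathcal T_A)$ preserves $\operatorname{Dom}\widetilde D$ and has bounded commutator with $\widetilde D$. This triple is regular: for every $c\in C(\widehat G,\mathcal T_A)$ both $(\hat\pi\times\hat L)(c)$ and the bounded extension of $[\widetilde D,(\hat\pi\times\hat L)(c)]$ lie in the domain of $\delta^k$ for all $k\ge1$, where $\delta=[|\widetilde D|,\cdot\,]$. -/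

import Mathlib

open scoped ComplexOrder InnerProductSpace

noncomputable section

namespace QTorus

/-! ### Weighted shifts on `ℓ²(G, K)` -/

/-- The Hilbert space `ℓ²(G, K) ≅ K ⊗ ℓ²(G)`. -/
abbrev Ell2 (G K : Type*) [NormedAddCommGroup K] : Type _ := lp (fun _ : G => K) 2

section Shift

variable {G K : Type*} [NormedAddCommGroup K] [InnerProductSpace ℂ K]

theorem shift_summable (e : G ≃ G) (T : G → K →L[ℂ] K) (c : ℝ) (hT : ∀ z, ‖T z‖ ≤ c)
    (f : Ell2 G K) :
    (∀ z, ‖T z (f (e z))‖ ^ (2 : ENNReal).toReal ≤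
      c ^ (2 : ENNReal).toReal * ‖f (e z)‖ ^ (2 : ENNReal).toReal) ∧
    HasSum (fun z => c ^ (2 : ENNReal).toReal * ‖f (e z)‖ ^ (2 : ENNReal).toReal)
      (c ^ (2 : ENNReal).toReal * ‖f‖ ^ (2 : ENNReal).toReal) := by
  constructor
  · intro z
    have hc : 0 ≤ c := (norm_nonneg _).trans (hT z)
    rw [← Real.mul_rpow hc (norm_nonneg _)]
    exact Real.rpow_le_rpow (norm_nonneg _)
      (((T z).le_opNorm _).trans (mul_le_mul_of_nonneg_right (hT z) (norm_nonneg _)))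
      (by norm_num)
  · have h := lp.hasSum_norm (p := 2) (by norm_num) f
    exact ((Equiv.hasSum_iff e).2 h).mul_left _

/-- The bounded operator `(S f)(z) = T_z (f (e z))` on `ℓ²(G, K)`, for a permutation `e` of `G` and
a uniformly bounded family of operators `T_z` on `K`. -/
def weightedShift (e : G ≃ G) (T : G → K →L[ℂ] K) (c : ℝ) (hT : ∀ z, ‖T z‖ ≤ c) :
    Ell2 G K →L[ℂ] Ell2 G K :=
  LinearMap.mkContinuous
    { toFun := fun f => ⟨fun z => T z (f (e z)), memℓp_gen <|
        Summable.of_nonneg_of_le (fun z => by positivity) (shift_summable e T c hT f).1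
          (shift_summable e T c hT f).2.summable⟩
      map_add' := fun f g => by
        apply lp.ext
        funext z
        exact map_add (T z) (f (e z)) (g (e z))
      map_smul' := fun a f => by
        apply lp.ext
        funext z
        exact map_smul (T z) a (f (e z)) }
    |c| (fun f => by
      refine lp.norm_le_of_tsum_le (p := 2) (by norm_num) (by positivity) ?_
      have h := shift_summable e T c hT f
      have hs : Summable fun z => ‖T z (f (e z))‖ ^ (2 : ENNReal).toReal :=
        Summable.of_nonneg_of_le (fun z => by positivity) h.1 h.2.summable
      refine (hs.tsum_le_tsum h.1 h.2.summable).trans ?_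
      rw [h.2.tsum_eq, Real.mul_rpow (abs_nonneg _) (norm_nonneg _)]
      have h2 : c ^ (2 : ENNReal).toReal = |c| ^ (2 : ENNReal).toReal := by simp
      rw [h2])

@[simp]
theorem weightedShift_apply (e : G ≃ G) (T : G → K →L[ℂ] K) (c : ℝ) (hT : ∀ z, ‖T z‖ ≤ c)
    (f : Ell2 G K) (z : G) : weightedShift e T c hT f z = T z (f (e z)) := rfl

end Shift

/-! ### Twisted actions and reduced twisted crossed products -/

/-- A twisting pair `(ρ, σ)` for a unital C⋆-algebra `A` and a discrete group `G` (written
additively). -/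
structure TwistingPair (A G : Type*) [CStarAlgebra A] [AddGroup G] where
  ρ : G → (A ≃⋆ₐ[ℂ] A)
  σ : G → G → unitary A
  ρ_σ : ∀ x y z, ρ x (σ y z : A) = (σ x y : A) * (σ (x + y) z : A) * star (σ x (y + z) : A)
  ρ_ρ : ∀ x y a, ρ x (ρ y a) = (σ x y : A) * ρ (x + y) a * star (σ x y : A)
  σ_zero_right : ∀ x, σ x 0 = 1
  σ_zero_left : ∀ x, σ 0 x = 1
  ρ_zero : ∀ a, ρ 0 a = a

section Crossed

variable {A G K : Type*} [CStarAlgebra A] [AddGroup G]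
  [NormedAddCommGroup K] [InnerProductSpace ℂ K] [CompleteSpace K]

theorem leftRegular_bound (P : TwistingPair A G) (π : A →⋆ₐ[ℂ] (K →L[ℂ] K)) (a : A) (x z : G) :
    ‖π (P.ρ (-z) a * (P.σ (-z) x : A))‖ ≤ ‖a‖ := by
  refine (NonUnitalStarAlgHom.norm_apply_le π _).trans ?_
  rw [CStarRing.norm_mul_coe_unitary]
  exact NonUnitalStarAlgHom.norm_apply_le (P.ρ (-z)) a

/-- The operator `Π(a δ_x)` of the left regular representation on `ℓ²(G, K)` induced by `π`:
`Π(a δ_x)(ξ ⊗ δ_y) = π(ρ_{-(x+y)}(a) σ_{-(x+y),x}) ξ ⊗ δ_{x+y}`. -/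
def leftRegular (P : TwistingPair A G) (π : A →⋆ₐ[ℂ] (K →L[ℂ] K)) (a : A) (x : G) :
    Ell2 G K →L[ℂ] Ell2 G K :=
  weightedShift (Equiv.addLeft (-x)) (fun z => π (P.ρ (-z) a * (P.σ (-z) x : A))) ‖a‖
    (leftRegular_bound P π a x)

/-- The reduced twisted crossed product: the C⋆-algebra generated by the image of the left regular
representation induced by `π` (to be used with `π` faithful). -/
def reducedCrossedProduct (P : TwistingPair A G) (π : A →⋆ₐ[ℂ] (K →L[ℂ] K)) :
    StarSubalgebra ℂ (Ell2 G K →L[ℂ] Ell2 G K) :=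
  (StarAlgebra.adjoin ℂ
    (Set.range fun p : A × G => leftRegular P π p.1 p.2)).topologicalClosure

instance (P : TwistingPair A G) (π : A →⋆ₐ[ℂ] (K →L[ℂ] K)) :
    IsClosed (reducedCrossedProduct P π : Set (Ell2 G K →L[ℂ] Ell2 G K)) :=
  StarSubalgebra.isClosed_topologicalClosure _

/-- The element `a δ_x` of the reduced twisted crossed product. -/
def crossedElem (P : TwistingPair A G) (π : A →⋆ₐ[ℂ] (K →L[ℂ] K)) (a : A) (x : G) :
    reducedCrossedProduct P π :=
  ⟨leftRegular P π a x,
    StarSubalgebra.le_topologicalClosure _ (StarAlgebra.subset_adjoin ℂ _ ⟨(a, x), rfl⟩)⟩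

/-- The subspace `C(G, 𝒜)` of the reduced twisted crossed product by a finite group: the elements
`∑ a_x δ_x` with all `a_x` in `𝒜`. -/
def crossedSmooth [Fintype G] (P : TwistingPair A G) (π : A →⋆ₐ[ℂ] (K →L[ℂ] K)) (𝒜 : Set A) :
    Set (reducedCrossedProduct P π) :=
  {c | ∃ f : G → A, (∀ x, f x ∈ 𝒜) ∧ c = ∑ x, crossedElem P π (f x) x}

end Crossed

/-! ### Twisting pairs from frames -/

section Frame

variable {B G : Type*} [CStarAlgebra B] [AddGroup G]

/-- The twisting pair `ρ_j(a) = μ_j a μ_j^*`, `σ_{j,k} = μ_j μ_k μ_{j+k}^*` of a family of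
unitaries `μ`, for a closed ⋆-subalgebra `A` for which these formulas make sense. -/
def frameTwistingPair (A : StarSubalgebra ℂ B) [IsClosed (A : Set B)] (μ : G → unitary B)
    (h₀ : μ 0 = 1)
    (h₁ : ∀ j, ∀ a ∈ A, (μ j : B) * a * star (μ j : B) ∈ A)
    (h₂ : ∀ j, ∀ a ∈ A, star (μ j : B) * a * (μ j : B) ∈ A)
    (h₃ : ∀ j k, ((μ j * μ k * star (μ (j + k)) : unitary B) : B) ∈ A) :
    TwistingPair A G where
  ρ j := StarAlgEquiv.ofBijective
    ({ toFun := fun a => ⟨(μ j : B) * a * star (μ j : B), h₁ j a a.2⟩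
       map_one' := by ext; simp
       map_zero' := by ext; simp
       map_mul' := fun a b => by
        ext
        have h : star (μ j : B) * (μ j : B) = 1 := by simp
        calc (μ j : B) * (a * b) * star (μ j : B)
            = (μ j : B) * a * 1 * b * star (μ j : B) := by simp [mul_assoc]
          _ = (μ j : B) * a * star (μ j : B) * ((μ j : B) * b * star (μ j : B)) := by
            rw [← h]; simp only [mul_assoc]
       map_add' := fun a b => by ext; simp [mul_add, add_mul]
       commutes' := fun r => by
        ext
        simp [Algebra.algebraMap_eq_smul_one]
       map_star' := fun a => by ext; simp [mul_assoc] } : A →⋆ₐ[ℂ] A)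
    ⟨fun a b hab => by
      have h := congrArg Subtype.val hab
      have h' : star (μ j : B) * ((μ j : B) * a * star (μ j : B)) * (μ j : B) =
          star (μ j : B) * ((μ j : B) * b * star (μ j : B)) * (μ j : B) :=
        congrArg (fun t => star (μ j : B) * t * (μ j : B)) h
      ext
      simpa [mul_assoc, ← mul_assoc (star (μ j : B)) (μ j : B)] using h',
     fun a => ⟨⟨star (μ j : B) * a * (μ j : B), h₂ j a a.2⟩, by
      ext
      change (μ j : B) * (star (μ j : B) * a * (μ j : B)) * star (μ j : B) = a
      simp [mul_assoc, ← mul_assoc (μ j : B) (star (μ j : B))]⟩⟩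
  σ j k := ⟨⟨((μ j * μ k * star (μ (j + k)) : unitary B) : B), h₃ j k⟩, by
    rw [Unitary.mem_iff]
    constructor <;> ext
    · exact (Unitary.mem_iff.1 (μ j * μ k * star (μ (j + k))).2).1
    · exact (Unitary.mem_iff.1 (μ j * μ k * star (μ (j + k))).2).2⟩
  ρ_σ x y z := by
    ext
    change ((μ x * (μ y * μ z * star (μ (y + z))) * star (μ x) : unitary B) : B) =
      ((μ x * μ y * star (μ (x + y)) * (μ (x + y) * μ z * star (μ (x + y + z))) *
        star (μ x * μ (y + z) * star (μ (x + (y + z)))) : unitary B) : B)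
    congr 1
    simp only [Unitary.star_eq_inv, add_assoc]
    group
  ρ_ρ x y a := by
    ext
    have h : star (μ (x + y) : B) * (μ (x + y) : B) = 1 := by simp
    change (μ x : B) * ((μ y : B) * a * star (μ y : B)) * star (μ x : B) =
      ((μ x : B) * (μ y : B) * star (μ (x + y) : B)) * ((μ (x + y) : B) * a * star (μ (x + y) : B)) *
        star ((μ x : B) * (μ y : B) * star (μ (x + y) : B))
    simp [mul_assoc, ← mul_assoc (star (μ (x + y) : B)) (μ (x + y) : B)]
  σ_zero_right x := by ext; simp [h₀]
  σ_zero_left x := by ext; simp [h₀]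
  ρ_zero a := by
    ext
    change ((μ 0 : unitary B) : B) * a * star ((μ 0 : unitary B) : B) = a
    simp [h₀]

end Frame

/-! ### Spectral triples and regularity -/

section Triples

variable {H : Type*} [NormedAddCommGroup H] [InnerProductSpace ℂ H]

/-- The bounded operator `S` preserves the domain of `D` and `[D, S]` extends to the bounded
operator `C`. -/
def IsBddCommutator (D : H →ₗ.[ℂ] H) (S C : H →L[ℂ] H) : Prop :=
  ∀ x : D.domain, ∃ h : S x ∈ D.domain, D ⟨S x, h⟩ - S (D x) = C x

/-- The graph of `D²`, on its natural domain. -/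
def sqGraph (D : H →ₗ.[ℂ] H) : Set (H × H) :=
  {p | ∃ y, (p.1, y) ∈ D.graph ∧ (y, p.2) ∈ D.graph}

/-- `R` is the operator `(1 + D²)^{-1/2}`: the positive bounded operator whose square is the
everywhere defined inverse of `1 + D²`. -/
def IsInvSqrtOneAddSq (D : H →ₗ.[ℂ] H) (R : H →L[ℂ] H) : Prop :=
  R.IsPositive ∧ ∀ x, (R (R x), x - R (R x)) ∈ sqGraph D

/-- `T` is the operator `|D|`: the positive self-adjoint operator with `T² = D²`. -/
def IsAbs [CompleteSpace H] (D T : H →ₗ.[ℂ] H) : Prop :=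
  IsSelfAdjoint T ∧ (∀ x : T.domain, 0 ≤ ⟪(x : H), T x⟫_ℂ) ∧ sqGraph T = sqGraph D

/-- `S ∈ Dom(δ^k)` for the derivation `δ = [T, ·]`. -/
def MemDomDelta (T : H →ₗ.[ℂ] H) : ℕ → (H →L[ℂ] H) → Prop
  | 0, _ => True
  | k + 1, S => ∃ C, IsBddCommutator T S C ∧ MemDomDelta T k C

/-- `S ∈ Dom^∞(δ)` for the derivation `δ = [T, ·]`. -/
def MemDomDeltaInf (T : H →ₗ.[ℂ] H) (S : H →L[ℂ] H) : Prop := ∀ k, MemDomDelta T k S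

variable [CompleteSpace H] {C : Type*} [CStarAlgebra C]

/-- `(𝒞, H, D, π)` is an odd spectral triple on the unital C⋆-algebra `C`. -/
structure IsOddSpectralTriple (𝒞 : Set C) (π : C →⋆ₐ[ℂ] (H →L[ℂ] H)) (D : H →ₗ.[ℂ] H) : Prop where
  isStarSubalgebra : ∃ S : StarSubalgebra ℂ C, (S : Set C) = 𝒞
  dense : Dense 𝒞
  dense_domain : Dense (D.domain : Set H)
  selfAdjoint : IsSelfAdjoint D
  compact : ∃ R : H →L[ℂ] H, IsInvSqrtOneAddSq D R ∧ IsCompactOperator R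
  commutator : ∀ a ∈ 𝒞, ∃ E, IsBddCommutator D (π a) E

/-- Regularity: `π(𝒞)` and `[D, π(𝒞)]` lie in `Dom^∞(δ)`, where `δ = [|D|, ·]`. -/
def IsRegularTriple (𝒞 : Set C) (π : C →⋆ₐ[ℂ] (H →L[ℂ] H)) (D : H →ₗ.[ℂ] H) : Prop :=
  ∃ T, IsAbs D T ∧ ∀ a ∈ 𝒞, MemDomDeltaInf T (π a) ∧
    ∃ E, IsBddCommutator D (π a) E ∧ MemDomDeltaInf T E

end Triples

/-! ### The equivariant construction, even to odd, for a finite group and `V = ℂ²` -/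

section Equivariant

variable {G H : Type*} [AddGroup G] [Fintype G] [NormedAddCommGroup H] [InnerProductSpace ℂ H]

/-- The Hilbert space `H ⊗ ℓ²(G) ⊗ ℂ²` for a finite group `G`. -/
abbrev Tens (G H : Type*) [Fintype G] [NormedAddCommGroup H] : Type _ :=
  PiLp 2 (fun _ : G × Fin 2 => H)

open Classical in
/-- The elementary tensor `ξ ⊗ δ_g ⊗ v`. -/
def tens (ξ : H) (g : G) (v : EuclideanSpace ℂ (Fin 2)) : Tens G H :=
  WithLp.toLp 2 fun p => if p.1 = g then v p.2 • ξ else 0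

/-- The operator `T ⊗ λ_h ⊗ 1`, i.e. `ξ ⊗ δ_g ⊗ v ↦ T ξ ⊗ δ_{h+g} ⊗ v`. -/
def ampShift (T : H →L[ℂ] H) (h : G) : Tens G H →L[ℂ] Tens G H :=
  ((PiLp.continuousLinearEquiv 2 ℂ (fun _ : G × Fin 2 => H)).symm :
      (G × Fin 2 → H) →L[ℂ] Tens G H) ∘L
    (ContinuousLinearMap.pi fun p : G × Fin 2 =>
      T ∘L ContinuousLinearMap.proj (R := ℂ) (φ := fun _ : G × Fin 2 => H) (-h + p.1, p.2)) ∘L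
    ((PiLp.continuousLinearEquiv 2 ℂ (fun _ : G × Fin 2 => H)) :
      Tens G H →L[ℂ] (G × Fin 2 → H))

/-- The operator `1 ⊗ M_ℓ`, i.e. `ξ ⊗ δ_g ⊗ v ↦ ξ ⊗ δ_g ⊗ ℓ(g) v`. -/
def lengthMul (ℓ : G → Matrix (Fin 2) (Fin 2) ℂ) : Tens G H →ₗ[ℂ] Tens G H where
  toFun x := WithLp.toLp 2 fun p => ∑ k, ℓ p.1 p.2 k • x (p.1, k)
  map_add' x y := by
    ext p
    simp [Finset.sum_add_distrib]
  map_smul' c x := by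
    ext p
    simp only [PiLp.smul_apply, RingHom.id_apply, Finset.smul_sum]
    exact Finset.sum_congr rfl fun k _ => smul_comm _ _ _

/-- The Hilbert space `(H⁺ ⊗ ℓ²(G) ⊗ ℂ²) ⊕ (H⁻ ⊗ ℓ²(G) ⊗ ℂ²)` with `H⁺ = H⁻ = H`. -/
abbrev EquivHilb (G H : Type*) [Fintype G] [NormedAddCommGroup H] : Type _ :=
  WithLp 2 (Tens G H × Tens G H)

/-- The operator `(π̂ × L̂)(a δ_h)`, where `T⁺ = π⁺(a) U⁺_h` and `T⁻ = π⁻(a) U⁻_h`: the diagonal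
operator with entries `T^± ⊗ λ_h ⊗ 1`. -/
def equivRep (Tp Tm : H →L[ℂ] H) (h : G) : EquivHilb G H →L[ℂ] EquivHilb G H :=
  ((WithLp.prodContinuousLinearEquiv 2 ℂ (Tens G H) (Tens G H)).symm :
      Tens G H × Tens G H →L[ℂ] EquivHilb G H) ∘L
    ((ampShift Tp h).prodMap (ampShift Tm h)) ∘L
    ((WithLp.prodContinuousLinearEquiv 2 ℂ (Tens G H) (Tens G H)) :
      EquivHilb G H →L[ℂ] Tens G H × Tens G H)

/-- The Dirac operator of the equivariant construction,
`[[1 ⊗ M_ℓ, D⁻ ⊗ 1 ⊗ 1], [D⁺ ⊗ 1 ⊗ 1, - 1 ⊗ M_ℓ]]`. -/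
def equivDirac (Dp Dm : H →ₗ.[ℂ] H) (ℓ : G → Matrix (Fin 2) (Fin 2) ℂ) :
    EquivHilb G H →ₗ.[ℂ] EquivHilb G H where
  domain :=
    { carrier := {x | (∀ p, x.fst p ∈ Dp.domain) ∧ ∀ p, x.snd p ∈ Dm.domain}
      add_mem' := fun hx hy =>
        ⟨fun p => add_mem (hx.1 p) (hy.1 p), fun p => add_mem (hx.2 p) (hy.2 p)⟩
      zero_mem' := ⟨fun _ => zero_mem _, fun _ => zero_mem _⟩
      smul_mem' := fun c _ hx =>
        ⟨fun p => Submodule.smul_mem _ c (hx.1 p), fun p => Submodule.smul_mem _ c (hx.2 p)⟩ }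
  toFun :=
    { toFun := fun x => WithLp.toLp 2
        (lengthMul ℓ (x : EquivHilb G H).fst + WithLp.toLp 2 fun p => Dm ⟨_, x.2.2 p⟩,
          (WithLp.toLp 2 fun p => Dp ⟨_, x.2.1 p⟩) - lengthMul ℓ (x : EquivHilb G H).snd)
      map_add' := fun x y => by
        have h1 : ∀ p, Dp ⟨_, (x + y).2.1 p⟩ = Dp ⟨_, x.2.1 p⟩ + Dp ⟨_, y.2.1 p⟩ := fun p =>
          Dp.map_add ⟨_, x.2.1 p⟩ ⟨_, y.2.1 p⟩
        have h2 : ∀ p, Dm ⟨_, (x + y).2.2 p⟩ = Dm ⟨_, x.2.2 p⟩ + Dm ⟨_, y.2.2 p⟩ := fun p =>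
          Dm.map_add ⟨_, x.2.2 p⟩ ⟨_, y.2.2 p⟩
        simp only [h1, h2]
        apply WithLp.ofLp_injective 2
        apply Prod.ext <;> ext p
        · simp
          abel
        · simp
          abel
      map_smul' := fun c x => by
        have h1 : ∀ p, Dp ⟨_, (c • x).2.1 p⟩ = c • Dp ⟨_, x.2.1 p⟩ := fun p =>
          Dp.map_smul c ⟨_, x.2.1 p⟩
        have h2 : ∀ p, Dm ⟨_, (c • x).2.2 p⟩ = c • Dm ⟨_, x.2.2 p⟩ := fun p =>
          Dm.map_smul c ⟨_, x.2.2 p⟩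
        simp only [h1, h2]
        apply WithLp.ofLp_injective 2
        apply Prod.ext <;> ext p
        · simp
        · simp [smul_sub] }

end Equivariant

/-! ### The quantum torus -/

section Torus

/-- The lattice `ℤ²`. -/
abbrev Z2 : Type := Fin 2 → ℤ

/-- `⟨x, Θ y⟩` for `Θ = [[0, θ], [-θ, 0]]`. -/
def thetaForm (θ : ℝ) (x y : Z2) : ℝ :=
  (fun i => (x i : ℝ)) ⬝ᵥ (!![0, θ; -θ, 0]).mulVec fun i => (y i : ℝ)

/-- The skew bicharacter `σ_Θ(x, y) = exp(-π i ⟨x, Θ y⟩)`. -/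
def sigmaTheta (θ : ℝ) (x y : Z2) : ℂ :=
  Complex.exp (-(Real.pi * Complex.I) * thetaForm θ x y)

theorem thetaForm_eq (θ : ℝ) (x y : Z2) :
    thetaForm θ x y = θ * ((x 0 : ℝ) * y 1 - x 1 * y 0) := by
  simp [thetaForm, dotProduct, Matrix.mulVec, Fin.sum_univ_two]
  ring

theorem thetaForm_add_left (θ : ℝ) (x x' y : Z2) :
    thetaForm θ (x + x') y = thetaForm θ x y + thetaForm θ x' y := by
  simp only [thetaForm_eq, Pi.add_apply]; push_cast; ring

theorem thetaForm_add_right (θ : ℝ) (x y y' : Z2) :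
    thetaForm θ x (y + y') = thetaForm θ x y + thetaForm θ x y' := by
  simp only [thetaForm_eq, Pi.add_apply]; push_cast; ring

theorem thetaForm_neg_left (θ : ℝ) (x y : Z2) : thetaForm θ (-x) y = -thetaForm θ x y := by
  simp only [thetaForm_eq, Pi.neg_apply]; push_cast; ring

theorem thetaForm_neg_right (θ : ℝ) (x y : Z2) : thetaForm θ x (-y) = -thetaForm θ x y := by
  simp only [thetaForm_eq, Pi.neg_apply]; push_cast; ring

theorem thetaForm_self (θ : ℝ) (x : Z2) : thetaForm θ x x = 0 := by
  simp only [thetaForm_eq]; ring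

theorem thetaForm_swap (θ : ℝ) (x y : Z2) : thetaForm θ y x = -thetaForm θ x y := by
  simp only [thetaForm_eq]; ring

theorem sigmaTheta_star (θ : ℝ) (x y : Z2) :
    star (sigmaTheta θ x y) = Complex.exp (Real.pi * Complex.I * thetaForm θ x y) := by
  rw [sigmaTheta, Complex.star_def, ← Complex.exp_conj]
  simp

theorem sigmaTheta_mem_unitary (θ : ℝ) (x y : Z2) : sigmaTheta θ x y ∈ unitary ℂ := by
  rw [Unitary.mem_iff, sigmaTheta_star, sigmaTheta, ← Complex.exp_add, ← Complex.exp_add]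
  constructor <;> (rw [← Complex.exp_zero]; congr 1; ring)

/-- The twisted action `(id, σ_Θ)` of `ℤ²` on `ℂ`. -/
def torusPair (θ : ℝ) : TwistingPair ℂ Z2 where
  ρ _ := StarAlgEquiv.refl ℂ ℂ
  σ x y := ⟨sigmaTheta θ x y, sigmaTheta_mem_unitary θ x y⟩
  ρ_σ x y z := by
    change sigmaTheta θ y z = sigmaTheta θ x y * sigmaTheta θ (x + y) z *
      star (sigmaTheta θ x (y + z))
    rw [sigmaTheta_star]
    simp only [sigmaTheta, ← Complex.exp_add, thetaForm_add_left, thetaForm_add_right]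
    congr 1
    push_cast
    ring
  ρ_ρ x y a := by
    change a = sigmaTheta θ x y * a * star (sigmaTheta θ x y)
    rw [mul_right_comm, (Unitary.mem_iff.1 (sigmaTheta_mem_unitary θ x y)).2, one_mul]
  σ_zero_right x := by
    ext
    change sigmaTheta θ x 0 = 1
    simp [sigmaTheta, thetaForm_eq]
  σ_zero_left x := by
    ext
    change sigmaTheta θ 0 x = 1
    simp [sigmaTheta, thetaForm_eq]
  ρ_zero _ := rfl

/-- The representation of `ℂ` on the Hilbert space `ℂ` by scalar multiplication. -/
def scalarRep : ℂ →⋆ₐ[ℂ] (ℂ →L[ℂ] ℂ) :=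
  { Algebra.ofId ℂ (ℂ →L[ℂ] ℂ) with
    map_star' := fun c => by
      change algebraMap ℂ (ℂ →L[ℂ] ℂ) (star c) = star (algebraMap ℂ (ℂ →L[ℂ] ℂ) c)
      exact algebraMap_star_comm c }

/-- The quantum torus `B = ℂ ⋊_r^{σ_Θ} ℤ²`, concretely realized on `ℓ²(ℤ²)`. As `ℤ²` is amenable,
it is also the full crossed product, i.e. the universal C⋆-algebra of the relations of the `W_x`. -/
def QuantumTorus (θ : ℝ) : Type := reducedCrossedProduct (torusPair θ) scalarRep

instance (θ : ℝ) : CStarAlgebra (QuantumTorus θ) :=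
  inferInstanceAs (CStarAlgebra (reducedCrossedProduct (torusPair θ) scalarRep))

instance (θ : ℝ) : PartialOrder (QuantumTorus θ) := CStarAlgebra.spectralOrder _

instance (θ : ℝ) : StarOrderedRing (QuantumTorus θ) := CStarAlgebra.spectralOrderedRing _

/-- The inclusion of `B` in the bounded operators on `ℓ²(ℤ²)`. -/
def torusIncl (θ : ℝ) : QuantumTorus θ →⋆ₐ[ℂ] (Ell2 Z2 ℂ →L[ℂ] Ell2 Z2 ℂ) :=
  (reducedCrossedProduct (torusPair θ) scalarRep).subtype

theorem torusIncl_injective (θ : ℝ) : Function.Injective (torusIncl θ) :=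
  Subtype.val_injective

/-- The generators `W_x = 1 δ_x` of the quantum torus. -/
def W (θ : ℝ) (x : Z2) : QuantumTorus θ := crossedElem (torusPair θ) scalarRep 1 x

theorem torusIncl_W_apply (θ : ℝ) (x : Z2) (f : Ell2 Z2 ℂ) (z : Z2) :
    torusIncl θ (W θ x) f z = sigmaTheta θ x z * f (-x + z) := by
  change (scalarRep (StarAlgEquiv.refl ℂ ℂ 1 * sigmaTheta θ (-z) x)) (f (-x + z)) = _
  have h : sigmaTheta θ (-z) x = sigmaTheta θ x z := by
    rw [sigmaTheta, sigmaTheta, thetaForm_neg_left, thetaForm_swap, neg_neg]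
  rw [h]
  change (algebraMap ℂ (ℂ →L[ℂ] ℂ) (1 * sigmaTheta θ x z)) (f (-x + z)) = _
  simp [Algebra.algebraMap_eq_smul_one]

theorem W_mul (θ : ℝ) (x y : Z2) : W θ x * W θ y = sigmaTheta θ x y • W θ (x + y) := by
  apply torusIncl_injective
  rw [map_mul, map_smul]
  ext f z
  change torusIncl θ (W θ x) (torusIncl θ (W θ y) f) z =
    sigmaTheta θ x y * torusIncl θ (W θ (x + y)) f z
  rw [torusIncl_W_apply, torusIncl_W_apply, torusIncl_W_apply, ← mul_assoc, ← mul_assoc]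
  congr 1
  · simp only [sigmaTheta, ← Complex.exp_add, thetaForm_add_left, thetaForm_add_right,
      thetaForm_neg_right, thetaForm_swap θ x y]
    congr 1
    push_cast
    ring
  · rw [neg_add_rev, add_assoc]

theorem W_zero (θ : ℝ) : W θ 0 = 1 := by
  apply torusIncl_injective
  rw [map_one]
  ext f z
  rw [torusIncl_W_apply]
  simp [sigmaTheta, thetaForm_eq]

theorem W_star (θ : ℝ) (x : Z2) : star (W θ x) = W θ (-x) := by
  apply torusIncl_injective
  rw [map_star, ContinuousLinearMap.star_eq_adjoint, eq_comm, ContinuousLinearMap.eq_adjoint_iff]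
  intro f g
  rw [lp.inner_eq_tsum, lp.inner_eq_tsum, ← (Equiv.addLeft (-x)).tsum_eq]
  congr 1
  funext z
  have h : torusIncl θ (W θ (-x)) f (-x + z) = star (sigmaTheta θ x z) * f z := by
    rw [torusIncl_W_apply, sigmaTheta_star, sigmaTheta]
    congr 2
    · rw [thetaForm_neg_left, thetaForm_add_right, thetaForm_neg_right, thetaForm_self]
      push_cast
      ring
    · simp
  rw [torusIncl_W_apply θ x g]
  change ⟪torusIncl θ (W θ (-x)) f (-x + z), g (-x + z)⟫_ℂ = _
  rw [h]
  simp only [RCLike.inner_apply, map_mul, Complex.star_def, Complex.conj_conj]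
  ring

theorem W_mem_unitary (θ : ℝ) (x : Z2) : W θ x ∈ unitary (QuantumTorus θ) := by
  have h : ∀ y : Z2, W θ (-y) * W θ y = 1 := fun y => by
    rw [W_mul, neg_add_cancel, W_zero, sigmaTheta, thetaForm_neg_left, thetaForm_self]
    simp
  rw [Unitary.mem_iff, W_star]
  exact ⟨h x, by simpa using h (-x)⟩

/-- The vector state `b ↦ ⟨δ_0, b δ_0⟩`; it is the trace `τ_B(∑ α_r W_r) = α_0`. -/
def torusTrace (θ : ℝ) : QuantumTorus θ →ₚ[ℂ] ℂ :=
  PositiveLinearMap.mk₀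
    { toFun := fun b => ⟪lp.single 2 0 (1 : ℂ), torusIncl θ b (lp.single 2 0 (1 : ℂ))⟫_ℂ
      map_add' := fun a b => by
        rw [map_add, add_apply, inner_add_right]
      map_smul' := fun c b => by
        rw [map_smul, smul_apply, inner_smul_right]
        rfl }
    (fun b hb => by
      obtain ⟨c, rfl⟩ := CStarAlgebra.nonneg_iff_eq_star_mul_self.1 hb
      change 0 ≤ ⟪lp.single 2 0 (1 : ℂ), torusIncl θ (star c * c) (lp.single 2 0 (1 : ℂ))⟫_ℂ
      rw [map_mul, map_star, ContinuousLinearMap.star_eq_adjoint, mul_apply_eq_comp,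
        ContinuousLinearMap.adjoint_inner_right]
      rw [inner_self_eq_norm_sq_to_K]
      exact pow_nonneg (by simp) 2)

theorem torusTrace_W (θ : ℝ) (x : Z2) : torusTrace θ (W θ x) = if x = 0 then 1 else 0 := by
  change ⟪lp.single 2 0 (1 : ℂ), torusIncl θ (W θ x) (lp.single 2 0 (1 : ℂ))⟫_ℂ = _
  rw [lp.inner_single_left, torusIncl_W_apply]
  by_cases h : x = 0
  · subst h
    simp [sigmaTheta, thetaForm_eq]
  · simp [h]

/-- The Hilbert space `L²(B, τ_B)` of the GNS representation of `τ_B`. -/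
abbrev L2B (θ : ℝ) : Type := (torusTrace θ).GNS

/-- The GNS representation of `B` on `L²(B, τ_B)`. -/
def piTau (θ : ℝ) : QuantumTorus θ →⋆ₐ[ℂ] (L2B θ →L[ℂ] L2B θ) := (torusTrace θ).gnsStarAlgHom

/-- The canonical map `ι_B : B → L²(B, τ_B)`. -/
def iotaB (θ : ℝ) (b : QuantumTorus θ) : L2B θ :=
  (((torusTrace θ).toPreGNS b : (torusTrace θ).PreGNS) : L2B θ)

/-- The sequences in `𝒮(ℤ²)`. -/
def IsSchwartz (α : Z2 → ℂ) : Prop :=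
  ∀ k : ℕ, BddAbove (Set.range fun r : Z2 => (1 + (r 0 : ℝ) ^ 2 + (r 1 : ℝ) ^ 2) ^ k * ‖α r‖ ^ 2)

theorem IsSchwartz.zero : IsSchwartz 0 := fun k => ⟨0, by rintro _ ⟨r, rfl⟩; simp⟩

theorem IsSchwartz.smul {α : Z2 → ℂ} (hα : IsSchwartz α) (c : ℂ) : IsSchwartz (c • α) := by
  intro k
  obtain ⟨b, hb⟩ := hα k
  refine ⟨‖c‖ ^ 2 * b, ?_⟩
  rintro _ ⟨r, rfl⟩
  have h := mul_le_mul_of_nonneg_left (hb ⟨r, rfl⟩) (sq_nonneg ‖c‖)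
  simp only [Pi.smul_apply, norm_smul, mul_pow] at h ⊢
  linarith

theorem IsSchwartz.add {α β : Z2 → ℂ} (hα : IsSchwartz α) (hβ : IsSchwartz β) :
    IsSchwartz (α + β) := by
  intro k
  obtain ⟨a, ha⟩ := hα k
  obtain ⟨b, hb⟩ := hβ k
  refine ⟨2 * (a + b), ?_⟩
  rintro _ ⟨r, rfl⟩
  have h1 := ha ⟨r, rfl⟩
  have h2 := hb ⟨r, rfl⟩
  have h3 : ‖α r + β r‖ ^ 2 ≤ 2 * (‖α r‖ ^ 2 + ‖β r‖ ^ 2) := by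
    have := norm_add_le (α r) (β r)
    nlinarith [norm_nonneg (α r + β r), sq_nonneg (‖α r‖ - ‖β r‖)]
  have h4 : (0 : ℝ) ≤ (1 + (r 0 : ℝ) ^ 2 + (r 1 : ℝ) ^ 2) ^ k := by positivity
  have h5 := mul_le_mul_of_nonneg_left h3 h4
  simp only [Pi.add_apply] at h1 h2 ⊢
  linarith

/-- The smooth noncommutative torus `𝒯_B`: the sums `∑ α_r W_r` with `α ∈ 𝒮(ℤ²)`. -/
def smoothTorus (θ : ℝ) : Set (QuantumTorus θ) :=
  {b | ∃ α : Z2 → ℂ, IsSchwartz α ∧ HasSum (fun r => α r • W θ r) b}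

/-- The graph of the derivation `δ^B_j`: the pairs `(ι_B(∑ α_r W_r), ∑ 2πi r_j α_r ι_B(W_r))` with
`α ∈ 𝒮(ℤ²)`. -/
def derivGraph (θ : ℝ) (j : Fin 2) : Submodule ℂ (L2B θ × L2B θ) where
  carrier := {p | ∃ (α : Z2 → ℂ) (b : QuantumTorus θ), IsSchwartz α ∧
    HasSum (fun r => α r • W θ r) b ∧ p.1 = iotaB θ b ∧
    HasSum (fun r => (2 * Real.pi * Complex.I * (r j : ℂ) * α r) • iotaB θ (W θ r)) p.2}
  add_mem' := by
    rintro p q ⟨α, b, h1, h2, h3, h4⟩ ⟨β, c, k1, k2, k3, k4⟩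
    refine ⟨α + β, b + c, h1.add k1, ?_, ?_, ?_⟩
    · simpa [add_smul] using h2.add k2
    · rw [Prod.fst_add, h3, k3]
      simp [iotaB, UniformSpace.Completion.coe_add]
    · simpa [mul_add, add_smul] using h4.add k4
  zero_mem' := ⟨0, 0, .zero, by simp, by
    simp [iotaB, UniformSpace.Completion.coe_zero], by simp⟩
  smul_mem' := by
    rintro c p ⟨α, b, h1, h2, h3, h4⟩
    refine ⟨c • α, c • b, h1.smul c, ?_, ?_, ?_⟩
    · simpa [mul_smul] using h2.const_smul c
    · rw [Prod.smul_fst, h3]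
      simp [iotaB]
    · simpa [smul_smul, mul_left_comm, mul_assoc] using h4.const_smul c

/-- The closable derivation `δ^B_j` on `ι_B(𝒯_B)`, with `δ^B_j(ι_B(W_r)) = 2πi r_j ι_B(W_r)`. -/
def torusDeriv (θ : ℝ) (j : Fin 2) : L2B θ →ₗ.[ℂ] L2B θ := (derivGraph θ j).toLinearPMap

/-- The component `D⁺ = -i (δ₁ + i δ₂)` of the Dirac operator `D_B`. -/
def diracPlus (θ : ℝ) : L2B θ →ₗ.[ℂ] L2B θ :=
  ((-Complex.I) • (torusDeriv θ 0 + Complex.I • torusDeriv θ 1)).closure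

/-- The component `D⁻ = -i (δ₁ - i δ₂)` of the Dirac operator `D_B`. -/
def diracMinus (θ : ℝ) : L2B θ →ₗ.[ℂ] L2B θ :=
  ((-Complex.I) • (torusDeriv θ 0 - Complex.I • torusDeriv θ 1)).closure

end Torus

/-! ### The covering -/

section Covering

variable (M : Matrix (Fin 2) (Fin 2) ℤ)

/-- The character `x ↦ exp(2πi ⟨M⁻¹ t, x⟩)`. -/
def deckChar (t x : Z2) : ℂ :=
  Complex.exp (2 * Real.pi * Complex.I *
    (((M.map (Int.cast : ℤ → ℝ))⁻¹.mulVec (fun i => (t i : ℝ)) ⬝ᵥ fun i => (x i : ℝ) : ℝ) : ℂ))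

theorem deckChar_norm (t x : Z2) : ‖deckChar M t x‖ = 1 := by
  rw [deckChar, Complex.norm_exp]
  simp

theorem deckChar_add_right (t x y : Z2) :
    deckChar M t (x + y) = deckChar M t x * deckChar M t y := by
  rw [deckChar, deckChar, deckChar, ← Complex.exp_add, ← mul_add, ← Complex.ofReal_add,
    ← dotProduct_add]
  congr 5
  funext i
  simp

theorem deckChar_zero_right (t : Z2) : deckChar M t 0 = 1 := by
  simp [deckChar]

theorem deckChar_neg_right (t x : Z2) : deckChar M t (-x) = star (deckChar M t x) := by
  have h : deckChar M t x * deckChar M t (-x) = 1 := by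
    rw [← deckChar_add_right, add_neg_cancel, deckChar_zero_right]
  have h' : deckChar M t x * star (deckChar M t x) = 1 := by
    rw [Complex.star_def, Complex.mul_conj, Complex.normSq_eq_norm_sq, deckChar_norm]
    simp
  have h0 : deckChar M t x ≠ 0 := by
    intro h0
    rw [h0] at h
    simp at h
  exact mul_left_cancel₀ h0 (h.trans h'.symm)

/-- The diagonal unitary `δ_x ↦ exp(2πi ⟨M⁻¹ t, x⟩) δ_x` on `ℓ²(ℤ²)`. -/
def deckDiag (t : Z2) : Ell2 Z2 ℂ →L[ℂ] Ell2 Z2 ℂ :=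
  weightedShift (Equiv.refl Z2) (fun z => scalarRep (deckChar M t z)) 1 (fun z =>
    (NonUnitalStarAlgHom.norm_apply_le scalarRep _).trans (deckChar_norm M t z).le)

theorem deckDiag_apply (t : Z2) (f : Ell2 Z2 ℂ) (z : Z2) :
    deckDiag M t f z = deckChar M t z * f z := by
  change (algebraMap ℂ (ℂ →L[ℂ] ℂ) (deckChar M t z)) (f z) = _
  simp [Algebra.algebraMap_eq_smul_one]

theorem deckDiag_mem_unitary (t : Z2) : deckDiag M t ∈ unitary (Ell2 Z2 ℂ →L[ℂ] Ell2 Z2 ℂ) := by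
  have h : ∀ z, star (deckChar M t z) * deckChar M t z = 1 := fun z => by
    rw [← deckChar_neg_right, ← deckChar_add_right, neg_add_cancel, deckChar_zero_right]
  have hstar : ∀ f z, star (deckDiag M t) f z = star (deckChar M t z) * f z := by
    intro f z
    have h1 : ⟪lp.single 2 z (1 : ℂ), star (deckDiag M t) f⟫_ℂ =
        ⟪deckDiag M t (lp.single 2 z (1 : ℂ)), f⟫_ℂ := by
      rw [ContinuousLinearMap.star_eq_adjoint, ContinuousLinearMap.adjoint_inner_right]
    have h2 : deckDiag M t (lp.single 2 z (1 : ℂ)) = lp.single 2 z (deckChar M t z) := by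
      apply lp.ext
      funext w
      rw [deckDiag_apply]
      by_cases hw : w = z
      · subst hw
        simp
      · simp [hw]
    rw [h2, lp.inner_single_left, lp.inner_single_left] at h1
    simpa [mul_comm] using h1
  rw [Unitary.mem_iff]
  constructor
  · ext f z
    change star (deckDiag M t) (deckDiag M t f) z = f z
    rw [hstar, deckDiag_apply, ← mul_assoc, h, one_mul]
  · ext f z
    change deckDiag M t (star (deckDiag M t) f) z = f z
    rw [deckDiag_apply, hstar, ← mul_assoc, mul_comm (deckChar M t z), h, one_mul]

/-- Conjugation by the diagonal unitary. -/
def deckConj (t : Z2) :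
    (Ell2 Z2 ℂ →L[ℂ] Ell2 Z2 ℂ) →⋆ₐ[ℂ] (Ell2 Z2 ℂ →L[ℂ] Ell2 Z2 ℂ) :=
  (Unitary.conjStarAlgAut ℂ (Ell2 Z2 ℂ →L[ℂ] Ell2 Z2 ℂ) ⟨deckDiag M t, deckDiag_mem_unitary M t⟩ :
    (Ell2 Z2 ℂ →L[ℂ] Ell2 Z2 ℂ) ≃⋆ₐ[ℂ] (Ell2 Z2 ℂ →L[ℂ] Ell2 Z2 ℂ))

theorem deckConj_leftRegular (θ : ℝ) (t : Z2) (c : ℂ) (x : Z2) :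
    deckConj M t (leftRegular (torusPair θ) scalarRep c x) =
      deckChar M t x • leftRegular (torusPair θ) scalarRep c x := by
  have hc : ∀ f : Ell2 Z2 ℂ, leftRegular (torusPair θ) scalarRep c x (deckDiag M t f) =
      star (deckChar M t x) • deckDiag M t (leftRegular (torusPair θ) scalarRep c x f) := by
    intro f
    apply lp.ext
    funext z
    change scalarRep _ (deckDiag M t f (-x + z)) =
      star (deckChar M t x) * deckDiag M t (leftRegular (torusPair θ) scalarRep c x f) z
    rw [deckDiag_apply, deckDiag_apply, deckChar_add_right, deckChar_neg_right]
    change scalarRep _ _ = _ * (_ * scalarRep _ (f (-x + z)))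
    have hl : ∀ (S : ℂ →L[ℂ] ℂ) (p q r : ℂ), S (p * q * r) = p * (q * S r) := fun S p q r => by
      rw [mul_assoc, ← smul_eq_mul, map_smul, smul_eq_mul, ← smul_eq_mul q, map_smul, smul_eq_mul]
    exact hl _ _ _ _
  have h1 : deckChar M t x * star (deckChar M t x) = 1 := by
    rw [← deckChar_neg_right, ← deckChar_add_right, add_neg_cancel, deckChar_zero_right]
  have hu := Unitary.mem_iff.1 (deckDiag_mem_unitary M t)
  have h2 : leftRegular (torusPair θ) scalarRep c x * deckDiag M t =
      star (deckChar M t x) • (deckDiag M t * leftRegular (torusPair θ) scalarRep c x) :=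
    ContinuousLinearMap.ext hc
  change deckDiag M t * leftRegular (torusPair θ) scalarRep c x * star (deckDiag M t) = _
  have h3 : deckDiag M t * leftRegular (torusPair θ) scalarRep c x =
      deckChar M t x • (leftRegular (torusPair θ) scalarRep c x * deckDiag M t) := by
    rw [h2, smul_smul, h1, one_smul]
  rw [h3, smul_mul_assoc, mul_assoc, hu.2, mul_one]

theorem deckConj_mem (θ : ℝ) (t : Z2) (b : QuantumTorus θ) :
    deckConj M t (torusIncl θ b) ∈ reducedCrossedProduct (torusPair θ) scalarRep := by
  have hcont : Continuous (deckConj M t) := map_continuous (deckConj M t)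
  have hle : StarAlgebra.adjoin ℂ
      (Set.range fun p : ℂ × Z2 => leftRegular (torusPair θ) scalarRep p.1 p.2) ≤
      (reducedCrossedProduct (torusPair θ) scalarRep).comap (deckConj M t) := by
    refine StarAlgebra.adjoin_le ?_
    rintro _ ⟨p, rfl⟩
    change deckConj M t (leftRegular (torusPair θ) scalarRep p.1 p.2) ∈
      reducedCrossedProduct (torusPair θ) scalarRep
    rw [deckConj_leftRegular]
    exact SMulMemClass.smul_mem _ (crossedElem (torusPair θ) scalarRep p.1 p.2).2
  have hcl : IsClosed (((reducedCrossedProduct (torusPair θ) scalarRep).comap (deckConj M t) :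
      StarSubalgebra ℂ (Ell2 Z2 ℂ →L[ℂ] Ell2 Z2 ℂ)) : Set (Ell2 Z2 ℂ →L[ℂ] Ell2 Z2 ℂ)) :=
    IsClosed.preimage hcont (inferInstance : IsClosed
      (reducedCrossedProduct (torusPair θ) scalarRep : Set (Ell2 Z2 ℂ →L[ℂ] Ell2 Z2 ℂ)))
  exact StarSubalgebra.topologicalClosure_minimal hle hcl b.2

/-- The automorphism `γ̃_t` of `B`, with `γ̃_t(W_x) = exp(2πi ⟨M⁻¹ t, x⟩) W_x`. -/
def deckTilde (θ : ℝ) (t : Z2) : QuantumTorus θ →⋆ₐ[ℂ] QuantumTorus θ :=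
  StarAlgHom.codRestrict ((deckConj M t).comp (torusIncl θ))
    (reducedCrossedProduct (torusPair θ) scalarRep) (deckConj_mem M θ t)

theorem deckTilde_W (θ : ℝ) (t x : Z2) : deckTilde M θ t (W θ x) = deckChar M t x • W θ x :=
  torusIncl_injective θ (deckConj_leftRegular M θ t 1 x)

/-- The group `G = ℤ² / M ℤ²`. -/
abbrev Deck : Type := Z2 ⧸ LinearMap.range M.mulVecLin

/-- The dual group `Ĝ`: the class of `s ∈ ℤ²` modulo `Mᵀ ℤ²` stands for the class of `M̂ s` in
`M̂ ℤ² / ℤ²`, where `M̂ = (M⁻¹)ᵀ`, i.e. for the character `t ↦ exp(2πi ⟨M⁻¹ t, s⟩)` of `G`. -/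
abbrev DualDeck : Type := Z2 ⧸ LinearMap.range (M.transpose).mulVecLin

/-- The action `γ` of `G` on `B`, given by `γ̃_t` for any representative `t`. -/
def deckAction (θ : ℝ) (g : Deck M) : QuantumTorus θ →⋆ₐ[ℂ] QuantumTorus θ :=
  deckTilde M θ (Quotient.out g)

/-- The fixed-point algebra `A = B^γ`. -/
def fixedAlg (θ : ℝ) : StarSubalgebra ℂ (QuantumTorus θ) where
  carrier := {b | ∀ g, deckAction M θ g b = b}
  mul_mem' := fun ha hb g => by rw [map_mul, ha g, hb g]
  add_mem' := fun ha hb g => by rw [map_add, ha g, hb g]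
  algebraMap_mem' := fun r g => AlgHomClass.commutes _ r
  star_mem' := fun ha g => by rw [map_star, ha g]

instance fixedAlg_isClosed (θ : ℝ) : IsClosed (fixedAlg M θ : Set (QuantumTorus θ)) := by
  have h : (fixedAlg M θ : Set (QuantumTorus θ)) =
      ⋂ g, {b | deckAction M θ g b = b} := by
    ext b
    simp [fixedAlg]
  rw [h]
  exact isClosed_iInter fun g => isClosed_eq (map_continuous (deckAction M θ g)) continuous_id

theorem W_conj_mem (θ : ℝ) (x : Z2) {a : QuantumTorus θ} (ha : a ∈ fixedAlg M θ) :
    W θ x * a * star (W θ x) ∈ fixedAlg M θ := by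
  intro g
  have h1 : star (deckChar M (Quotient.out g) x) * deckChar M (Quotient.out g) x = 1 := by
    rw [← deckChar_neg_right, ← deckChar_add_right, neg_add_cancel, deckChar_zero_right]
  have h2 : deckAction M θ g (W θ x) = deckChar M (Quotient.out g) x • W θ x :=
    deckTilde_W M θ _ x
  rw [map_mul, map_mul, map_star, ha g, h2, star_smul, smul_mul_assoc, smul_mul_smul_comm,
    mul_comm, h1, one_smul]

theorem deckChar_add_left (t t' x : Z2) :
    deckChar M (t + t') x = deckChar M t x * deckChar M t' x := by
  have h : (fun i => (((t + t') i : ℤ) : ℝ)) = (fun i => (t i : ℝ)) + fun i => (t' i : ℝ) := by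
    funext i
    simp
  rw [deckChar, deckChar, deckChar, ← Complex.exp_add, ← mul_add, ← Complex.ofReal_add, h,
    Matrix.mulVec_add, add_dotProduct]

/-- The section `s : Ĝ → ℤ²`, `s(ĝ) = Mᵀ ζ(ĝ)`, where `ζ(ĝ) ∈ [0,1)²` is the representative of `ĝ`
in the half-open unit square: if `n` is any representative of `ĝ` modulo `Mᵀ ℤ²`, then
`ζ(ĝ) = M̂ n - ⌊M̂ n⌋` and `s(ĝ) = n - Mᵀ ⌊M̂ n⌋`. -/
def sect (g : DualDeck M) : Z2 :=
  Quotient.out g - M.transpose.mulVec fun i =>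
    ⌊((M.map (Int.cast : ℤ → ℝ))⁻¹).transpose.mulVec (fun k => ((Quotient.out g : Z2) k : ℝ)) i⌋

theorem mk_sect (g : DualDeck M) : Submodule.Quotient.mk (sect M g) = g := by
  rw [sect, Submodule.Quotient.mk_sub]
  have h : (Submodule.Quotient.mk (M.transpose.mulVec fun i =>
      ⌊((M.map (Int.cast : ℤ → ℝ))⁻¹).transpose.mulVec
        (fun k => ((Quotient.out g : Z2) k : ℝ)) i⌋) : DualDeck M) = 0 :=
    (Submodule.Quotient.mk_eq_zero _).2 ⟨_, Matrix.mulVecLin_apply _ _⟩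
  rw [h, sub_zero]
  exact Quotient.out_eq g

section Nondeg

variable [hM : Fact (1 < M.det)]

theorem det_real_ne_zero : (M.map (Int.cast : ℤ → ℝ)).det ≠ 0 := by
  have h : (M.map (Int.cast : ℤ → ℝ)).det = (M.det : ℝ) := by
    simp [Matrix.det_fin_two]
  rw [h]
  have := hM.out
  exact_mod_cast (by lia : M.det ≠ 0)

theorem inv_transpose_mulVec (k : Z2) :
    ((M.map (Int.cast : ℤ → ℝ))⁻¹).transpose.mulVec
      (fun i => ((M.transpose.mulVec k i : ℤ) : ℝ)) = fun i => (k i : ℝ) := by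
  have h : (fun i => ((M.transpose.mulVec k i : ℤ) : ℝ)) =
      (M.map (Int.cast : ℤ → ℝ)).transpose.mulVec fun i => (k i : ℝ) := by
    funext i
    simp [Matrix.mulVec, dotProduct, Fin.sum_univ_two]
  rw [h, Matrix.mulVec_mulVec, ← Matrix.transpose_mul,
    Matrix.mul_nonsing_inv _ (isUnit_iff_ne_zero.2 (det_real_ne_zero M)), Matrix.transpose_one,
    Matrix.one_mulVec]

theorem deckChar_range (t k : Z2) : deckChar M t (M.transpose.mulVec k) = 1 := by
  have h : (M.map (Int.cast : ℤ → ℝ))⁻¹.mulVec (fun i => (t i : ℝ)) ⬝ᵥ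
      (fun i => ((M.transpose.mulVec k i : ℤ) : ℝ)) = ((∑ i, t i * k i : ℤ) : ℝ) := by
    rw [dotProduct_comm, Matrix.dotProduct_mulVec, ← Matrix.mulVec_transpose,
      inv_transpose_mulVec, dotProduct_comm]
    simp [dotProduct]
  rw [deckChar, h, Complex.exp_eq_one_iff]
  exact ⟨∑ i, t i * k i, by push_cast; ring⟩

theorem deckChar_range_left (k x : Z2) : deckChar M (M.mulVec k) x = 1 := by
  have h0 : (fun i => ((M.mulVec k i : ℤ) : ℝ)) =
      (M.map (Int.cast : ℤ → ℝ)).mulVec fun i => (k i : ℝ) := by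
    funext i
    simp [Matrix.mulVec, dotProduct, Fin.sum_univ_two]
  rw [deckChar, h0, Matrix.mulVec_mulVec,
    Matrix.nonsing_inv_mul _ (isUnit_iff_ne_zero.2 (det_real_ne_zero M)), Matrix.one_mulVec,
    Complex.exp_eq_one_iff]
  exact ⟨∑ i, k i * x i, by simp [dotProduct]; ring⟩

/-- The action `γ` is given by any representative. -/
theorem deckAction_mk (θ : ℝ) (t : Z2) :
    deckAction M θ (Submodule.Quotient.mk t) = deckTilde M θ t := by
  have h : (Submodule.Quotient.mk (Quotient.out (Submodule.Quotient.mk t : Deck M)) : Deck M) =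
      Submodule.Quotient.mk t := Quotient.out_eq _
  obtain ⟨k, hk⟩ := (Submodule.Quotient.eq _).1 h
  have h1 : ∀ x, deckChar M (Quotient.out (Submodule.Quotient.mk t : Deck M)) x =
      deckChar M t x := fun x => by
    rw [← sub_add_cancel (Quotient.out (Submodule.Quotient.mk t : Deck M)) t, ← hk,
      deckChar_add_left, Matrix.mulVecLin_apply, deckChar_range_left, one_mul]
  have h2 : deckDiag M (Quotient.out (Submodule.Quotient.mk t : Deck M)) = deckDiag M t := by
    ext f z
    rw [deckDiag_apply, deckDiag_apply, h1]
  ext b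
  apply torusIncl_injective
  change deckDiag M (Quotient.out (Submodule.Quotient.mk t : Deck M)) * torusIncl θ b *
    star (deckDiag M (Quotient.out (Submodule.Quotient.mk t : Deck M))) =
    deckDiag M t * torusIncl θ b * star (deckDiag M t)
  rw [h2]

instance : Finite (DualDeck M) := by
  refine Module.finite_of_fg_torsion _ ?_
  intro q
  obtain ⟨x, rfl⟩ := Submodule.Quotient.mk_surjective _ q
  have hd : M.det ≠ 0 := by have := hM.out; lia
  refine ⟨⟨M.det, mem_nonZeroDivisors_of_ne_zero hd⟩, ?_⟩
  change M.det • (Submodule.Quotient.mk x : DualDeck M) = 0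
  rw [← Submodule.Quotient.mk_smul, Submodule.Quotient.mk_eq_zero]
  refine ⟨M.transpose.adjugate.mulVec x, ?_⟩
  rw [Matrix.mulVecLin_apply, Matrix.mulVec_mulVec, Matrix.mul_adjugate, Matrix.det_transpose,
    Matrix.smul_mulVec, Matrix.one_mulVec]

instance : Fintype (DualDeck M) := Fintype.ofFinite _

theorem sect_zero : sect M 0 = 0 := by
  have h : (Submodule.Quotient.mk (Quotient.out (0 : DualDeck M)) : DualDeck M) = 0 :=
    Quotient.out_eq _
  obtain ⟨k, hk⟩ := (Submodule.Quotient.mk_eq_zero _).1 h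
  rw [sect, ← hk, Matrix.mulVecLin_apply, inv_transpose_mulVec]
  simp

theorem deckChar_sect (t : Z2) (j k : DualDeck M) :
    deckChar M t (sect M j + sect M k - sect M (j + k)) = 1 := by
  have h : (Submodule.Quotient.mk (sect M j + sect M k - sect M (j + k)) : DualDeck M) = 0 := by
    rw [Submodule.Quotient.mk_sub, Submodule.Quotient.mk_add, mk_sect, mk_sect, mk_sect, sub_self]
  obtain ⟨l, hl⟩ := (Submodule.Quotient.mk_eq_zero _).1 h
  rw [← hl, Matrix.mulVecLin_apply, deckChar_range]

/-- The frame `μ_ĝ = W_{s(ĝ)}`. -/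
def frame (θ : ℝ) (j : DualDeck M) : unitary (QuantumTorus θ) :=
  ⟨W θ (sect M j), W_mem_unitary θ (sect M j)⟩

/-- The twisting pair `(ρ, σ)` of `Ĝ` on `A` determined by the frame `μ`. -/
def coveringPair (θ : ℝ) : TwistingPair (fixedAlg M θ) (DualDeck M) :=
  frameTwistingPair (fixedAlg M θ) (frame M θ)
    (by ext; simp [frame, sect_zero, W_zero])
    (fun j a ha => W_conj_mem M θ _ ha)
    (fun j a ha => by
      have h := W_conj_mem M θ (-sect M j) ha
      rwa [W_star, neg_neg, ← W_star] at h)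
    (fun j k g => by
      change deckTilde M θ (Quotient.out g)
        (W θ (sect M j) * W θ (sect M k) * star (W θ (sect M (j + k)))) =
        W θ (sect M j) * W θ (sect M k) * star (W θ (sect M (j + k)))
      rw [W_star, W_mul, smul_mul_assoc, W_mul, map_smul, map_smul, deckTilde_W,
        ← sub_eq_add_neg, deckChar_sect, one_smul])

/-- The element `W_{Mᵀ x}` of `A`. -/
def WA (θ : ℝ) (x : Z2) : fixedAlg M θ :=
  ⟨W θ (M.transpose.mulVec x), fun g => by
    change deckTilde M θ (Quotient.out g) _ = _
    rw [deckTilde_W, deckChar_range, one_smul]⟩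

/-- The smooth subalgebra `𝒯_A = A ∩ 𝒯_B` of `A`. -/
def smoothFixed (θ : ℝ) : Set (fixedAlg M θ) := {a | (a : QuantumTorus θ) ∈ smoothTorus θ}

/-- `ε(x₁, x₂) = [[0, x₁ - i x₂], [x₁ + i x₂, 0]]`. -/
def eps (x : Z2) : Matrix (Fin 2) (Fin 2) ℂ :=
  !![0, (x 0 : ℂ) - Complex.I * x 1; (x 0 : ℂ) + Complex.I * x 1, 0]

/-- The length function `ℓ(ĝ) = ε(s(ĝ))` on `Ĝ`. -/
def lengthFun (j : DualDeck M) : Matrix (Fin 2) (Fin 2) ℂ := eps (sect M j)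

/-- The Dirac operator `D̃` of the equivariant construction. -/
def diracTilde (θ : ℝ) : EquivHilb (DualDeck M) (L2B θ) →ₗ.[ℂ] EquivHilb (DualDeck M) (L2B θ) :=
  equivDirac (diracPlus θ) (diracMinus θ) (lengthFun M)

/-- The operator `(π̂ × L̂)(a δ_j)` of the equivariant construction from `π = π_B|_A` and
`U(j) = π_B(μ_j)`. -/
def hatRep (θ : ℝ) (a : fixedAlg M θ) (j : DualDeck M) :
    EquivHilb (DualDeck M) (L2B θ) →L[ℂ] EquivHilb (DualDeck M) (L2B θ) :=
  equivRep (piTau θ a * piTau θ (frame M θ j)) (piTau θ a * piTau θ (frame M θ j)) j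

/-- The explicit formula for a representation of `A ⋊_r Ĝ` on the elements `W_{Mᵀx} δ_j` and the
vectors `(ι_B(W_m) ⊗ δ_g ⊗ v, ι_B(W_n) ⊗ δ_h ⊗ w)`. -/
def HasExplicitFormula {K : Type*} [NormedAddCommGroup K] [InnerProductSpace ℂ K] [CompleteSpace K]
    (θ : ℝ) (π₀ : fixedAlg M θ →⋆ₐ[ℂ] (K →L[ℂ] K))
    (R : reducedCrossedProduct (coveringPair M θ) π₀ →⋆ₐ[ℂ]
      (EquivHilb (DualDeck M) (L2B θ) →L[ℂ] EquivHilb (DualDeck M) (L2B θ))) : Prop :=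
  ∀ (x : Z2) (j : DualDeck M) (m n : Z2) (g h : DualDeck M) (v w : EuclideanSpace ℂ (Fin 2)),
    R (crossedElem (coveringPair M θ) π₀ (WA M θ x) j)
        (WithLp.toLp 2 (tens (iotaB θ (W θ m)) g v, tens (iotaB θ (W θ n)) h w)) =
      WithLp.toLp 2
        (Complex.exp (-(Real.pi * Complex.I) *
            ((thetaForm θ (M.transpose.mulVec x) (sect M j) +
              thetaForm θ (M.transpose.mulVec x + sect M j) m : ℝ) : ℂ)) •
          tens (iotaB θ (W θ (m + M.transpose.mulVec x + sect M j))) (j + g) v,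
        Complex.exp (-(Real.pi * Complex.I) *
            ((thetaForm θ (M.transpose.mulVec x) (sect M j) +
              thetaForm θ (M.transpose.mulVec x + sect M j) n : ℝ) : ℂ)) •
          tens (iotaB θ (W θ (n + M.transpose.mulVec x + sect M j))) (j + h) w)

end Nondeg

end Covering

end QTorus

end

open QTorus

noncomputable section

namespace QTorus

/-! ### Bounded commutators -/

section Commutator

variable {H : Type*} [NormedAddCommGroup H] [InnerProductSpace ℂ H]

/-! The proof rests on two facts: `B` is graded by `Ĝ`, and in the Fourier basis every operator
involved is block diagonal or a convergent series of weighted shifts.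

Algebra. The spectral subspaces of `γ` grade `B` by `Ĝ`. The piece of degree 0 is `A`, and `μ_j` is
a unitary of degree `j`, so the piece of degree `j` is `A μ_j` and `B` is the finite direct sum of
these pieces. A ⋆-homomorphism on `B` can therefore be assembled from linear maps on the pieces
(`gradedHom`). Sending `b` of degree `j` to the left regular operator of `(b μ_j^*) δ_j` produces
the matrix entries `π₀(μ_z b μ_{z+j}^*)`, whose products telescope. The resulting `regHom` is
injective because `π₀` is, hence isometric with closed range, and its range contains the generators;
so it identifies `B` with the crossed product, and `Φ` is its inverse. Sending `b` of degree `j` to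
`π_τ(b) ⊗ λ_j ⊗ 1` on both summands gives `hatHom`, and `π̂ × L̂` is `hatHom` after `Φ`. Since `Φ`
carries the smooth crossed product exactly onto `𝒯_B` (`crossedSmooth_eq`), the analytic claims
concern `B` alone.

Spectrum. The vectors `ι_B(W_n)` form a Hilbert basis, and `D^±` are the maximal diagonal operators
with eigenvalues `2π(n₁ ± i n₂)`. Hence `D̃` splits into Hermitian 4 × 4 blocks indexed by `(n, g)`.
The opposite signs of the two length terms cancel the cross terms, so each block squares to the
scalar `λ² = |s(g)|² + 4π²|n|²`. Self-adjointness follows from maximality of the domain, `|D̃|` is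
`λ` on each block, and compactness follows from `λ → ∞`, which holds because `Ĝ` is finite.

Regularity. `W_r` is a weighted shift of the index set. Its commutator with a block diagonal
operator is a weighted shift along the same permutation, with a weight governed by the difference of
two blocks whose indices differ by `r`; for both `D̃` and `|D̃|` this difference is `O(1 + |r|²)`
uniformly. Each further commutator thus costs one power of `1 + |r|²`, which Schwartz coefficients
absorb, and closedness of the operators lets the commutator pass through the series. -/

theorem isBddCommutator_iff {D : H →ₗ.[ℂ] H} {S C : H →L[ℂ] H} :
    IsBddCommutator D S C ↔ ∀ x y, (x, y) ∈ D.graph → (S x, C x + S y) ∈ D.graph := by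
  constructor
  · intro h x y hxy
    obtain ⟨x', rfl, rfl⟩ := D.mem_graph_iff.1 hxy
    obtain ⟨hS, hC⟩ := h x'
    rw [← hC, sub_add_cancel]
    exact D.mem_graph ⟨S x', hS⟩
  · intro h x
    obtain ⟨z, hz, hz'⟩ := D.mem_graph_iff.1 (h _ _ (D.mem_graph x))
    have hz : (z : H) = S x := hz
    have hz' : D z = C x + S (D x) := hz'
    obtain ⟨z, hzd⟩ := z
    subst hz
    exact ⟨hzd, by rw [hz', add_sub_cancel_right]⟩

/-- In graph form a bounded commutator says that certain points lie in the graph. For fixed `(x, y)`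
these points depend additively on the pair `(S, C)`, so partial sums stay in the graph and a closed
graph contains their limit. -/
theorem IsBddCommutator.hasSum {D : H →ₗ.[ℂ] H} (hD : D.IsClosed) {ι : Type*}
    {S C : ι → H →L[ℂ] H} {s c : H →L[ℂ] H} (h : ∀ i, IsBddCommutator D (S i) (C i))
    (hs : HasSum S s) (hc : HasSum C c) : IsBddCommutator D s c := by
  rw [isBddCommutator_iff]
  intro x y hxy
  have hs' : ∀ v, HasSum (fun i => S i v) (s v) := fun v =>
    (ContinuousLinearMap.apply ℂ H v).hasSum hs
  have hc' : ∀ v, HasSum (fun i => C i v) (c v) := fun v =>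
    (ContinuousLinearMap.apply ℂ H v).hasSum hc
  have key : HasSum (fun i => (S i x, C i x + S i y)) (s x, c x + s y) :=
    (hs' x).prodMk ((hc' x).add (hs' y))
  refine hD.mem_of_tendsto key (Filter.Eventually.of_forall fun F => ?_)
  exact Submodule.sum_mem _ fun i _ => isBddCommutator_iff.1 (h i) x y hxy

end Commutator

/-! ### Block diagonal operators -/

section Block

variable {I K H : Type*} [NormedAddCommGroup K] [InnerProductSpace ℂ K]
  [NormedAddCommGroup H] [InnerProductSpace ℂ H]

/-- The graph of the block diagonal operator with blocks `L i`, in the coordinates given by `U`. -/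
def blockGraph (U : H ≃ₗᵢ[ℂ] Ell2 I K) (L : I → K →L[ℂ] K) : Submodule ℂ (H × H) where
  carrier := {p | ∀ i, U p.2 i = L i (U p.1 i)}
  add_mem' := fun {p q} hp hq i => by
    simp only [Prod.fst_add, Prod.snd_add, map_add, lp.coeFn_add, Pi.add_apply, hp i, hq i]
  zero_mem' := fun i => by simp
  smul_mem' := fun c p hp i => by
    simp only [Prod.smul_fst, Prod.smul_snd, map_smul, lp.coeFn_smul, Pi.smul_apply, hp i]

/-- The block diagonal operator with blocks `L i` on its maximal domain, in the coordinates given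
by `U`. -/
def blockOp (U : H ≃ₗᵢ[ℂ] Ell2 I K) (L : I → K →L[ℂ] K) : H →ₗ.[ℂ] H :=
  (blockGraph U L).toLinearPMap

/-- `Submodule.toLinearPMap` has the given submodule as its graph only if that submodule is
single-valued; here a zero first entry kills every block of the second. -/
theorem mem_graph_blockOp {U : H ≃ₗᵢ[ℂ] Ell2 I K} {L : I → K →L[ℂ] K} {x y : H} :
    (x, y) ∈ (blockOp U L).graph ↔ ∀ i, U y i = L i (U x i) := by
  rw [blockOp, Submodule.toLinearPMap_graph_eq]
  · rfl
  · rintro ⟨x, y⟩ h hx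
    have hx : x = 0 := hx
    subst hx
    refine U.injective (lp.ext (funext fun i => ?_))
    rw [h i]
    simp

theorem blockOp_isClosed (U : H ≃ₗᵢ[ℂ] Ell2 I K) (L : I → K →L[ℂ] K) : (blockOp U L).IsClosed := by
  have h : ((blockOp U L).graph : Set (H × H)) = ⋂ i, {p : H × H | U p.2 i = L i (U p.1 i)} := by
    ext ⟨x, y⟩
    rw [SetLike.mem_coe, mem_graph_blockOp, Set.mem_iInter]
    rfl
  have hev : ∀ i, Continuous fun x : H => U x i := fun i =>
    (lp.evalCLM ℂ (fun _ : I => K) 2 i).continuous.comp U.continuous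
  rw [LinearPMap.IsClosed, h]
  exact isClosed_iInter fun i => isClosed_eq ((hev i).comp continuous_snd)
    ((L i).continuous.comp ((hev i).comp continuous_fst))

open Classical in
theorem mem_graph_blockOp_single (U : H ≃ₗᵢ[ℂ] Ell2 I K) (L : I → K →L[ℂ] K) (i : I) (v : K) :
    (U.symm (lp.single 2 i v), U.symm (lp.single 2 i (L i v))) ∈ (blockOp U L).graph := by
  rw [mem_graph_blockOp]
  intro k
  rw [U.apply_symm_apply, U.apply_symm_apply]
  by_cases h : k = i
  · subst h; simp
  · simp [h]

theorem blockOp_dense_domain (U : H ≃ₗᵢ[ℂ] Ell2 I K) (L : I → K →L[ℂ] K) :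
    Dense ((blockOp U L).domain : Set H) := by
  classical
  intro x
  have h := (U.symm.toContinuousLinearEquiv : Ell2 I K →L[ℂ] H).hasSum
    (lp.hasSum_single (p := 2) (by norm_num) (U x))
  have hx : (U.symm.toContinuousLinearEquiv : Ell2 I K →L[ℂ] H) (U x) = x :=
    U.symm_apply_apply x
  rw [hx] at h
  refine mem_closure_of_tendsto h (Filter.Eventually.of_forall fun F => ?_)
  exact Submodule.sum_mem _ fun i _ =>
    LinearPMap.mem_domain_of_mem_graph (mem_graph_blockOp_single U L i (U x i))

/-- Testing a point of the adjoint graph against vectors supported in a single block yields exactly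
the block equations and nothing more, which is the definition of the maximal domain. The converse
inclusion is symmetry of each block, applied termwise to the inner products. -/
theorem blockOp_isSelfAdjoint [CompleteSpace K] [CompleteSpace H] (U : H ≃ₗᵢ[ℂ] Ell2 I K)
    {L : I → K →L[ℂ] K} (hL : ∀ i, IsSelfAdjoint (L i)) : IsSelfAdjoint (blockOp U L) := by
  classical
  have hsymm : ∀ i v w, ⟪L i v, w⟫_ℂ = ⟪v, L i w⟫_ℂ := fun i v w => by
    rw [← ContinuousLinearMap.adjoint_inner_right, (ContinuousLinearMap.isSelfAdjoint_iff'.1 (hL i))]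
  rw [LinearPMap.isSelfAdjoint_def]
  apply LinearPMap.eq_of_eq_graph
  rw [LinearPMap.adjoint_graph_eq_graph_adjoint (blockOp_dense_domain U L)]
  ext ⟨y, z⟩
  rw [Submodule.mem_adjoint_iff, mem_graph_blockOp]
  constructor
  · intro h i
    refine ext_inner_left ℂ fun v => ?_
    have h1 := sub_eq_zero.1 (h _ _ (mem_graph_blockOp_single U L i v))
    rw [← U.inner_map_map, ← U.inner_map_map (U.symm _) z, U.apply_symm_apply, U.apply_symm_apply,
      lp.inner_single_left, lp.inner_single_left, hsymm] at h1
    exact h1.symm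
  · intro h a b hab
    rw [mem_graph_blockOp] at hab
    rw [sub_eq_zero, ← U.inner_map_map, ← U.inner_map_map a z, lp.inner_eq_tsum, lp.inner_eq_tsum]
    refine tsum_congr fun i => ?_
    rw [hab i, hsymm, h i]

/-- The weighted shift in the coordinates given by `U`. -/
def blockShift (U : H ≃ₗᵢ[ℂ] Ell2 I K) (e : I ≃ I) (Q : I → K →L[ℂ] K) (c : ℝ)
    (hQ : ∀ z, ‖Q z‖ ≤ c) : H →L[ℂ] H :=
  (U.symm.toContinuousLinearEquiv : Ell2 I K →L[ℂ] H) ∘L weightedShift e Q c hQ ∘L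
    (U.toContinuousLinearEquiv : H →L[ℂ] Ell2 I K)

theorem blockShift_apply (U : H ≃ₗᵢ[ℂ] Ell2 I K) (e : I ≃ I) (Q : I → K →L[ℂ] K) (c : ℝ)
    (hQ : ∀ z, ‖Q z‖ ≤ c) (x : H) (i : I) :
    U (blockShift U e Q c hQ x) i = Q i (U x (e i)) := by
  change U (U.symm (weightedShift e Q c hQ (U x))) i = _
  rw [U.apply_symm_apply, weightedShift_apply]

theorem norm_blockShift_le (U : H ≃ₗᵢ[ℂ] Ell2 I K) (e : I ≃ I) (Q : I → K →L[ℂ] K) (c : ℝ)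
    (hQ : ∀ z, ‖Q z‖ ≤ c) : ‖blockShift U e Q c hQ‖ ≤ |c| := by
  refine ContinuousLinearMap.opNorm_le_bound _ (abs_nonneg c) fun x => ?_
  change ‖U.symm (weightedShift e Q c hQ (U x))‖ ≤ _
  rw [U.symm.norm_map, ← U.norm_map x]
  exact (ContinuousLinearMap.le_opNorm _ _).trans
    (mul_le_mul_of_nonneg_right (LinearMap.mkContinuous_norm_le _ (abs_nonneg _) _)
      (norm_nonneg _))

/-- The basic commutator computation. Boundedness of `Q'` also settles the domain question: `C x + S
y` is a genuine `ℓ²` vector with the blocks required of the image of `S x`. -/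
theorem isBddCommutator_blockShift (U : H ≃ₗᵢ[ℂ] Ell2 I K) (L : I → K →L[ℂ] K) (e : I ≃ I)
    {Q Q' : I → K →L[ℂ] K} {c c' : ℝ} (hQ : ∀ z, ‖Q z‖ ≤ c) (hQ' : ∀ z, ‖Q' z‖ ≤ c')
    (h : ∀ z, Q' z = L z * Q z - Q z * L (e z)) :
    IsBddCommutator (blockOp U L) (blockShift U e Q c hQ) (blockShift U e Q' c' hQ') := by
  rw [isBddCommutator_iff]
  intro x y hxy
  rw [mem_graph_blockOp] at hxy ⊢
  intro i
  rw [map_add, lp.coeFn_add, Pi.add_apply, blockShift_apply, blockShift_apply, blockShift_apply,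
    h, hxy]
  simp

theorem lp_ext_of_isometry (U : H ≃ₗᵢ[ℂ] Ell2 I K) {x y : H} (h : ∀ i, U x i = U y i) : x = y :=
  U.injective (lp.ext (funext h))

/-- A block diagonal operator with scalar blocks tending to zero is compact. -/
theorem isCompactOperator_blockShift [FiniteDimensional ℂ K] [CompleteSpace H]
    (U : H ≃ₗᵢ[ℂ] Ell2 I K)
    {r : I → ℝ} (hr : Filter.Tendsto r Filter.cofinite (nhds 0)) (c : ℝ)
    (hc : ∀ i, ‖((r i : ℂ) • (1 : K →L[ℂ] K))‖ ≤ c) :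
    IsCompactOperator (blockShift U (Equiv.refl I) (fun i => (r i : ℂ) • (1 : K →L[ℂ] K)) c hc) := by
  classical
  set T := blockShift U (Equiv.refl I) (fun i => (r i : ℂ) • (1 : K →L[ℂ] K)) c hc with hT
  have hn : ∀ a : ℝ, ‖((a : ℂ) • (1 : K →L[ℂ] K))‖ ≤ |a| := fun a => by
    rw [norm_smul, Complex.norm_real, Real.norm_eq_abs]
    exact mul_le_of_le_one_right (abs_nonneg _) ContinuousLinearMap.norm_id_le
  -- The projection onto one block, written so as to factor through the identity of the
  -- finite-dimensional space `K`, which is compact.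
  let P : I → H →L[ℂ] H := fun i =>
    ((U.symm.toContinuousLinearEquiv : Ell2 I K →L[ℂ] H) ∘L
      lp.singleContinuousLinearMap ℂ (fun _ : I => K) 2 i) ∘L
      ((1 : K →L[ℂ] K) ∘L
      (lp.evalCLM ℂ (fun _ : I => K) 2 i ∘L (U.toContinuousLinearEquiv : H →L[ℂ] Ell2 I K)))
  have hP : ∀ i x, U (P i x) = lp.single 2 i (U x i) := fun i x => U.apply_symm_apply _
  have hPc : ∀ i, IsCompactOperator (P i) := fun i => by
    have : ProperSpace K := FiniteDimensional.proper ℂ K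
    have h1 : IsCompactOperator (1 : K →L[ℂ] K) :=
      ⟨Metric.closedBall 0 1, isCompact_closedBall _ _,
        Metric.closedBall_mem_nhds (0 : K) one_pos⟩
    have h2 := h1.comp_clm (lp.evalCLM ℂ (fun _ : I => K) 2 i ∘L
      (U.toContinuousLinearEquiv : H →L[ℂ] Ell2 I K))
    exact h2.clm_comp ((U.symm.toContinuousLinearEquiv : Ell2 I K →L[ℂ] H) ∘L
      lp.singleContinuousLinearMap ℂ (fun _ : I => K) 2 i)
  let TF : Finset I → H →L[ℂ] H := fun F => ∑ i ∈ F, (r i : ℂ) • P i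
  have hTF : ∀ F, IsCompactOperator (TF F) := fun F => by
    change TF F ∈ compactOperator (RingHom.id ℂ) H H
    refine Submodule.sum_mem _ fun i _ => Submodule.smul_mem _ _ (hPc i)
  refine isCompactOperator_of_tendsto (l := Filter.atTop) (F := TF) ?_
    (Filter.Eventually.of_forall hTF)
  rw [Metric.tendsto_nhds]
  intro ε hε
  have hev := (Metric.tendsto_nhds.1 hr) (ε / 2) (half_pos hε)
  rw [Filter.eventually_cofinite] at hev
  filter_upwards [Filter.eventually_ge_atTop hev.toFinset] with F hF
  have hb : ∀ i, ‖(((if i ∈ F then 0 else r i : ℝ) : ℂ) • (1 : K →L[ℂ] K))‖ ≤ ε / 2 := fun i => by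
    refine (hn _).trans ?_
    by_cases hi : i ∈ F
    · simp [hi, (half_pos hε).le]
    · rw [if_neg hi]
      by_contra hlt
      refine hi (hF ?_)
      rw [Set.Finite.mem_toFinset, Set.mem_ofPred_eq, Real.dist_eq, sub_zero]
      exact fun h => hlt h.le
  -- The error of the finite truncation is again block diagonal, with the blocks in `F` deleted, so
  -- its norm is controlled by the remaining `r i`, all at most `ε / 2`.
  have hdiff : T - TF F = blockShift U (Equiv.refl I)
      (fun i => ((if i ∈ F then 0 else r i : ℝ) : ℂ) • (1 : K →L[ℂ] K)) (ε / 2) hb := by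
    ext x
    refine lp_ext_of_isometry U fun k => ?_
    rw [blockShift_apply, sub_apply, map_sub, lp.coeFn_sub, Pi.sub_apply, hT, blockShift_apply]
    have : U (TF F x) k = if k ∈ F then (r k : ℂ) • U x k else 0 := by
      simp only [TF, sum_apply, map_sum, smul_apply, map_smul, hP]
      rw [lp.coeFn_sum, Finset.sum_apply]
      rw [← Finset.sum_ite_eq F k (fun i => (r i : ℂ) • U x i)]
      refine Finset.sum_congr rfl fun i _ => ?_
      rw [lp.coeFn_smul, Pi.smul_apply]
      by_cases h : k = i
      · subst h; simp
      · simp [h]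
    rw [this]
    by_cases hk : k ∈ F <;> simp [hk]
  rw [dist_comm, dist_eq_norm, hdiff]
  refine (norm_blockShift_le _ _ _ _ _).trans_lt ?_
  rw [abs_of_pos (half_pos hε)]
  exact half_lt_self hε

/-! ### Block diagonal operators whose blocks have scalar squares -/

section Square

variable [CompleteSpace K] [CompleteSpace H] {L : I → K →L[ℂ] K} {lam : I → ℝ}

/-- Because `‖L v‖² = ⟪v, L² v⟫`. It serves to identify the domain of the square, and later to
compare the eigenvalues of `|D̃|` with the blocks of `D̃`. -/
theorem norm_apply_of_sq_eq_smul {L : K →L[ℂ] K} (hL : IsSelfAdjoint L) {a : ℝ} (ha : 0 ≤ a)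
    (h : L * L = ((a ^ 2 : ℝ) : ℂ) • 1) (v : K) : ‖L v‖ = a * ‖v‖ := by
  have h1 : ⟪L v, L v⟫_ℂ = ((a ^ 2 : ℝ) : ℂ) * ⟪v, v⟫_ℂ := by
    rw [← ContinuousLinearMap.adjoint_inner_right, ContinuousLinearMap.isSelfAdjoint_iff'.1 hL]
    change ⟪v, (L * L) v⟫_ℂ = _
    rw [h, smul_apply, inner_smul_right]
    rfl
  rw [inner_self_eq_norm_sq_to_K, inner_self_eq_norm_sq_to_K] at h1
  have h2 : ‖L v‖ ^ 2 = (a * ‖v‖) ^ 2 := by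
    rw [mul_pow]
    simp only [RCLike.ofReal_eq_complex_ofReal] at h1
    exact_mod_cast h1
  exact (sq_eq_sq₀ (norm_nonneg _) (mul_nonneg ha (norm_nonneg _))).1 h2

/-- The square remembers only the scalars `lam i`, not the blocks themselves. This is what
identifies the absolute value and the resolvent. -/
theorem sqGraph_blockOp (U : H ≃ₗᵢ[ℂ] Ell2 I K) (hL : ∀ i, IsSelfAdjoint (L i))
    (h0 : ∀ i, 0 ≤ lam i) (hsq : ∀ i, L i * L i = ((lam i ^ 2 : ℝ) : ℂ) • 1) :
    sqGraph (blockOp U L) = {p | ∀ i, U p.2 i = ((lam i ^ 2 : ℝ) : ℂ) • U p.1 i} := by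
  have hsq' : ∀ i v, L i (L i v) = ((lam i ^ 2 : ℝ) : ℂ) • v := fun i v => by
    change (L i * L i) v = _
    rw [hsq]
    rfl
  ext ⟨x, z⟩
  simp only [sqGraph, Set.mem_ofPred_eq, mem_graph_blockOp]
  constructor
  · rintro ⟨y, h1, h2⟩ i
    rw [h2, h1, hsq']
  · intro h
    -- The intermediate vector of `D²` must itself be square summable: `‖L i x_i‖² = lam i² ‖x_i‖² =
    -- |⟪x_i, z_i⟫|`, which is summable since `x` and `z` are in `ℓ²`.
    have hmem : Memℓp (fun i => L i (U x i)) 2 := by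
      have hs : ∀ i, ‖L i (U x i)‖ ^ (2 : ENNReal).toReal = ‖⟪U x i, U z i⟫_ℂ‖ := fun i => by
        rw [h i, inner_smul_right, inner_self_eq_norm_sq_to_K,
          norm_apply_of_sq_eq_smul (hL i) (h0 i) (hsq i)]
        simp [mul_pow]
      have hs' : Summable fun i => ⟪U x i, U z i⟫_ℂ :=
        lp.summable_inner (𝕜 := ℂ) (G := fun _ : I => K) (U x) (U z)
      have hs'' : Summable fun i => ‖L i (U x i)‖ ^ (2 : ENNReal).toReal :=
        (summable_congr hs).2 hs'.norm
      exact memℓp_gen hs''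
    refine ⟨U.symm ⟨_, hmem⟩, fun i => ?_, fun i => ?_⟩
    · rw [U.apply_symm_apply]
    · rw [U.apply_symm_apply, h i]
      exact (hsq' i _).symm

theorem isSelfAdjoint_real_smul_one (a : ℝ) : IsSelfAdjoint ((a : ℂ) • (1 : K →L[ℂ] K)) := by
  rw [isSelfAdjoint_iff, star_smul, star_one]
  simp

theorem isAbs_blockOp (U : H ≃ₗᵢ[ℂ] Ell2 I K) (hL : ∀ i, IsSelfAdjoint (L i))
    (h0 : ∀ i, 0 ≤ lam i) (hsq : ∀ i, L i * L i = ((lam i ^ 2 : ℝ) : ℂ) • 1) :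
    IsAbs (blockOp U L) (blockOp U fun i => (lam i : ℂ) • 1) := by
  refine ⟨blockOp_isSelfAdjoint U fun i => isSelfAdjoint_real_smul_one _, fun x => ?_, ?_⟩
  · have hx := mem_graph_blockOp.1 ((blockOp U fun i => (lam i : ℂ) • (1 : K →L[ℂ] K)).mem_graph x)
    rw [← U.inner_map_map, lp.inner_eq_tsum]
    refine tsum_nonneg fun i => ?_
    rw [hx i, smul_apply, inner_smul_right]
    refine mul_nonneg (by exact_mod_cast h0 i) ?_
    change 0 ≤ ⟪U (x : H) i, U (x : H) i⟫_ℂ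
    rw [inner_self_eq_norm_sq_to_K]
    exact pow_nonneg (by simp) 2
  · rw [sqGraph_blockOp U hL h0 hsq, sqGraph_blockOp (lam := lam) U
      (fun i => isSelfAdjoint_real_smul_one _) h0]
    intro i
    rw [smul_mul_smul_comm, one_mul, ← sq]
    push_cast
    rfl

/-- The operator is multiplication by `(1 + lam i²)^{-1/2}` on each block; these scalars tend to
zero, and finite-dimensional blocks make it compact. -/
theorem exists_isInvSqrtOneAddSq_blockOp [FiniteDimensional ℂ K] (U : H ≃ₗᵢ[ℂ] Ell2 I K)
    (hL : ∀ i, IsSelfAdjoint (L i)) (h0 : ∀ i, 0 ≤ lam i)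
    (hsq : ∀ i, L i * L i = ((lam i ^ 2 : ℝ) : ℂ) • 1)
    (hlim : Filter.Tendsto lam Filter.cofinite Filter.atTop) :
    ∃ R : H →L[ℂ] H, IsInvSqrtOneAddSq (blockOp U L) R ∧ IsCompactOperator R := by
  have hpos : ∀ i, 0 < 1 + lam i ^ 2 := fun i => by positivity
  set r : I → ℝ := fun i => (Real.sqrt (1 + lam i ^ 2))⁻¹ with hr
  have hr0 : ∀ i, 0 ≤ r i := fun i => by positivity
  have hr2 : ∀ i, r i * r i = (1 + lam i ^ 2)⁻¹ := fun i => by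
    rw [hr]
    dsimp only
    rw [← mul_inv, Real.mul_self_sqrt (hpos i).le]
  have hr1 : ∀ i, r i ≤ 1 := fun i => by
    refine inv_le_one_of_one_le₀ ?_
    rw [Real.one_le_sqrt]
    nlinarith [sq_nonneg (lam i)]
  have hc : ∀ i, ‖((r i : ℂ) • (1 : K →L[ℂ] K))‖ ≤ 1 := fun i => by
    rw [norm_smul, Complex.norm_real, Real.norm_eq_abs, abs_of_nonneg (hr0 i)]
    exact mul_le_one₀ (hr1 i) (norm_nonneg _) ContinuousLinearMap.norm_id_le
  have hlim0 : Filter.Tendsto r Filter.cofinite (nhds 0) := by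
    refine (Filter.Tendsto.comp tendsto_inv_atTop_zero ?_)
    refine Filter.tendsto_atTop_mono (fun i => ?_) hlim
    exact Real.le_sqrt_of_sq_le (by linarith)
  refine ⟨blockShift U (Equiv.refl I) (fun i => (r i : ℂ) • 1) 1 hc, ⟨?_, fun x => ?_⟩,
    isCompactOperator_blockShift U hlim0 1 hc⟩
  · set R := blockShift U (Equiv.refl I) (fun i => (r i : ℂ) • (1 : K →L[ℂ] K)) 1 hc with hR
    have happ : ∀ x i, U (R x) i = (r i : ℂ) • U x i := fun x i => by
      rw [hR, blockShift_apply]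
      rfl
    rw [ContinuousLinearMap.isPositive_iff_complex]
    intro x
    have h1 : ⟪R x, x⟫_ℂ = ((∑' i, r i * ‖U x i‖ ^ 2 : ℝ) : ℂ) := by
      rw [← U.inner_map_map, lp.inner_eq_tsum, Complex.ofReal_tsum]
      refine tsum_congr fun i => ?_
      rw [happ, inner_smul_left, inner_self_eq_norm_sq_to_K]
      simp
    rw [h1]
    refine ⟨by simp, ?_⟩
    simp only [Complex.ofReal_re, RCLike.re_to_complex]
    exact tsum_nonneg fun i => mul_nonneg (hr0 i) (sq_nonneg _)
  · rw [sqGraph_blockOp U hL h0 hsq]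
    intro i
    simp only [map_sub, lp.coeFn_sub, Pi.sub_apply, blockShift_apply, smul_apply, one_apply_eq_self,
      Equiv.refl_apply, smul_smul]
    have h1 : U x i = (1 : ℂ) • U x i := (one_smul _ _).symm
    nth_rewrite 1 [h1]
    rw [← sub_smul]
    congr 1
    -- What remains is the scalar identity `1 - (1 + λ²)⁻¹ = λ² (1 + λ²)⁻¹`.
    rw [← Complex.ofReal_mul, hr2, ← Complex.ofReal_mul, ← Complex.ofReal_one,
      ← Complex.ofReal_sub, Complex.ofReal_inj]
    have := (hpos i).ne'
    field_simp
    ring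

end Square

end Block

/-! ### The Fourier basis of `L²(B, τ_B)` -/

section Fourier

/-- The ⋆-subalgebra of `B` spanned by the `W_x`. -/
def spanW (θ : ℝ) : StarSubalgebra ℂ (QuantumTorus θ) where
  carrier := Submodule.span ℂ (Set.range (W θ))
  mul_mem' := fun {a b} ha hb => by
    refine Submodule.span_induction₂ (p := fun a b _ _ => a * b ∈ Submodule.span ℂ (Set.range (W θ)))
      ?_ ?_ ?_ ?_ ?_ ?_ ?_ ha hb
    · rintro _ _ ⟨x, rfl⟩ ⟨y, rfl⟩
      rw [W_mul]
      exact Submodule.smul_mem _ _ (Submodule.subset_span ⟨_, rfl⟩)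
    · intro y _; simp
    · intro x _; simp
    · intro x y z _ _ _ h1 h2
      rw [add_mul]; exact add_mem h1 h2
    · intro x y z _ _ _ h1 h2
      rw [mul_add]; exact add_mem h1 h2
    · intro r x y _ _ h
      rw [smul_mul_assoc]; exact Submodule.smul_mem _ _ h
    · intro r x y _ _ h
      rw [mul_smul_comm]; exact Submodule.smul_mem _ _ h
  add_mem' := fun ha hb => add_mem ha hb
  algebraMap_mem' := fun r => by
    rw [Algebra.algebraMap_eq_smul_one, ← W_zero]
    exact Submodule.smul_mem _ _ (Submodule.subset_span ⟨_, rfl⟩)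
  star_mem' := fun {a} ha => by
    refine Submodule.span_induction (p := fun a _ => star a ∈ Submodule.span ℂ (Set.range (W θ)))
      ?_ ?_ ?_ ?_ ha
    · rintro _ ⟨x, rfl⟩
      rw [W_star]
      exact Submodule.subset_span ⟨_, rfl⟩
    · simp
    · intro x y _ _ hx hy
      rw [star_add]; exact add_mem hx hy
    · intro c x _ hx
      rw [star_smul]; exact Submodule.smul_mem _ _ hx

theorem leftRegular_eq_smul_W (θ : ℝ) (c : ℂ) (x : Z2) :
    leftRegular (torusPair θ) scalarRep c x = torusIncl θ (c • W θ x) := by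
  rw [map_smul]
  ext f z
  change scalarRep (c * sigmaTheta θ (-z) x) (f (-x + z)) =
    c * scalarRep (1 * sigmaTheta θ (-z) x) (f (-x + z))
  rw [map_mul, map_mul, map_one, one_mul]
  change algebraMap ℂ (ℂ →L[ℂ] ℂ) c _ = _
  rw [Algebra.algebraMap_eq_smul_one]
  rfl

/-- Products and adjoints of the `W_x` are multiples of some `W_y`, so their span is already the
⋆-algebra generated by the operators `c δ_x`, whose closure is `B`. -/
theorem dense_spanW (θ : ℝ) :
    Dense (Submodule.span ℂ (Set.range (W θ)) : Set (QuantumTorus θ)) := by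
  have hle : StarAlgebra.adjoin ℂ
      (Set.range fun p : ℂ × Z2 => leftRegular (torusPair θ) scalarRep p.1 p.2) ≤
      (spanW θ).map (torusIncl θ) := by
    refine StarAlgebra.adjoin_le ?_
    rintro _ ⟨p, rfl⟩
    refine ⟨p.1 • W θ p.2, ?_, (leftRegular_eq_smul_W θ p.1 p.2).symm⟩
    exact Submodule.smul_mem _ _ (Submodule.subset_span ⟨_, rfl⟩)
  intro b
  have hb : torusIncl θ b ∈ closure ((spanW θ).map (torusIncl θ) :
      Set (Ell2 Z2 ℂ →L[ℂ] Ell2 Z2 ℂ)) := closure_mono hle b.2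
  exact closure_subtype.2 hb

/-- By density, identities between continuous linear maps on `B` reduce to a check on the
generators. -/
theorem torus_ext {θ : ℝ} {E : Type*} [AddCommMonoid E] [Module ℂ E] [TopologicalSpace E]
    [T2Space E] {f g : QuantumTorus θ →ₗ[ℂ] E} (hf : Continuous f) (hg : Continuous g)
    (h : ∀ x, f (W θ x) = g (W θ x)) (b : QuantumTorus θ) : f b = g b := by
  have hs : Set.EqOn f g (Submodule.span ℂ (Set.range (W θ)) : Set (QuantumTorus θ)) := by
    refine LinearMap.eqOn_span' ?_
    rintro _ ⟨x, rfl⟩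
    exact h x
  exact congrFun (Continuous.ext_on (dense_spanW θ) hf hg hs) b

theorem inner_iotaB (θ : ℝ) (a b : QuantumTorus θ) :
    ⟪iotaB θ a, iotaB θ b⟫_ℂ = torusTrace θ (star a * b) := by
  rw [iotaB, iotaB, UniformSpace.Completion.inner_coe]
  rfl

theorem piTau_iotaB (θ : ℝ) (a b : QuantumTorus θ) :
    piTau θ a (iotaB θ b) = iotaB θ (a * b) := by
  change (torusTrace θ).gnsNonUnitalStarAlgHom a _ = _
  rw [iotaB, PositiveLinearMap.gnsNonUnitalStarAlgHom_apply_coe]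
  rfl

theorem iotaB_smul (θ : ℝ) (c : ℂ) (b : QuantumTorus θ) : iotaB θ (c • b) = c • iotaB θ b := by
  simp [iotaB]

/-- The map `ι_B` as a continuous linear map. -/
def iotaCLM (θ : ℝ) : QuantumTorus θ →L[ℂ] L2B θ where
  toFun := iotaB θ
  map_add' a b := by simp [iotaB, UniformSpace.Completion.coe_add]
  map_smul' := iotaB_smul θ
  cont := by
    -- Cyclicity of `ι_B(1)` reduces continuity of `ι_B` to the automatic continuity of the
    -- ⋆-homomorphism `π_τ`.
    have h : iotaB θ = fun b => piTau θ b (iotaB θ 1) := by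
      funext b
      rw [piTau_iotaB, mul_one]
    rw [h]
    exact (ContinuousLinearMap.apply ℂ (L2B θ) (iotaB θ 1)).continuous.comp
      (map_continuous (piTau θ))

theorem denseRange_iotaB (θ : ℝ) : DenseRange (iotaB θ) :=
  UniformSpace.Completion.denseRange_coe (α := (torusTrace θ).PreGNS)

theorem orthonormal_iotaB_W (θ : ℝ) : Orthonormal ℂ fun r => iotaB θ (W θ r) := by
  rw [orthonormal_iff_ite]
  intro r s
  rw [inner_iotaB, W_star, W_mul, map_smul, torusTrace_W]
  by_cases h : r = s
  · subst h
    simp [sigmaTheta, thetaForm_neg_left, thetaForm_self]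
  · have : ¬ (-r + s = 0) := fun h' => h (neg_add_eq_zero.1 h')
    simp [h, this]

theorem span_iotaB_W (θ : ℝ) :
    ⊤ ≤ (Submodule.span ℂ (Set.range fun r => iotaB θ (W θ r))).topologicalClosure := by
  have h := (denseRange_iotaB θ).dense_image (iotaCLM θ).continuous (dense_spanW θ)
  rintro x -
  refine closure_mono ?_ (h x)
  rintro _ ⟨b, hb, rfl⟩
  have := Submodule.mem_map_of_mem (f := (iotaCLM θ : QuantumTorus θ →ₗ[ℂ] L2B θ)) hb
  rw [Submodule.map_span, ← Set.range_comp] at this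
  exact this

/-- The Hilbert basis `ι_B(W_r)` of `L²(B, τ_B)`. -/
def fourier (θ : ℝ) : HilbertBasis Z2 ℂ (L2B θ) :=
  HilbertBasis.mk (orthonormal_iotaB_W θ) (span_iotaB_W θ)

theorem fourier_apply (θ : ℝ) (r : Z2) : fourier θ r = iotaB θ (W θ r) := by
  rw [fourier, HilbertBasis.coe_mk]

theorem fourier_repr_of_hasSum {θ : ℝ} {α : Z2 → ℂ} {y : L2B θ}
    (h : HasSum (fun r => α r • iotaB θ (W θ r)) y) (n : Z2) : (fourier θ).repr y n = α n := by
  rw [HilbertBasis.repr_apply_apply]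
  have h1 := (innerSL ℂ (fourier θ n)).hasSum h
  have h2 : (fun r => innerSL ℂ (fourier θ n) (α r • iotaB θ (W θ r))) =
      fun r => if r = n then α n else 0 := by
    funext r
    rw [innerSL_apply_apply, inner_smul_right, ← fourier_apply,
      (orthonormal_iff_ite.1 (fourier θ).orthonormal)]
    by_cases hr : r = n
    · subst hr; simp
    · have hr' : ¬ n = r := fun h => hr h.symm
      simp [hr, hr']
  rw [h2] at h1
  exact h1.unique (hasSum_ite_eq n (α n))

theorem hasSum_iotaB {θ : ℝ} {α : Z2 → ℂ} {b : QuantumTorus θ}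
    (h : HasSum (fun r => α r • W θ r) b) :
    HasSum (fun r => α r • iotaB θ (W θ r)) (iotaB θ b) := by
  have h1 := (iotaCLM θ).hasSum h
  refine h1.congr_fun fun r => ?_
  exact (iotaB_smul θ _ _).symm

end Fourier

/-! ### The operators `D^±` -/

section Dirac

/-- Fourier coefficients of both entries can be read off the defining series. In particular the
first entry determines the second, so `derivGraph` really is a graph. -/
theorem derivGraph_coeff {θ : ℝ} {j : Fin 2} {y z : L2B θ} (h : (y, z) ∈ derivGraph θ j) (n : Z2) :
    (fourier θ).repr z n = 2 * Real.pi * Complex.I * (n j : ℂ) * (fourier θ).repr y n := by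
  obtain ⟨α, b, -, h2, h3, h4⟩ := h
  have h3 : y = iotaB θ b := h3
  rw [fourier_repr_of_hasSum h4, h3, fourier_repr_of_hasSum (hasSum_iotaB h2)]

theorem torusDeriv_graph (θ : ℝ) (j : Fin 2) : (torusDeriv θ j).graph = derivGraph θ j := by
  refine Submodule.toLinearPMap_graph_eq _ ?_
  rintro ⟨y, z⟩ h hy
  have hy : y = 0 := hy
  subst hy
  refine (fourier θ).repr.injective (lp.ext (funext fun n => ?_))
  rw [derivGraph_coeff h n]
  simp

theorem isSchwartz_single (n : Z2) : IsSchwartz (Pi.single n 1) := by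
  intro k
  refine ⟨(1 + (n 0 : ℝ) ^ 2 + (n 1 : ℝ) ^ 2) ^ k, ?_⟩
  rintro _ ⟨r, rfl⟩
  by_cases h : r = n
  · subst h; simp
  · simp only [Pi.single_apply, h, if_false, norm_zero]
    simp only [ne_eq, OfNat.ofNat_ne_zero, not_false_eq_true, zero_pow, mul_zero]
    positivity

theorem single_mem_torusDeriv (θ : ℝ) (j : Fin 2) (n : Z2) :
    (iotaB θ (W θ n), (2 * Real.pi * Complex.I * (n j : ℂ)) • iotaB θ (W θ n)) ∈
      (torusDeriv θ j).graph := by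
  rw [torusDeriv_graph]
  refine ⟨Pi.single n 1, W θ n, isSchwartz_single n, ?_, rfl, ?_⟩
  · convert hasSum_ite_eq n (W θ n) using 2 with r
    by_cases h : r = n
    · subst h; simp
    · simp [h]
  · convert hasSum_ite_eq n ((2 * Real.pi * Complex.I * (n j : ℂ)) • iotaB θ (W θ n)) using 2 with r
    by_cases h : r = n
    · subst h; simp
    · simp [h]

/-- An operator which is diagonal in a Hilbert basis contained in its domain is closable, and its
closure is the maximal diagonal operator. -/
theorem closure_eq_blockOp {ι H : Type*} [NormedAddCommGroup H] [InnerProductSpace ℂ H]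
    (b : HilbertBasis ι ℂ H) (c : ι → ℂ) {f : H →ₗ.[ℂ] H}
    (h1 : ∀ y z, (y, z) ∈ f.graph → ∀ n, b.repr z n = c n * b.repr y n)
    (h2 : ∀ n, (b n, c n • b n) ∈ f.graph) :
    f.closure = blockOp b.repr fun n => c n • 1 := by
  have hle : f ≤ blockOp b.repr fun n => c n • 1 := by
    refine LinearPMap.le_of_le_graph ?_
    rintro ⟨y, z⟩ h
    rw [mem_graph_blockOp]
    exact h1 y z h
  have hcl := (blockOp_isClosed b.repr fun n => c n • (1 : ℂ →L[ℂ] ℂ))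
  have hf : f.IsClosable := hcl.isClosable.leIsClosable hle
  apply LinearPMap.eq_of_eq_graph
  rw [← hf.graph_closure_eq_closure_graph]
  apply le_antisymm
  · exact Submodule.topologicalClosure_minimal _ (LinearPMap.le_graph_of_le hle) hcl
  · rintro ⟨y, z⟩ h
    rw [mem_graph_blockOp] at h
    -- The expansions of `y` and `z` have proportional terms, so their simultaneous partial sums are
    -- finite combinations of the points `(b n, c n • b n)` and converge in the graph norm.
    have hs := (b.hasSum_repr y).prodMk (b.hasSum_repr z)
    refine mem_closure_of_tendsto hs (Filter.Eventually.of_forall fun F => ?_)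
    refine Submodule.sum_mem _ fun n _ => ?_
    have := Submodule.smul_mem _ (b.repr y n) (h2 n)
    rw [Prod.smul_mk, smul_smul] at this
    rw [h n]
    simpa [mul_comm] using this

/-- The complex number `n₁ + i n₂`. -/
def Z2.toComplex (n : Z2) : ℂ := (n 0 : ℂ) + Complex.I * n 1

/-- The eigenvalue comes from `-i (2πi n₁ + i · 2πi n₂) = 2π (n₁ + i n₂)`. -/
theorem diracPlus_eq (θ : ℝ) :
    diracPlus θ = blockOp (fourier θ).repr fun n => (2 * Real.pi * n.toComplex) • 1 := by
  refine closure_eq_blockOp (fourier θ) _ ?_ fun n => ?_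
  · intro y z h n
    obtain ⟨⟨y', hy⟩, h1, h2⟩ := (LinearPMap.mem_graph_iff _).1 h
    have h1 : y' = y := h1
    subst h1
    have hy' : y' ∈ (torusDeriv θ 0).domain ⊓ (torusDeriv θ 1).domain := hy
    have h3 := derivGraph_coeff (torusDeriv_graph θ 0 ▸ (torusDeriv θ 0).mem_graph ⟨y', hy'.1⟩) n
    have h4 := derivGraph_coeff (torusDeriv_graph θ 1 ▸ (torusDeriv θ 1).mem_graph ⟨y', hy'.2⟩) n
    have h5 : z = (-Complex.I) • (torusDeriv θ 0 ⟨y', hy'.1⟩ +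
      Complex.I • torusDeriv θ 1 ⟨y', hy'.2⟩) := h2.symm
    rw [h5, map_smul, map_add, map_smul, lp.coeFn_smul, Pi.smul_apply, lp.coeFn_add, Pi.add_apply,
      lp.coeFn_smul, Pi.smul_apply, h3, h4, Z2.toComplex, smul_eq_mul, smul_eq_mul]
    linear_combination (-(2 * Real.pi * (n 0 : ℂ) * (fourier θ).repr y' n) -
      2 * Real.pi * (n 1 : ℂ) * Complex.I * (fourier θ).repr y' n) * Complex.I_sq
  · rw [fourier_apply]
    obtain ⟨y0, h1, h2⟩ := (LinearPMap.mem_graph_iff _).1 (single_mem_torusDeriv θ 0 n)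
    obtain ⟨y1, h3, h4⟩ := (LinearPMap.mem_graph_iff _).1 (single_mem_torusDeriv θ 1 n)
    obtain ⟨y0, hy0⟩ := y0
    obtain ⟨y1, hy1⟩ := y1
    have h1 : y0 = iotaB θ (W θ n) := h1
    have h3 : y1 = iotaB θ (W θ n) := h3
    subst h1
    subst h3
    refine (LinearPMap.mem_graph_iff _).2 ⟨⟨_, ⟨hy0, hy1⟩⟩, rfl, ?_⟩
    change (-Complex.I) • (torusDeriv θ 0 ⟨_, hy0⟩ + Complex.I • torusDeriv θ 1 ⟨_, hy1⟩) = _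
    rw [h2, h4, smul_smul, ← add_smul, smul_smul, Z2.toComplex]
    congr 1
    linear_combination (-(2 * Real.pi * (n 0 : ℂ)) -
      2 * Real.pi * (n 1 : ℂ) * Complex.I) * Complex.I_sq

/-- The eigenvalues are conjugate to those of `D⁺`; this conjugacy is what makes the blocks of `D̃`
Hermitian. -/
theorem diracMinus_eq (θ : ℝ) :
    diracMinus θ = blockOp (fourier θ).repr fun n => (2 * Real.pi * star n.toComplex) • 1 := by
  have hc : ∀ n : Z2, star n.toComplex = (n 0 : ℂ) - Complex.I * n 1 := fun n => by
    simp [Z2.toComplex, sub_eq_add_neg]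
  refine closure_eq_blockOp (fourier θ) _ ?_ fun n => ?_
  · intro y z h n
    obtain ⟨⟨y', hy⟩, h1, h2⟩ := (LinearPMap.mem_graph_iff _).1 h
    have h1 : y' = y := h1
    subst h1
    have hy' : y' ∈ (torusDeriv θ 0).domain ⊓ (torusDeriv θ 1).domain := hy
    have h3 := derivGraph_coeff (torusDeriv_graph θ 0 ▸ (torusDeriv θ 0).mem_graph ⟨y', hy'.1⟩) n
    have h4 := derivGraph_coeff (torusDeriv_graph θ 1 ▸ (torusDeriv θ 1).mem_graph ⟨y', hy'.2⟩) n
    have h5 : z = (-Complex.I) • (torusDeriv θ 0 ⟨y', hy'.1⟩ -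
      Complex.I • torusDeriv θ 1 ⟨y', hy'.2⟩) := h2.symm
    rw [h5, map_smul, map_sub, map_smul, lp.coeFn_smul, Pi.smul_apply, lp.coeFn_sub, Pi.sub_apply,
      lp.coeFn_smul, Pi.smul_apply, h3, h4, hc, smul_eq_mul, smul_eq_mul]
    linear_combination (-(2 * Real.pi * (n 0 : ℂ) * (fourier θ).repr y' n) +
      2 * Real.pi * (n 1 : ℂ) * Complex.I * (fourier θ).repr y' n) * Complex.I_sq
  · rw [fourier_apply]
    obtain ⟨y0, h1, h2⟩ := (LinearPMap.mem_graph_iff _).1 (single_mem_torusDeriv θ 0 n)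
    obtain ⟨y1, h3, h4⟩ := (LinearPMap.mem_graph_iff _).1 (single_mem_torusDeriv θ 1 n)
    obtain ⟨y0, hy0⟩ := y0
    obtain ⟨y1, hy1⟩ := y1
    have h1 : y0 = iotaB θ (W θ n) := h1
    have h3 : y1 = iotaB θ (W θ n) := h3
    subst h1
    subst h3
    refine (LinearPMap.mem_graph_iff _).2 ⟨⟨_, ⟨hy0, hy1⟩⟩, rfl, ?_⟩
    change (-Complex.I) • (torusDeriv θ 0 ⟨_, hy0⟩ - Complex.I • torusDeriv θ 1 ⟨_, hy1⟩) = _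
    rw [h2, h4, smul_smul, ← sub_smul, smul_smul, hc]
    congr 1
    linear_combination (-(2 * Real.pi * (n 0 : ℂ)) +
      2 * Real.pi * (n 1 : ℂ) * Complex.I) * Complex.I_sq

end Dirac

/-! ### Coordinates on `(H ⊗ ℓ²(G) ⊗ ℂ²) ⊕ (H ⊗ ℓ²(G) ⊗ ℂ²)` -/

section Coordinates

theorem hasSum_prod_fintype {ι G : Type*} [Fintype G] {f : ι × G → ℝ} {a : G → ℝ}
    (h : ∀ g, HasSum (fun m => f (m, g)) (a g)) : HasSum f (∑ g, a g) := by
  classical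
  -- Each slice is extended by zero to the whole product, and the finitely many extensions are
  -- added.
  have h1 : ∀ g, HasSum (fun i : ι × G => if i.2 = g then f i else 0) (a g) := fun g => by
    have hinj : Function.Injective fun m : ι => (m, g) := fun m n h => (Prod.ext_iff.1 h).1
    refine (hinj.hasSum_iff ?_).1 ?_
    · rintro ⟨m, g'⟩ hx
      rw [if_neg]
      rintro rfl
      exact hx ⟨m, rfl⟩
    · simpa [Function.comp_def] using h g
  convert hasSum_sum (s := Finset.univ) fun g _ => h1 g using 2 with i
  simp

variable {ι G H : Type*} [Fintype G] [NormedAddCommGroup H] [InnerProductSpace ℂ H]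
  (b : HilbertBasis ι ℂ H)

/-- The coordinates of a vector, as a vector of `ℂ² ⊕ ℂ²` for each basis vector of `H` and each
group element. -/
def coordFun (x : EquivHilb G H) (i : ι × G) : EuclideanSpace ℂ (Fin 2 ⊕ Fin 2) :=
  WithLp.toLp 2 (Sum.elim (fun k => b.repr (x.fst (i.2, k)) i.1)
    fun k => b.repr (x.snd (i.2, k)) i.1)

/-- Parseval in each of the finitely many `H`-components, regrouped by basis index and group
element. -/
theorem hasSum_coordFun (x : EquivHilb G H) :
    HasSum (fun i => ‖coordFun b x i‖ ^ 2) (‖x‖ ^ 2) := by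
  have h0 : ∀ y : H, HasSum (fun m => ‖b.repr y m‖ ^ 2) (‖y‖ ^ 2) := fun y => by
    have h := lp.hasSum_norm (p := 2) (by norm_num) (b.repr y)
    rw [b.repr.norm_map] at h
    simpa using h
  have h1 : ‖x‖ ^ 2 = ∑ g, ∑ k, (‖x.fst (g, k)‖ ^ 2 + ‖x.snd (g, k)‖ ^ 2) := by
    rw [WithLp.prod_norm_sq_eq_of_L2, PiLp.norm_sq_eq_of_L2, PiLp.norm_sq_eq_of_L2,
      Fintype.sum_prod_type, Fintype.sum_prod_type, ← Finset.sum_add_distrib]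
    simp only [Finset.sum_add_distrib]
  rw [h1]
  refine hasSum_prod_fintype fun g => ?_
  convert hasSum_sum (s := Finset.univ)
    fun k (_ : k ∈ Finset.univ) => (h0 (x.fst (g, k))).add (h0 (x.snd (g, k))) using 2 with m
  rw [EuclideanSpace.norm_sq_eq, Fintype.sum_sum_type, ← Finset.sum_add_distrib]
  rfl

/-- The coordinates of a vector as a linear isometry. -/
def coordIsometry : EquivHilb G H →ₗᵢ[ℂ] Ell2 (ι × G) (EuclideanSpace ℂ (Fin 2 ⊕ Fin 2)) where
  toFun x := ⟨coordFun b x, memℓp_gen (by simpa using (hasSum_coordFun b x).summable)⟩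
  map_add' x y := by
    refine lp.ext (funext fun i => ?_)
    refine PiLp.ext fun k => ?_
    change _ = coordFun b x i k + coordFun b y i k
    rcases k with k | k <;> simp [coordFun]
  map_smul' c x := by
    refine lp.ext (funext fun i => ?_)
    refine PiLp.ext fun k => ?_
    rcases k with k | k <;> simp [coordFun]
  norm_map' x := by
    have h := lp.hasSum_norm (p := 2) (by norm_num)
      (⟨coordFun b x, memℓp_gen (by simpa using (hasSum_coordFun b x).summable)⟩ :
        Ell2 (ι × G) (EuclideanSpace ℂ (Fin 2 ⊕ Fin 2)))
    have h' := hasSum_coordFun b x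
    simp only [ENNReal.toReal_ofNat, Real.rpow_ofNat] at h
    exact (sq_eq_sq₀ (norm_nonneg _) (norm_nonneg _)).1 (h.unique h')

theorem coordIsometry_surjective : Function.Surjective (coordIsometry (G := G) b) := by
  intro f
  have hmem : ∀ (g : G) (s : Fin 2 ⊕ Fin 2), Memℓp (fun m => f (m, g) s) 2 := fun g s => by
    refine memℓp_gen ?_
    have hinj : Function.Injective fun m : ι => (m, g) := fun m n h => (Prod.ext_iff.1 h).1
    refine Summable.of_nonneg_of_le (fun m => by positivity) (fun m => ?_)
      ((lp.hasSum_norm (p := 2) (by norm_num) f).summable.comp_injective hinj)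
    exact Real.rpow_le_rpow (norm_nonneg _) (PiLp.norm_apply_le _ _) (by norm_num)
  refine ⟨WithLp.toLp 2 (WithLp.toLp 2 fun p => b.repr.symm ⟨_, hmem p.1 (Sum.inl p.2)⟩,
    WithLp.toLp 2 fun p => b.repr.symm ⟨_, hmem p.1 (Sum.inr p.2)⟩), ?_⟩
  refine lp.ext (funext fun i => ?_)
  refine PiLp.ext fun k => ?_
  rcases k with k | k
  · change b.repr (b.repr.symm _) _ = _
    rw [b.repr.apply_symm_apply]
  · change b.repr (b.repr.symm _) _ = _
    rw [b.repr.apply_symm_apply]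

/-- The coordinates of a vector as a unitary. -/
def coord : EquivHilb G H ≃ₗᵢ[ℂ] Ell2 (ι × G) (EuclideanSpace ℂ (Fin 2 ⊕ Fin 2)) :=
  LinearIsometryEquiv.ofSurjective (coordIsometry b) (coordIsometry_surjective b)

theorem coord_inl (x : EquivHilb G H) (m : ι) (g : G) (k : Fin 2) :
    coord b x (m, g) (Sum.inl k) = b.repr (x.fst (g, k)) m := rfl

theorem coord_inr (x : EquivHilb G H) (m : ι) (g : G) (k : Fin 2) :
    coord b x (m, g) (Sum.inr k) = b.repr (x.snd (g, k)) m := rfl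

/-- The length term is everywhere defined, so it can be moved to the other side; only `D^±` restrict
the domain. -/
theorem mem_graph_equivDirac {Dp Dm : H →ₗ.[ℂ] H} {ℓ : G → Matrix (Fin 2) (Fin 2) ℂ}
    {x y : EquivHilb G H} : (x, y) ∈ (equivDirac Dp Dm ℓ).graph ↔
      (∀ p, (x.fst p, y.snd p + lengthMul ℓ x.snd p) ∈ Dp.graph) ∧
      ∀ p, (x.snd p, y.fst p - lengthMul ℓ x.fst p) ∈ Dm.graph := by
  constructor
  · intro h
    obtain ⟨x', rfl, rfl⟩ := (LinearPMap.mem_graph_iff _).1 h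
    constructor <;> intro p
    · have := Dp.mem_graph ⟨_, x'.2.1 p⟩
      convert this using 2
      change (Dp ⟨_, x'.2.1 p⟩ - lengthMul ℓ (x' : EquivHilb G H).snd p) + _ = _
      abel
    · have := Dm.mem_graph ⟨_, x'.2.2 p⟩
      convert this using 2
      change (lengthMul ℓ (x' : EquivHilb G H).fst p + Dm ⟨_, x'.2.2 p⟩) - _ = _
      abel
  · rintro ⟨h1, h2⟩
    refine (LinearPMap.mem_graph_iff _).2 ⟨⟨x, fun p => LinearPMap.mem_domain_of_mem_graph (h1 p),
      fun p => LinearPMap.mem_domain_of_mem_graph (h2 p)⟩, rfl, ?_⟩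
    have h1' := fun p => (LinearPMap.image_iff (LinearPMap.mem_domain_of_mem_graph (h1 p))).2 (h1 p)
    have h2' := fun p => (LinearPMap.image_iff (LinearPMap.mem_domain_of_mem_graph (h2 p))).2 (h2 p)
    apply WithLp.ofLp_injective 2
    apply Prod.ext <;> ext p
    · change lengthMul ℓ x.fst p + Dm ⟨_, _⟩ = y.fst p
      rw [← h2']
      abel
    · change Dp ⟨_, _⟩ - lengthMul ℓ x.snd p = y.snd p
      rw [← h1']
      abel

/-- The blocks `[[ℓ, c̄], [c, -ℓ]]`. -/
def diracBlock (A : Matrix (Fin 2) (Fin 2) ℂ) (c : ℂ) :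
    EuclideanSpace ℂ (Fin 2 ⊕ Fin 2) →L[ℂ] EuclideanSpace ℂ (Fin 2 ⊕ Fin 2) :=
  Matrix.toEuclideanCLM (𝕜 := ℂ) (Matrix.fromBlocks A (star c • 1) (c • 1) (-A))

theorem diracBlock_inl (A : Matrix (Fin 2) (Fin 2) ℂ) (c : ℂ)
    (v : EuclideanSpace ℂ (Fin 2 ⊕ Fin 2)) (k : Fin 2) :
    diracBlock A c v (Sum.inl k) = ∑ l, A k l * v (Sum.inl l) + star c * v (Sum.inr k) := by
  rw [diracBlock, Matrix.ofLp_toEuclideanCLM, Matrix.fromBlocks_mulVec]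
  fin_cases k <;> simp

theorem diracBlock_inr (A : Matrix (Fin 2) (Fin 2) ℂ) (c : ℂ)
    (v : EuclideanSpace ℂ (Fin 2 ⊕ Fin 2)) (k : Fin 2) :
    diracBlock A c v (Sum.inr k) = c * v (Sum.inl k) - ∑ l, A k l * v (Sum.inr l) := by
  rw [diracBlock, Matrix.ofLp_toEuclideanCLM, Matrix.fromBlocks_mulVec]
  fin_cases k <;> simp [sub_eq_add_neg, add_comm]

/-- `D^±` are diagonal in the basis index and `ℓ` mixes only the fibre over a group element, so the
equations decouple over `(n, g)`. The domains agree exactly because those of `D^±` are maximal. -/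
theorem equivDirac_eq_blockOp (c : ι → ℂ) (ℓ : G → Matrix (Fin 2) (Fin 2) ℂ) :
    equivDirac (blockOp b.repr fun n => c n • 1) (blockOp b.repr fun n => star (c n) • 1) ℓ =
      blockOp (coord b) fun i => diracBlock (ℓ i.2) (c i.1) := by
  apply LinearPMap.eq_of_eq_graph
  ext ⟨x, y⟩
  simp only [mem_graph_equivDirac, mem_graph_blockOp]
  have hlen : ∀ (u : Tens G H) (p : G × Fin 2) (n : ι), b.repr (lengthMul ℓ u p) n =
      ∑ l, ℓ p.1 p.2 l * b.repr (u (p.1, l)) n := fun u p n => by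
    change b.repr (∑ l, ℓ p.1 p.2 l • u (p.1, l)) n = _
    rw [map_sum, lp.coeFn_sum, Finset.sum_apply]
    simp only [map_smul, lp.coeFn_smul, Pi.smul_apply, smul_eq_mul]
  simp only [map_add, map_sub, lp.coeFn_add, lp.coeFn_sub, Pi.add_apply, Pi.sub_apply, hlen]
  constructor
  · rintro ⟨h1, h2⟩ ⟨n, g⟩
    refine PiLp.ext fun k => ?_
    rcases k with k | k
    · rw [diracBlock_inl]
      have := h2 (g, k) n
      simp only [coord_inl, coord_inr]
      rw [add_comm, ← sub_eq_iff_eq_add]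
      exact this
    · rw [diracBlock_inr]
      have := h1 (g, k) n
      simp only [coord_inl, coord_inr]
      exact eq_sub_of_add_eq this
  · intro h
    constructor
    · rintro ⟨g, k⟩ n
      have := congrArg (fun v => v (Sum.inr k)) (congrArg WithLp.ofLp (h (n, g)))
      simp only [diracBlock_inr, coord_inl, coord_inr] at this
      exact add_eq_of_eq_sub this
    · rintro ⟨g, k⟩ n
      have := congrArg (fun v => v (Sum.inl k)) (congrArg WithLp.ofLp (h (n, g)))
      simp only [diracBlock_inl, coord_inl, coord_inr] at this
      rw [add_comm] at this
      exact sub_eq_of_eq_add this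

theorem diracBlock_isSelfAdjoint {A : Matrix (Fin 2) (Fin 2) ℂ} (hA : A.IsHermitian) (c : ℂ) :
    IsSelfAdjoint (diracBlock A c) := by
  refine IsSelfAdjoint.map ?_ (Matrix.toEuclideanCLM (n := Fin 2 ⊕ Fin 2) (𝕜 := ℂ))
  rw [IsSelfAdjoint, Matrix.star_eq_conjTranspose, Matrix.fromBlocks_conjTranspose]
  simp [hA.eq]

/-- The scalar `c` commutes with `A`, and the opposite signs of `A` in the two corners cancel the
off-diagonal entries of the square. -/
theorem diracBlock_mul_self {A : Matrix (Fin 2) (Fin 2) ℂ} {a : ℂ} (hA : A * A = a • 1) (c : ℂ) :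
    diracBlock A c * diracBlock A c = (a + star c * c) • 1 := by
  rw [diracBlock, ← map_mul, Matrix.fromBlocks_multiply, ← map_one (Matrix.toEuclideanCLM (𝕜 := ℂ)),
    ← map_smul, ← Matrix.fromBlocks_one, Matrix.fromBlocks_smul]
  congr 2
  · rw [hA]
    simp [add_smul, smul_smul, mul_comm]
  · simp
  · simp
  · simp [hA, add_smul, smul_smul, mul_comm, add_comm]

/-- The block is a sum of a part depending on the matrix and a part that is real-linear in `c`; the
two operators are the coefficients of `c` and of its conjugate. -/
theorem exists_diracBlock_sub_eq :
    ∃ A₁ A₂ : EuclideanSpace ℂ (Fin 2 ⊕ Fin 2) →L[ℂ] EuclideanSpace ℂ (Fin 2 ⊕ Fin 2),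
      ∀ A A' c c', diracBlock A c - diracBlock A' c' = diracBlock A 0 - diracBlock A' 0 +
        ((c - c') • A₁ + star (c - c') • A₂) := by
  refine ⟨Matrix.toEuclideanCLM (𝕜 := ℂ) (Matrix.fromBlocks 0 0 1 0),
    Matrix.toEuclideanCLM (𝕜 := ℂ) (Matrix.fromBlocks 0 1 0 0), fun A A' c c' => ?_⟩
  simp only [diracBlock, ← map_smul, ← map_sub, ← map_add]
  congr 1
  ext (i | i) (j | j) <;> simp [sub_mul]

/-- Finiteness of `G` bounds the length part uniformly, so only the difference of the eigenvalue
parameters can grow. -/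
theorem exists_diracBlock_sub_le (ℓ : G → Matrix (Fin 2) (Fin 2) ℂ) :
    ∃ C, 0 ≤ C ∧ ∀ g g' c c', ‖diracBlock (ℓ g) c - diracBlock (ℓ g') c'‖ ≤
      C * (1 + ‖c - c'‖) := by
  obtain ⟨A₁, A₂, hA⟩ := exists_diracBlock_sub_eq
  obtain ⟨N, hN⟩ := (Set.finite_range fun g => ‖diracBlock (ℓ g) 0‖).bddAbove
  have hle : ∀ g, ‖diracBlock (ℓ g) 0‖ ≤ |N| := fun g => (hN ⟨g, rfl⟩).trans (le_abs_self N)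
  have hN0 : 0 ≤ |N| := abs_nonneg N
  have ha₁ : 0 ≤ ‖A₁‖ := norm_nonneg _
  have ha₂ : 0 ≤ ‖A₂‖ := norm_nonneg _
  refine ⟨2 * |N| + (‖A₁‖ + ‖A₂‖), by positivity, fun g g' c c' => ?_⟩
  rw [hA]
  have h1 := norm_sub_le (diracBlock (ℓ g) 0) (diracBlock (ℓ g') 0)
  refine (norm_add_le _ _).trans ?_
  have h2 : ‖(c - c') • A₁ + star (c - c') • A₂‖ ≤ ‖c - c'‖ * ‖A₁‖ + ‖c - c'‖ * ‖A₂‖ := by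
    refine (norm_add_le _ _).trans_eq ?_
    rw [norm_smul, norm_smul, norm_star]
  have h3 := hle g
  have h4 := hle g'
  nlinarith [norm_nonneg (c - c'), mul_nonneg hN0 (norm_nonneg (c - c'))]

end Coordinates

/-! ### The grading of `B` by the dual group -/

section Grading

variable (M : Matrix (Fin 2) (Fin 2) ℤ) [hM : Fact (1 < M.det)] (θ : ℝ)

instance : Finite (Deck M) :=
  haveI : Fact (1 < M.transpose.det) := ⟨by rw [Matrix.det_transpose]; exact hM.out⟩
  inferInstanceAs (Finite (DualDeck M.transpose))

instance : Fintype (Deck M) := Fintype.ofFinite _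

theorem deckChar_out (t x : Z2) :
    deckChar M (Quotient.out (Submodule.Quotient.mk t : Deck M)) x = deckChar M t x := by
  have h : (Submodule.Quotient.mk (Quotient.out (Submodule.Quotient.mk t : Deck M)) : Deck M) =
      Submodule.Quotient.mk t := Quotient.out_eq _
  obtain ⟨k, hk⟩ := (Submodule.Quotient.eq _).1 h
  rw [← sub_add_cancel (Quotient.out (Submodule.Quotient.mk t : Deck M)) t, ← hk,
    deckChar_add_left, Matrix.mulVecLin_apply, deckChar_range_left, one_mul]

theorem deckChar_eq_of_mk_eq (t : Z2) {x y : Z2}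
    (h : (Submodule.Quotient.mk x : DualDeck M) = Submodule.Quotient.mk y) :
    deckChar M t x = deckChar M t y := by
  obtain ⟨k, hk⟩ := (Submodule.Quotient.eq _).1 h
  rw [← sub_add_cancel x y, ← hk, deckChar_add_right, Matrix.mulVecLin_apply, deckChar_range,
    one_mul]

/-- Nondegeneracy of the pairing between `G` and `Ĝ`. Taking for `t` the two standard basis vectors
shows that `n = (M⁻¹)ᵀ x` is integral, and then `x = Mᵀ n`. -/
theorem mk_eq_zero_of_deckChar {x : Z2} (h : ∀ t, deckChar M t x = 1) :
    (Submodule.Quotient.mk x : DualDeck M) = 0 := by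
  have h1 : ∀ k : Fin 2, ∃ n : ℤ, ((M.map (Int.cast : ℤ → ℝ))⁻¹).transpose.mulVec
      (fun i => (x i : ℝ)) k = n := fun k => by
    obtain ⟨n, hn⟩ := Complex.exp_eq_one_iff.1 (h (Pi.single k 1))
    refine ⟨n, ?_⟩
    have h2 : (fun i => ((Pi.single k 1 : Z2) i : ℝ)) = Pi.single k 1 := by
      funext i
      by_cases hi : i = k
      · subst hi; simp
      · simp [hi]
    rw [h2, mul_comm] at hn
    have h3 := mul_right_cancel₀ Complex.two_pi_I_ne_zero hn
    rw [Matrix.mulVec_single_one] at h3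
    exact_mod_cast h3
  choose n hn using h1
  rw [Submodule.Quotient.mk_eq_zero]
  refine ⟨n, ?_⟩
  have h2 : ((M.map (Int.cast : ℤ → ℝ))).transpose.mulVec (fun k => (n k : ℝ)) =
      fun i => (x i : ℝ) := by
    rw [← funext hn, Matrix.mulVec_mulVec, ← Matrix.transpose_mul,
      Matrix.nonsing_inv_mul _ (isUnit_iff_ne_zero.2 (det_real_ne_zero M)), Matrix.transpose_one,
      Matrix.one_mulVec]
  funext i
  have h3 := congrFun h2 i
  rw [Matrix.mulVecLin_apply]
  have h4 : ((M.transpose.mulVec n i : ℤ) : ℝ) = (x i : ℝ) := by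
    rw [← h3]
    simp [Matrix.mulVec, dotProduct, Fin.sum_univ_two]
  exact_mod_cast h4

open Classical in
/-- Orthogonality of characters. -/
theorem sum_deckChar (x : Z2) : ∑ g : Deck M, deckChar M (Quotient.out g) x =
    if (Submodule.Quotient.mk x : DualDeck M) = 0 then (Fintype.card (Deck M) : ℂ) else 0 := by
  by_cases hx : (Submodule.Quotient.mk x : DualDeck M) = 0
  · rw [if_pos hx]
    have h : ∀ t, deckChar M t x = 1 := fun t => by
      rw [deckChar_eq_of_mk_eq M t (y := 0) (by rw [hx, Submodule.Quotient.mk_zero]),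
        deckChar_zero_right]
    simp [h]
  · rw [if_neg hx]
    obtain ⟨t, ht⟩ : ∃ t, deckChar M t x ≠ 1 := by
      by_contra! h
      exact hx (mk_eq_zero_of_deckChar M h)
    have h1 : ∀ g : Deck M, deckChar M (Quotient.out (g + Submodule.Quotient.mk t)) x =
        deckChar M (Quotient.out g) x * deckChar M t x := fun g => by
      have hg : g = Submodule.Quotient.mk (Quotient.out g) := (Quotient.out_eq g).symm
      conv_lhs => rw [hg, ← Submodule.Quotient.mk_add, deckChar_out, deckChar_add_left]
    -- Translating the summation variable by `t` multiplies the sum by a character value different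
    -- from 1, so the sum vanishes.
    have h2 := Equiv.sum_comp (Equiv.addRight (Submodule.Quotient.mk t : Deck M))
      fun g => deckChar M (Quotient.out g) x
    simp only [Equiv.coe_addRight, h1, ← Finset.sum_mul] at h2
    by_contra h3
    exact ht (mul_left_cancel₀ h3 (h2.trans (mul_one _).symm))

/-- The spectral subspace of `B` for the character `j` of `G`. -/
def homog (j : DualDeck M) : Submodule ℂ (QuantumTorus θ) where
  carrier := {b | ∀ t, deckTilde M θ t b = deckChar M t (sect M j) • b}
  add_mem' := fun ha hb t => by rw [map_add, ha t, hb t, smul_add]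
  zero_mem' := fun t => by simp
  smul_mem' := fun c a ha t => by rw [map_smul, ha t, smul_comm]

variable {M θ}

theorem deckChar_sect_mk (t x : Z2) :
    deckChar M t (sect M (Submodule.Quotient.mk x)) = deckChar M t x :=
  deckChar_eq_of_mk_eq M t (mk_sect M _)

theorem W_mem_homog (x : Z2) : W θ x ∈ homog M θ (Submodule.Quotient.mk x) := fun t => by
  rw [deckTilde_W, deckChar_sect_mk]

theorem frame_mem_homog (j : DualDeck M) : (frame M θ j : QuantumTorus θ) ∈ homog M θ j :=
  fun t => deckTilde_W M θ t _

theorem mul_mem_homog {j k : DualDeck M} {a b : QuantumTorus θ} (ha : a ∈ homog M θ j)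
    (hb : b ∈ homog M θ k) : a * b ∈ homog M θ (j + k) := fun t => by
  have h : deckChar M t (sect M (j + k)) = deckChar M t (sect M j) * deckChar M t (sect M k) := by
    rw [← deckChar_add_right]
    refine deckChar_eq_of_mk_eq M t ?_
    rw [Submodule.Quotient.mk_add, mk_sect, mk_sect, mk_sect]
  rw [map_mul, ha t, hb t, smul_mul_smul_comm, h]

theorem star_mem_homog {j : DualDeck M} {a : QuantumTorus θ} (ha : a ∈ homog M θ j) :
    star a ∈ homog M θ (-j) := fun t => by
  have h : deckChar M t (sect M (-j)) = star (deckChar M t (sect M j)) := by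
    rw [← deckChar_neg_right]
    refine deckChar_eq_of_mk_eq M t ?_
    rw [Submodule.Quotient.mk_neg, mk_sect, mk_sect]
  rw [map_star, ha t, star_smul, h]

/-- The degree condition quantifies over `ℤ²` and the fixed-point condition over chosen
representatives of `G`; independence of the representative reconciles them. -/
theorem mem_homog_zero_iff {a : QuantumTorus θ} : a ∈ homog M θ 0 ↔ a ∈ fixedAlg M θ := by
  constructor
  · intro h g
    have := h (Quotient.out g)
    rwa [sect_zero, deckChar_zero_right, one_smul] at this
  · intro h t
    rw [sect_zero, deckChar_zero_right, one_smul, ← deckAction_mk]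
    exact h _

theorem one_mem_homog : (1 : QuantumTorus θ) ∈ homog M θ 0 :=
  mem_homog_zero_iff.2 (one_mem _)

variable (M θ)

/-- The projection of `B` onto the spectral subspace of the character `j`. -/
def specProj (j : DualDeck M) : QuantumTorus θ →ₗ[ℂ] QuantumTorus θ :=
  (Fintype.card (Deck M) : ℂ)⁻¹ • ∑ g : Deck M, star (deckChar M (Quotient.out g) (sect M j)) •
    (deckTilde M θ (Quotient.out g)).toAlgHom.toLinearMap

variable {M θ}

theorem specProj_apply (j : DualDeck M) (b : QuantumTorus θ) :
    specProj M θ j b = (Fintype.card (Deck M) : ℂ)⁻¹ • ∑ g : Deck M,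
      star (deckChar M (Quotient.out g) (sect M j)) • deckTilde M θ (Quotient.out g) b := by
  simp [specProj]

theorem continuous_specProj (j : DualDeck M) : Continuous (specProj M θ j) := by
  have h : ⇑(specProj M θ j) = fun b => (Fintype.card (Deck M) : ℂ)⁻¹ • ∑ g : Deck M,
      star (deckChar M (Quotient.out g) (sect M j)) • deckTilde M θ (Quotient.out g) b :=
    funext (specProj_apply j)
  rw [h]
  have h' : Continuous fun b : QuantumTorus θ => ∑ g : Deck M,
      star (deckChar M (Quotient.out g) (sect M j)) • deckTilde M θ (Quotient.out g) b :=
    continuous_finsetSum _ fun g _ =>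
      (continuous_const_smul (star (deckChar M (Quotient.out g) (sect M j)))).comp
        (map_continuous (deckTilde M θ (Quotient.out g)))
  exact (continuous_const_smul ((Fintype.card (Deck M) : ℂ)⁻¹)).comp h'

open Classical in
theorem specProj_of_mem {j k : DualDeck M} {b : QuantumTorus θ} (hb : b ∈ homog M θ k) :
    specProj M θ j b = if k = j then b else 0 := by
  rw [specProj_apply]
  have h : ∀ g : Deck M, star (deckChar M (Quotient.out g) (sect M j)) •
      deckTilde M θ (Quotient.out g) b = deckChar M (Quotient.out g) (-sect M j + sect M k) • b :=
    fun g => by rw [hb, smul_smul, deckChar_add_right, deckChar_neg_right]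
  simp only [h]
  rw [← Finset.sum_smul, sum_deckChar, Submodule.Quotient.mk_add, Submodule.Quotient.mk_neg,
    mk_sect, mk_sect]
  have h0 : (Fintype.card (Deck M) : ℂ) ≠ 0 := by exact_mod_cast Fintype.card_ne_zero
  by_cases hjk : k = j
  · subst hjk
    rw [if_pos (neg_add_cancel _), if_pos rfl, smul_smul, inv_mul_cancel₀ h0, one_smul]
  · rw [if_neg hjk, if_neg, zero_smul, smul_zero]
    exact fun h => hjk (neg_add_eq_zero.1 h).symm

theorem specProj_self {j : DualDeck M} {b : QuantumTorus θ} (hb : b ∈ homog M θ j) :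
    specProj M θ j b = b := by
  rw [specProj_of_mem hb, if_pos rfl]

open Classical in
theorem specProj_W (j : DualDeck M) (x : Z2) :
    specProj M θ j (W θ x) = if Submodule.Quotient.mk x = j then W θ x else 0 :=
  specProj_of_mem (W_mem_homog x)

/-- Each `W_x` survives under exactly one projection, that of the class of `x`; density does the
rest. As `Ĝ` is finite, `B` is an algebraic direct sum of its spectral subspaces. -/
theorem sum_specProj (b : QuantumTorus θ) : ∑ j, specProj M θ j b = b := by
  classical
  have h := torus_ext (f := ∑ j, specProj M θ j) (g := LinearMap.id) (θ := θ)
    (by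
      simp only [LinearMap.coe_sum, Finset.sum_fn]
      exact continuous_finsetSum _ fun j _ => continuous_specProj j)
    continuous_id (fun x => by simp [specProj_W]) b
  simpa using h

theorem specProj_mem (j : DualDeck M) (b : QuantumTorus θ) : specProj M θ j b ∈ homog M θ j := by
  classical
  intro t
  have h := torus_ext (θ := θ) (f := (deckTilde M θ t).toAlgHom.toLinearMap ∘ₗ specProj M θ j)
    (g := deckChar M t (sect M j) • specProj M θ j)
    ((map_continuous (deckTilde M θ t)).comp (continuous_specProj j))
    ((continuous_specProj j).const_smul _) (fun x => by
      change deckTilde M θ t (specProj M θ j (W θ x)) =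
        deckChar M t (sect M j) • specProj M θ j (W θ x)
      rw [specProj_W]
      by_cases hx : Submodule.Quotient.mk x = j
      · rw [if_pos hx, ← hx]
        exact W_mem_homog x t
      · rw [if_neg hx, map_zero, smul_zero]) b
  exact h

/-! ### Representations of `B` from graded pieces -/

section GradedHom

variable {C : Type*} [Ring C] [Algebra ℂ C]

/-- The linear map which is `F j` on the spectral subspace of `j`. -/
def gradedLin (F : DualDeck M → QuantumTorus θ →ₗ[ℂ] C) : QuantumTorus θ →ₗ[ℂ] C :=
  ∑ j, F j ∘ₗ specProj M θ j

theorem gradedLin_apply (F : DualDeck M → QuantumTorus θ →ₗ[ℂ] C) (b : QuantumTorus θ) :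
    gradedLin F b = ∑ j, F j (specProj M θ j b) := by
  simp [gradedLin]

theorem gradedLin_of_mem (F : DualDeck M → QuantumTorus θ →ₗ[ℂ] C) {j : DualDeck M}
    {b : QuantumTorus θ} (hb : b ∈ homog M θ j) : gradedLin F b = F j b := by
  classical
  rw [gradedLin_apply, Finset.sum_eq_single j]
  · rw [specProj_self hb]
  · intro k _ hk
    rw [specProj_of_mem hb, if_neg hk.symm, map_zero]
  · simp

/-- The ⋆-homomorphism which is `F j` on the spectral subspace of `j`. -/
def gradedHom [StarRing C] (F : DualDeck M → QuantumTorus θ →ₗ[ℂ] C) (h1 : F 0 1 = 1)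
    (hmul : ∀ j k b c, b ∈ homog M θ j → c ∈ homog M θ k → F (j + k) (b * c) = F j b * F k c)
    (hstar : ∀ j b, b ∈ homog M θ j → F (-j) (star b) = star (F j b)) :
    QuantumTorus θ →⋆ₐ[ℂ] C :=
  { AlgHom.ofLinearMap (gradedLin F) (by rw [gradedLin_of_mem F one_mem_homog, h1])
      (fun b c => by
        -- Both factors are expanded into homogeneous components, so that multiplicativity is only
        -- needed between pieces of definite degree.
        conv_lhs => rw [← sum_specProj (M := M) b, ← sum_specProj (M := M) c, Finset.sum_mul_sum]
        rw [map_sum, gradedLin_apply, gradedLin_apply, Finset.sum_mul_sum]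
        refine Finset.sum_congr rfl fun j _ => ?_
        rw [map_sum]
        refine Finset.sum_congr rfl fun k _ => ?_
        rw [gradedLin_of_mem F (mul_mem_homog (specProj_mem j b) (specProj_mem k c)),
          hmul _ _ _ _ (specProj_mem j b) (specProj_mem k c)]) with
    map_star' := fun b => by
      change gradedLin F (star b) = star (gradedLin F b)
      conv_lhs => rw [← sum_specProj (M := M) b, star_sum, map_sum]
      rw [gradedLin_apply, star_sum]
      refine Finset.sum_congr rfl fun j _ => ?_
      rw [gradedLin_of_mem F (star_mem_homog (specProj_mem j b)), hstar _ _ (specProj_mem j b)] }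

end GradedHom

end Grading

/-! ### The isomorphism of `A ⋊_r Ĝ` with `B` -/

section Iso

variable {M : Matrix (Fin 2) (Fin 2) ℤ} [hM : Fact (1 < M.det)] {θ : ℝ}

theorem star_frame_mul_frame (j : DualDeck M) :
    star (frame M θ j : QuantumTorus θ) * (frame M θ j : QuantumTorus θ) = 1 :=
  (Unitary.mem_iff.1 (frame M θ j).2).1

theorem frame_mul_star_frame (j : DualDeck M) :
    (frame M θ j : QuantumTorus θ) * star (frame M θ j : QuantumTorus θ) = 1 :=
  (Unitary.mem_iff.1 (frame M θ j).2).2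

theorem frame_zero : (frame M θ 0 : QuantumTorus θ) = 1 := by
  simp [frame, sect_zero, W_zero]

variable (M θ) in
/-- The coefficient `b_j ∈ A` in `b = ∑ b_j μ_j`. -/
def frameCoeff (j : DualDeck M) : QuantumTorus θ →ₗ[ℂ] fixedAlg M θ where
  toFun b := ⟨specProj M θ 0 (b * star (frame M θ j : QuantumTorus θ)),
    mem_homog_zero_iff.1 (specProj_mem 0 _)⟩
  map_add' a b := by ext; simp [add_mul]
  map_smul' c a := by ext; simp

/-- Here `b μ_j^*` already has degree 0. The projection in the definition of `frameCoeff` serves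
only to make it a linear map on all of `B`. -/
theorem frameCoeff_of_mem {j : DualDeck M} {b : QuantumTorus θ} (hb : b ∈ homog M θ j) :
    (frameCoeff M θ j b : QuantumTorus θ) = b * star (frame M θ j : QuantumTorus θ) := by
  refine specProj_self ?_
  have := mul_mem_homog hb (star_mem_homog (frame_mem_homog (θ := θ) j))
  rwa [add_neg_cancel] at this

theorem coe_mul_frame_mem (a : fixedAlg M θ) (j : DualDeck M) :
    (a : QuantumTorus θ) * (frame M θ j : QuantumTorus θ) ∈ homog M θ j := by
  have := mul_mem_homog (mem_homog_zero_iff.2 a.2) (frame_mem_homog (θ := θ) j)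
  rwa [zero_add] at this

theorem frameCoeff_mul_frame (a : fixedAlg M θ) (j : DualDeck M) :
    frameCoeff M θ j ((a : QuantumTorus θ) * (frame M θ j : QuantumTorus θ)) = a := by
  ext
  rw [frameCoeff_of_mem (coe_mul_frame_mem a j), mul_assoc, frame_mul_star_frame, mul_one]

/-- The matrix coefficients of the left regular representation. -/
theorem coveringPair_coeff {j : DualDeck M} {b : QuantumTorus θ} (hb : b ∈ homog M θ j)
    (z : DualDeck M) :
    (((coveringPair M θ).ρ z (frameCoeff M θ j b) * ((coveringPair M θ).σ z j : fixedAlg M θ) :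
      fixedAlg M θ) : QuantumTorus θ) =
      (frame M θ z : QuantumTorus θ) * b * star (frame M θ (z + j) : QuantumTorus θ) := by
  change ((frame M θ z : QuantumTorus θ) * (frameCoeff M θ j b : QuantumTorus θ) *
    star (frame M θ z : QuantumTorus θ)) * ((frame M θ z : QuantumTorus θ) *
    (frame M θ j : QuantumTorus θ) * star (frame M θ (z + j) : QuantumTorus θ)) = _
  rw [frameCoeff_of_mem hb]
  calc (frame M θ z : QuantumTorus θ) * (b * star (frame M θ j : QuantumTorus θ)) *
        star (frame M θ z : QuantumTorus θ) * ((frame M θ z : QuantumTorus θ) *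
        (frame M θ j : QuantumTorus θ) * star (frame M θ (z + j) : QuantumTorus θ))
      = (frame M θ z : QuantumTorus θ) * b * (star (frame M θ j : QuantumTorus θ) *
        (star (frame M θ z : QuantumTorus θ) * (frame M θ z : QuantumTorus θ)) *
        (frame M θ j : QuantumTorus θ)) * star (frame M θ (z + j) : QuantumTorus θ) := by
        simp only [mul_assoc]
    _ = _ := by
        rw [star_frame_mul_frame, mul_one, star_frame_mul_frame, mul_one]

variable {K : Type*} [NormedAddCommGroup K] [InnerProductSpace ℂ K] [CompleteSpace K]
  (π₀ : fixedAlg M θ →⋆ₐ[ℂ] (K →L[ℂ] K))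

theorem leftRegular_apply {A G : Type*} [CStarAlgebra A] [AddGroup G] (P : TwistingPair A G)
    (π : A →⋆ₐ[ℂ] (K →L[ℂ] K)) (a : A) (x : G) (f : Ell2 G K) (z : G) :
    leftRegular P π a x f z = π (P.ρ (-z) a * (P.σ (-z) x : A)) (f (-x + z)) := rfl

/-- The left regular representation as a linear map in the coefficient. -/
def leftRegularLin {A G : Type*} [CStarAlgebra A] [AddGroup G] (P : TwistingPair A G)
    (π : A →⋆ₐ[ℂ] (K →L[ℂ] K)) (x : G) : A →ₗ[ℂ] (Ell2 G K →L[ℂ] Ell2 G K) where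
  toFun a := leftRegular P π a x
  map_add' a b := by
    ext f z
    rw [add_apply, lp.coeFn_add, Pi.add_apply]
    simp only [leftRegular_apply, map_add, add_mul, add_apply]
  map_smul' c a := by
    ext f z
    rw [smul_apply, lp.coeFn_smul, Pi.smul_apply]
    simp only [leftRegular_apply, map_smul, smul_mul_assoc, smul_apply, RingHom.id_apply]

/-- The graded pieces of the left regular representation of `B`. -/
def regPiece (j : DualDeck M) :
    QuantumTorus θ →ₗ[ℂ] (Ell2 (DualDeck M) K →L[ℂ] Ell2 (DualDeck M) K) :=
  leftRegularLin (coveringPair M θ) π₀ j ∘ₗ frameCoeff M θ j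

theorem regPiece_apply (j : DualDeck M) (b : QuantumTorus θ) (f : Ell2 (DualDeck M) K)
    (z : DualDeck M) :
    regPiece π₀ j b f z = π₀ ((coveringPair M θ).ρ (-z) (frameCoeff M θ j b) *
      ((coveringPair M θ).σ (-z) j : fixedAlg M θ)) (f (-j + z)) := rfl

theorem regPiece_one : regPiece (θ := θ) π₀ 0 1 = 1 := by
  ext f z
  have h : (coveringPair M θ).ρ (-z) (frameCoeff M θ 0 1) *
      ((coveringPair M θ).σ (-z) 0 : fixedAlg M θ) = 1 := by
    ext
    rw [coveringPair_coeff one_mem_homog, mul_one, add_zero, frame_mul_star_frame]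
    rfl
  rw [regPiece_apply, h, map_one, neg_zero, zero_add]
  rfl

/-- The matrix entries have the form `μ_z b μ_{z+j}^*`, so in a product the inner factor `μ_{z+j}^*
μ_{z+j}` drops out. Written this way, the cocycle `σ` has disappeared from the computation. -/
theorem regPiece_mul (j k : DualDeck M) (b c : QuantumTorus θ) (hb : b ∈ homog M θ j)
    (hc : c ∈ homog M θ k) : regPiece π₀ (j + k) (b * c) = regPiece π₀ j b * regPiece π₀ k c := by
  ext f z
  rw [mul_apply_eq_comp, regPiece_apply, regPiece_apply, regPiece_apply,
    ← mul_apply_eq_comp, ← map_mul]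
  have h : (coveringPair M θ).ρ (-z) (frameCoeff M θ (j + k) (b * c)) *
      ((coveringPair M θ).σ (-z) (j + k) : fixedAlg M θ) =
      (coveringPair M θ).ρ (-z) (frameCoeff M θ j b) *
      ((coveringPair M θ).σ (-z) j : fixedAlg M θ) *
      ((coveringPair M θ).ρ (-(-j + z)) (frameCoeff M θ k c) *
      ((coveringPair M θ).σ (-(-j + z)) k : fixedAlg M θ)) := by
    refine Subtype.ext ((coveringPair_coeff (mul_mem_homog hb hc) (-z)).trans ?_)
    refine Eq.trans ?_ (congrArg₂ (· * ·) (coveringPair_coeff hb (-z))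
      (coveringPair_coeff hc (-(-j + z)))).symm
    have h1 : -(-j + z) = -z + j := by abel
    rw [h1, add_assoc]
    calc _ = (frame M θ (-z) : QuantumTorus θ) * b * 1 * c *
        star (frame M θ (-z + (j + k)) : QuantumTorus θ) := by simp only [mul_assoc, one_mul]
      _ = _ := by
        rw [← star_frame_mul_frame (-z + j)]
        simp only [mul_assoc]
  have hz : -(j + k) + z = -k + (-j + z) := by abel
  rw [h, hz]

/-- The adjoint of an entry `μ_z b μ_{z+j}^*` is `μ_{z+j} b^* μ_z^*`, which is the entry at `z + j`
of `b^*` in degree `-j`. -/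
theorem regPiece_star (j : DualDeck M) (b : QuantumTorus θ) (hb : b ∈ homog M θ j) :
    regPiece π₀ (-j) (star b) = star (regPiece π₀ j b) := by
  rw [ContinuousLinearMap.star_eq_adjoint, ContinuousLinearMap.eq_adjoint_iff]
  intro f g
  rw [lp.inner_eq_tsum, lp.inner_eq_tsum, ← (Equiv.addLeft j).tsum_eq fun z =>
    ⟪f z, regPiece π₀ j b g z⟫_ℂ]
  refine tsum_congr fun z => ?_
  rw [regPiece_apply, regPiece_apply, Equiv.coe_addLeft, neg_neg, neg_add_cancel_left,
    ← ContinuousLinearMap.adjoint_inner_left, ← ContinuousLinearMap.star_eq_adjoint, ← map_star]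
  congr 3
  ext
  change _ = star (((coveringPair M θ).ρ (-(j + z)) (frameCoeff M θ j b) *
      ((coveringPair M θ).σ (-(j + z)) j : fixedAlg M θ) : fixedAlg M θ) : QuantumTorus θ)
  rw [coveringPair_coeff hb, coveringPair_coeff (star_mem_homog hb)]
  have h1 : -(j + z) = -z + -j := by abel
  rw [h1, neg_add_cancel_right, star_mul, star_mul, star_star, mul_assoc]

/-- The left regular representation of `B`. -/
def regHom : QuantumTorus θ →⋆ₐ[ℂ] (Ell2 (DualDeck M) K →L[ℂ] Ell2 (DualDeck M) K) :=
  gradedHom (regPiece π₀) (regPiece_one π₀) (regPiece_mul π₀) (regPiece_star π₀)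

theorem regHom_apply (b : QuantumTorus θ) :
    regHom π₀ b = ∑ j, regPiece π₀ j (specProj M θ j b) := gradedLin_apply _ b

theorem regHom_mul_frame (a : fixedAlg M θ) (j : DualDeck M) :
    regHom π₀ ((a : QuantumTorus θ) * (frame M θ j : QuantumTorus θ)) =
      leftRegular (coveringPair M θ) π₀ a j := by
  refine (gradedLin_of_mem _ (coe_mul_frame_mem a j)).trans ?_
  change leftRegular _ _ (frameCoeff M θ j _) j = _
  rw [frameCoeff_mul_frame]

theorem regHom_mem (b : QuantumTorus θ) :
    regHom π₀ b ∈ reducedCrossedProduct (coveringPair M θ) π₀ := by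
  rw [regHom_apply]
  exact sum_mem fun j _ => (crossedElem (coveringPair M θ) π₀
    (frameCoeff M θ j (specProj M θ j b)) j).2

/-- Apply the operator to a vector at the neutral element and read the coordinate `z`: only the
component `b_z` contributes, through `π₀(μ_{-z} b_z)`. Faithfulness of `π₀` and unitarity of the
frame give `b_z = 0`. -/
theorem regHom_injective (hπ₀ : Function.Injective π₀) : Function.Injective (regHom π₀) := by
  classical
  rw [injective_iff_map_eq_zero]
  intro b hb
  rw [← sum_specProj (M := M) b]
  refine Finset.sum_eq_zero fun z _ => ?_
  have h1 : π₀ ((coveringPair M θ).ρ (-z) (frameCoeff M θ z (specProj M θ z b)) *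
      ((coveringPair M θ).σ (-z) z : fixedAlg M θ)) = 0 := by
    ext ξ
    have h2 : regHom π₀ b (lp.single 2 0 ξ) z = 0 := by
      rw [hb]
      rfl
    rw [regHom_apply, sum_apply, lp.coeFn_sum, Finset.sum_apply, Finset.sum_eq_single z] at h2
    · rw [regPiece_apply, neg_add_cancel, lp.single_apply_self] at h2
      exact h2
    · intro j _ hj
      rw [regPiece_apply, lp.single_apply_ne, map_zero]
      exact fun h => hj (neg_add_eq_zero.1 h)
    · simp
  have h2 := congrArg Subtype.val (hπ₀ (h1.trans (map_zero π₀).symm))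
  rw [coveringPair_coeff (specProj_mem z b), neg_add_cancel, frame_zero, star_one, mul_one] at h2
  have h3 : star (frame M θ (-z) : QuantumTorus θ) * ((frame M θ (-z) : QuantumTorus θ) *
      specProj M θ z b) = 0 := by
    rw [h2]
    exact mul_zero _
  rwa [← mul_assoc, star_frame_mul_frame, one_mul] at h3

/-- An injective ⋆-homomorphism of C⋆-algebras is isometric, so its range is closed, and this range
contains every generator `a δ_j`. -/
theorem reducedCrossedProduct_le_range (hπ₀ : Function.Injective π₀) :
    reducedCrossedProduct (coveringPair M θ) π₀ ≤ (regHom π₀).range := by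
  refine StarSubalgebra.topologicalClosure_minimal (StarAlgebra.adjoin_le ?_) ?_
  · rintro _ ⟨⟨a, j⟩, rfl⟩
    exact ⟨_, regHom_mul_frame π₀ a j⟩
  · have h := (NonUnitalStarAlgHom.isometry (regHom π₀)
      (regHom_injective π₀ hπ₀)).isClosedEmbedding.isClosed_range
    exact h

/-- The isomorphism of `B` onto `A ⋊_r Ĝ`. -/
def regEquiv (hπ₀ : Function.Injective π₀) :
    QuantumTorus θ ≃⋆ₐ[ℂ] reducedCrossedProduct (coveringPair M θ) π₀ :=
  StarAlgEquiv.ofBijective (StarAlgHom.codRestrict (regHom π₀) _ (regHom_mem π₀))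
    ⟨fun a b h => regHom_injective π₀ hπ₀ (congrArg Subtype.val h), fun c => by
      obtain ⟨b, hb⟩ := reducedCrossedProduct_le_range π₀ hπ₀ c.2
      exact ⟨b, Subtype.ext hb⟩⟩

theorem regEquiv_mul_frame (hπ₀ : Function.Injective π₀) (a : fixedAlg M θ) (j : DualDeck M) :
    regEquiv π₀ hπ₀ ((a : QuantumTorus θ) * (frame M θ j : QuantumTorus θ)) =
      crossedElem (coveringPair M θ) π₀ a j := Subtype.ext (regHom_mul_frame π₀ a j)

theorem regEquiv_symm_crossedElem (hπ₀ : Function.Injective π₀) (a : fixedAlg M θ)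
    (j : DualDeck M) : (regEquiv π₀ hπ₀).symm (crossedElem (coveringPair M θ) π₀ a j) =
      (a : QuantumTorus θ) * (frame M θ j : QuantumTorus θ) := by
  rw [← regEquiv_mul_frame π₀ hπ₀, StarAlgEquiv.symm_apply_apply]

end Iso

/-! ### The representation on `(L²(B) ⊗ ℓ²(Ĝ) ⊗ ℂ²)²` -/

section Rep

section Abstract

variable {G H : Type*} [AddCommGroup G] [Fintype G] [NormedAddCommGroup H] [InnerProductSpace ℂ H]

theorem equivRep_fst (S T : H →L[ℂ] H) (h : G) (x : EquivHilb G H) (p : G × Fin 2) :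
    (equivRep S T h x).fst p = S (x.fst (-h + p.1, p.2)) := rfl

theorem equivRep_snd (S T : H →L[ℂ] H) (h : G) (x : EquivHilb G H) (p : G × Fin 2) :
    (equivRep S T h x).snd p = T (x.snd (-h + p.1, p.2)) := rfl

theorem equivHilb_ext {G H : Type*} [Fintype G] [NormedAddCommGroup H] {x y : EquivHilb G H} (h1 : ∀ p, x.fst p = y.fst p)
    (h2 : ∀ p, x.snd p = y.snd p) : x = y := by
  apply WithLp.ofLp_injective 2
  exact Prod.ext (PiLp.ext h1) (PiLp.ext h2)

theorem equivRep_one : equivRep (1 : H →L[ℂ] H) 1 (0 : G) = 1 := by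
  ext1 x
  refine equivHilb_ext (fun p => ?_) fun p => ?_
  · rw [equivRep_fst, neg_zero, zero_add]; rfl
  · rw [equivRep_snd, neg_zero, zero_add]; rfl

theorem equivRep_mul (S S' T T' : H →L[ℂ] H) (h k : G) :
    equivRep (S * S') (T * T') (h + k) = equivRep S T h * equivRep S' T' k := by
  have hz : ∀ g : G, -(h + k) + g = -k + (-h + g) := fun g => by abel
  ext1 x
  refine equivHilb_ext (fun p => ?_) fun p => ?_
  · change _ = (equivRep S T h (equivRep S' T' k x)).fst p
    rw [equivRep_fst, equivRep_fst, equivRep_fst, hz]; rfl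
  · change _ = (equivRep S T h (equivRep S' T' k x)).snd p
    rw [equivRep_snd, equivRep_snd, equivRep_snd, hz]; rfl

theorem equivRep_star [CompleteSpace H] (S T : H →L[ℂ] H) (h : G) :
    equivRep (star S) (star T) (-h) = star (equivRep S T h) := by
  rw [ContinuousLinearMap.star_eq_adjoint (equivRep S T h), ContinuousLinearMap.eq_adjoint_iff]
  intro x y
  rw [WithLp.prod_inner_apply, WithLp.prod_inner_apply]
  have key : ∀ (R : H →L[ℂ] H) (u v : G × Fin 2 → H),
      ∑ p, ⟪star R (u (- -h + p.1, p.2)), v p⟫_ℂ = ∑ p, ⟪u p, R (v (-h + p.1, p.2))⟫_ℂ := by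
    intro R u v
    rw [← Equiv.sum_comp ((Equiv.addLeft h).prodCongr (Equiv.refl (Fin 2)))
      fun p => ⟪u p, R (v (-h + p.1, p.2))⟫_ℂ]
    refine Finset.sum_congr rfl fun p _ => ?_
    rw [ContinuousLinearMap.star_eq_adjoint, ContinuousLinearMap.adjoint_inner_left, neg_neg]
    change _ = ⟪u (h + p.1, p.2), R (v (-h + (h + p.1), p.2))⟫_ℂ
    rw [neg_add_cancel_left]
  congr 1
  · rw [PiLp.inner_apply, PiLp.inner_apply]
    exact key S x.fst y.fst
  · rw [PiLp.inner_apply, PiLp.inner_apply]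
    exact key T x.snd y.snd

end Abstract

variable {M : Matrix (Fin 2) (Fin 2) ℤ} [hM : Fact (1 < M.det)] {θ : ℝ}

variable (M θ) in
/-- The graded pieces of the representation of `B` on `(L²(B) ⊗ ℓ²(Ĝ) ⊗ ℂ²)²`. -/
def hatPiece (j : DualDeck M) : QuantumTorus θ →ₗ[ℂ]
    (EquivHilb (DualDeck M) (L2B θ) →L[ℂ] EquivHilb (DualDeck M) (L2B θ)) where
  toFun b := equivRep (piTau θ b) (piTau θ b) j
  map_add' a b := by
    ext1 x
    refine equivHilb_ext (fun p => ?_) fun p => ?_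
    · change _ = (equivRep (piTau θ a) (piTau θ a) j x).fst p +
        (equivRep (piTau θ b) (piTau θ b) j x).fst p
      simp only [equivRep_fst, map_add, add_apply]
    · change _ = (equivRep (piTau θ a) (piTau θ a) j x).snd p +
        (equivRep (piTau θ b) (piTau θ b) j x).snd p
      simp only [equivRep_snd, map_add, add_apply]
  map_smul' c a := by
    ext1 x
    refine equivHilb_ext (fun p => ?_) fun p => ?_
    · change _ = c • (equivRep (piTau θ a) (piTau θ a) j x).fst p
      simp only [equivRep_fst, map_smul, smul_apply]
    · change _ = c • (equivRep (piTau θ a) (piTau θ a) j x).snd p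
      simp only [equivRep_snd, map_smul, smul_apply]

variable (M θ) in
/-- The representation of `B` on `(L²(B) ⊗ ℓ²(Ĝ) ⊗ ℂ²)²`. -/
def hatHom : QuantumTorus θ →⋆ₐ[ℂ]
    (EquivHilb (DualDeck M) (L2B θ) →L[ℂ] EquivHilb (DualDeck M) (L2B θ)) :=
  gradedHom (hatPiece M θ)
    (by
      change equivRep (piTau θ 1) (piTau θ 1) 0 = 1
      rw [map_one, equivRep_one])
    -- The factorization holds for arbitrary `b` and `c`; degrees only decide which translation is
    -- attached to an element.
    (fun j k b c _ _ => by
      change equivRep (piTau θ (b * c)) (piTau θ (b * c)) (j + k) = _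
      rw [map_mul, equivRep_mul]
      rfl)
    (fun j b _ => by
      change equivRep (piTau θ (star b)) (piTau θ (star b)) (-j) = _
      rw [map_star, equivRep_star]
      rfl)

theorem hatHom_of_mem {j : DualDeck M} {b : QuantumTorus θ} (hb : b ∈ homog M θ j) :
    hatHom M θ b = equivRep (piTau θ b) (piTau θ b) j := gradedLin_of_mem _ hb

theorem hatHom_mul_frame (a : fixedAlg M θ) (j : DualDeck M) :
    hatHom M θ ((a : QuantumTorus θ) * (frame M θ j : QuantumTorus θ)) = hatRep M θ a j := by
  rw [hatHom_of_mem (coe_mul_frame_mem a j), map_mul, hatRep]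

end Rep

/-! ### Schwartz sequences and the smooth noncommutative torus -/

section Schwartz

/-- The weight `1 + r₁² + r₂²`. -/
def wt (r : Z2) : ℝ := 1 + (r 0 : ℝ) ^ 2 + (r 1 : ℝ) ^ 2

theorem one_le_wt (r : Z2) : 1 ≤ wt r := by
  rw [wt]
  nlinarith [sq_nonneg (r 0 : ℝ), sq_nonneg (r 1 : ℝ)]

theorem wt_pos (r : Z2) : 0 < wt r := one_pos.trans_le (one_le_wt r)

theorem wt_neg (r : Z2) : wt (-r) = wt r := by
  simp [wt]

/-- Submultiplicativity up to a constant is what keeps rapid decay stable under convolution. -/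
theorem wt_add_le (r s : Z2) : wt (r + s) ≤ 2 * (wt r * wt s) := by
  simp only [wt, Pi.add_apply]
  push_cast
  nlinarith [sq_nonneg ((r 0 : ℝ) - s 0), sq_nonneg ((r 1 : ℝ) - s 1),
    mul_nonneg (add_nonneg (sq_nonneg (r 0 : ℝ)) (sq_nonneg (r 1 : ℝ)))
      (add_nonneg (sq_nonneg (s 0 : ℝ)) (sq_nonneg (s 1 : ℝ)))]

/-- The square of the weight dominates `(1 + r₁²)(1 + r₂²)`, whose inverse is a product of two
convergent series. -/
theorem summable_inv_wt_sq : Summable fun r : Z2 => (wt r ^ 2)⁻¹ := by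
  have h1 : Summable fun n : ℤ => (1 + (n : ℝ) ^ 2)⁻¹ := by
    refine Summable.of_norm_bounded_eventually
      (Real.summable_one_div_int_pow (p := 2).2 one_lt_two) ?_
    have h : ∀ᶠ n : ℤ in Filter.cofinite, n ≠ 0 := by
      rw [Filter.eventually_cofinite]
      simp
    filter_upwards [h] with n hn
    have hn' : (0 : ℝ) < (n : ℝ) ^ 2 := by positivity
    rw [Real.norm_of_nonneg (by positivity), one_div]
    exact inv_anti₀ hn' (by linarith)
  have h2 : Summable fun p : ℤ × ℤ => (1 + (p.1 : ℝ) ^ 2)⁻¹ * (1 + (p.2 : ℝ) ^ 2)⁻¹ :=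
    h1.mul_of_nonneg h1 (fun n => by positivity) fun n => by positivity
  have h3 := (finTwoArrowEquiv ℤ).summable_iff.2 h2
  refine Summable.of_nonneg_of_le (fun r => by positivity) (fun r => ?_) h3
  change (wt r ^ 2)⁻¹ ≤ (1 + (r 0 : ℝ) ^ 2)⁻¹ * (1 + (r 1 : ℝ) ^ 2)⁻¹
  rw [← mul_inv]
  refine inv_anti₀ (by positivity) ?_
  rw [wt]
  nlinarith [sq_nonneg (r 0 : ℝ), sq_nonneg (r 1 : ℝ),
    mul_nonneg (sq_nonneg (r 0 : ℝ)) (sq_nonneg (r 1 : ℝ))]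

theorem isSchwartz_iff {α : Z2 → ℂ} :
    IsSchwartz α ↔ ∀ k : ℕ, Summable fun r => wt r ^ k * ‖α r‖ := by
  constructor
  · intro h k
    -- The factor 2 appears because the definition bounds the squared modulus; the two extra powers
    -- of the weight pay for summability over `ℤ²`.
    obtain ⟨b, hb⟩ := h (2 * (k + 2))
    refine Summable.of_nonneg_of_le (fun r => mul_nonneg (pow_nonneg (wt_pos r).le _)
      (norm_nonneg _)) (fun r => ?_) (summable_inv_wt_sq.mul_left (Real.sqrt b))
    have h1 : (wt r ^ (k + 2) * ‖α r‖) ^ 2 ≤ b := by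
      have := hb ⟨r, rfl⟩
      rw [mul_pow, ← pow_mul, mul_comm (k + 2)]
      exact this
    have h2 := Real.le_sqrt_of_sq_le h1
    have h3 := wt_pos r
    rw [← div_eq_mul_inv, le_div_iff₀ (by positivity)]
    calc wt r ^ k * ‖α r‖ * wt r ^ 2 = wt r ^ (k + 2) * ‖α r‖ := by ring
      _ ≤ _ := h2
  · intro h k
    have hb : ∀ k r, wt r ^ k * ‖α r‖ ≤ ∑' r, wt r ^ k * ‖α r‖ := fun k r =>
      (h k).le_tsum r fun s _ => mul_nonneg (pow_nonneg (wt_pos s).le _) (norm_nonneg _)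
    -- The squared modulus is split into two factors, only one of which carries the weight; each
    -- factor is at most its own sum.
    refine ⟨(∑' r, wt r ^ k * ‖α r‖) * ∑' r, wt r ^ 0 * ‖α r‖, ?_⟩
    rintro _ ⟨r, rfl⟩
    have h1 := hb k r
    have h2 := hb 0 r
    have h3 : 0 ≤ wt r ^ k * ‖α r‖ := mul_nonneg (pow_nonneg (wt_pos r).le _) (norm_nonneg _)
    calc _ = (wt r ^ k * ‖α r‖) * (wt r ^ 0 * ‖α r‖) := by rw [wt]; ring
      _ ≤ _ := mul_le_mul h1 h2 (by simp) (h3.trans h1)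

theorem IsSchwartz.summable_norm {α : Z2 → ℂ} (h : IsSchwartz α) : Summable fun r => ‖α r‖ := by
  simpa using isSchwartz_iff.1 h 0

theorem norm_W (θ : ℝ) (r : Z2) : ‖W θ r‖ = ‖(1 : QuantumTorus θ)‖ := by
  have := CStarRing.norm_mul_coe_unitary (1 : QuantumTorus θ) ⟨W θ r, W_mem_unitary θ r⟩
  rwa [one_mul] at this

theorem IsSchwartz.summable_norm_W {α : Z2 → ℂ} (h : IsSchwartz α) (θ : ℝ) :
    Summable fun r => ‖α r • W θ r‖ := by
  simp only [norm_smul, norm_W]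
  exact h.summable_norm.mul_right _

theorem IsSchwartz.of_norm_le {α β : Z2 → ℂ} (h : IsSchwartz α) (hle : ∀ r, ‖β r‖ ≤ ‖α r‖) :
    IsSchwartz β := by
  rw [isSchwartz_iff] at h ⊢
  refine fun k => Summable.of_nonneg_of_le (fun r => mul_nonneg (pow_nonneg (wt_pos r).le _)
      (norm_nonneg _)) (fun r => ?_) (h k)
  exact mul_le_mul_of_nonneg_left (hle r) (pow_nonneg (wt_pos r).le _)

theorem norm_sigmaTheta (θ : ℝ) (x y : Z2) : ‖sigmaTheta θ x y‖ = 1 := by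
  rw [sigmaTheta, Complex.norm_exp]
  simp

/-- Reindexing of a double series by its diagonals. -/
def diagEquiv : Z2 × Z2 ≃ Z2 × Z2 where
  toFun p := (p.2, p.1 - p.2)
  invFun p := (p.1 + p.2, p.1)
  left_inv p := by simp
  right_inv p := by simp

/-- The coefficients of a product form a twisted convolution. The twist has modulus one, so the
estimates are those for an ordinary convolution of rapidly decreasing sequences. -/
theorem smoothTorus_mul_mem {θ : ℝ} {a b : QuantumTorus θ} (ha : a ∈ smoothTorus θ)
    (hb : b ∈ smoothTorus θ) : a * b ∈ smoothTorus θ := by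
  obtain ⟨α, hα, hαa⟩ := ha
  obtain ⟨β, hβ, hβb⟩ := hb
  have hsum : ∀ k, Summable fun p : Z2 × Z2 =>
      wt p.1 ^ k * (‖α p.2‖ * ‖β (p.1 - p.2)‖) := fun k => by
    have h1 : Summable fun p : Z2 × Z2 => (wt p.1 ^ k * ‖α p.1‖) * (wt p.2 ^ k * ‖β p.2‖) :=
      (isSchwartz_iff.1 hα k).mul_of_nonneg (isSchwartz_iff.1 hβ k)
        (fun r => mul_nonneg (pow_nonneg (wt_pos r).le _) (norm_nonneg _))
        (fun r => mul_nonneg (pow_nonneg (wt_pos r).le _) (norm_nonneg _))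
    -- The constant is the `k`-th power of the one in `wt_add_le`.
    have h2 := (diagEquiv.summable_iff.2 h1).mul_left (2 ^ k)
    refine Summable.of_nonneg_of_le (fun p => ?_) (fun p => ?_) h2
    · exact mul_nonneg (pow_nonneg (wt_pos _).le _) (by positivity)
    · change _ ≤ 2 ^ k * ((wt p.2 ^ k * ‖α p.2‖) * (wt (p.1 - p.2) ^ k * ‖β (p.1 - p.2)‖))
      have h3 : wt p.1 ^ k ≤ (2 * (wt p.2 * wt (p.1 - p.2))) ^ k := by
        refine pow_le_pow_left₀ (wt_pos _).le ?_ k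
        have := wt_add_le p.2 (p.1 - p.2)
        rwa [add_sub_cancel] at this
      calc _ ≤ (2 * (wt p.2 * wt (p.1 - p.2))) ^ k * (‖α p.2‖ * ‖β (p.1 - p.2)‖) :=
            mul_le_mul_of_nonneg_right h3 (by positivity)
        _ = _ := by rw [mul_pow, mul_pow]; ring
  have hnorm : ∀ t r, ‖α r * β (t - r) * sigmaTheta θ r (t - r)‖ = ‖α r‖ * ‖β (t - r)‖ :=
    fun t r => by rw [norm_mul, norm_mul, norm_sigmaTheta, mul_one]
  have hsc : Summable fun p : Z2 × Z2 =>
      ‖α p.2 * β (p.1 - p.2) * sigmaTheta θ p.2 (p.1 - p.2)‖ := by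
    simpa [norm_sigmaTheta] using hsum 0
  refine ⟨fun t => ∑' r, α r * β (t - r) * sigmaTheta θ r (t - r), ?_, ?_⟩
  · rw [isSchwartz_iff]
    intro k
    refine Summable.of_nonneg_of_le (fun t => mul_nonneg (pow_nonneg (wt_pos t).le _)
      (norm_nonneg _)) (fun t => ?_) (hsum k).prod
    have h1 : Summable fun r => ‖α r * β (t - r) * sigmaTheta θ r (t - r)‖ := hsc.prod_factor t
    dsimp only
    rw [tsum_mul_left]
    refine mul_le_mul_of_nonneg_left ?_ (pow_nonneg (wt_pos t).le _)
    refine (norm_tsum_le_tsum_norm h1).trans_eq (tsum_congr fun r => hnorm t r)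
  · have h0 : Summable fun p : Z2 × Z2 => (α p.1 • W θ p.1) * (β p.2 • W θ p.2) :=
      summable_mul_of_summable_norm (f := fun r => α r • W θ r) (g := fun r => β r • W θ r)
        (hα.summable_norm_W θ) (hβ.summable_norm_W θ)
    have h1 := hαa.mul hβb h0
    have h2 := diagEquiv.hasSum_iff.2 h1
    refine HasSum.prod_fiberwise h2 fun t => ?_
    have h3 : HasSum (fun r => α r * β (t - r) * sigmaTheta θ r (t - r))
      (∑' r, α r * β (t - r) * sigmaTheta θ r (t - r)) :=
      (Summable.of_norm (hsc.prod_factor t)).hasSum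
    convert h3.smul_const (W θ t) using 2 with r
    change (α r • W θ r) * (β (t - r) • W θ (t - r)) = _
    rw [smul_mul_smul_comm, W_mul, smul_smul, add_sub_cancel]

theorem smoothTorus_star_mem {θ : ℝ} {a : QuantumTorus θ} (ha : a ∈ smoothTorus θ) :
    star a ∈ smoothTorus θ := by
  obtain ⟨α, hα, hαa⟩ := ha
  refine ⟨fun r => star (α (-r)), ?_, ?_⟩
  · rw [isSchwartz_iff] at hα ⊢
    intro k
    have := (Equiv.neg Z2).summable_iff.2 (hα k)
    refine this.congr fun r => ?_
    simp [wt_neg]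
  · have h := (Equiv.neg Z2).hasSum_iff.2 hαa.star
    convert h using 2 with r
    simp [W_star]

theorem W_mem_smoothTorus (θ : ℝ) (r : Z2) : W θ r ∈ smoothTorus θ := by
  refine ⟨Pi.single r 1, isSchwartz_single r, ?_⟩
  convert hasSum_ite_eq r (W θ r) using 2 with s
  by_cases h : s = r
  · subst h; simp
  · simp [h]

theorem smoothTorus_smul_mem {θ : ℝ} (c : ℂ) {a : QuantumTorus θ} (ha : a ∈ smoothTorus θ) :
    c • a ∈ smoothTorus θ := by
  obtain ⟨α, hα, hαa⟩ := ha
  exact ⟨c • α, hα.smul c, by simpa [mul_smul] using hαa.const_smul c⟩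

/-- The smooth noncommutative torus as a ⋆-subalgebra. -/
def smoothSubalgebra (θ : ℝ) : StarSubalgebra ℂ (QuantumTorus θ) where
  carrier := smoothTorus θ
  mul_mem' := smoothTorus_mul_mem
  add_mem' := by
    rintro a b ⟨α, hα, hαa⟩ ⟨β, hβ, hβb⟩
    exact ⟨α + β, hα.add hβ, by simpa [add_smul] using hαa.add hβb⟩
  algebraMap_mem' := fun r => by
    rw [Algebra.algebraMap_eq_smul_one, ← W_zero]
    exact smoothTorus_smul_mem r (W_mem_smoothTorus θ 0)
  star_mem' := smoothTorus_star_mem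

theorem dense_smoothTorus (θ : ℝ) : Dense (smoothTorus θ) := by
  refine (dense_spanW θ).mono fun b hb => ?_
  have h : Submodule.span ℂ (Set.range (W θ)) ≤
      Subalgebra.toSubmodule (smoothSubalgebra θ).toSubalgebra := by
    rw [Submodule.span_le]
    rintro _ ⟨r, rfl⟩
    exact W_mem_smoothTorus θ r
  exact h hb

variable {M : Matrix (Fin 2) (Fin 2) ℤ} [hM : Fact (1 < M.det)] {θ : ℝ}

/-- The projection merely restricts the coefficient sequence to one coset of `Mᵀ ℤ²`. -/
theorem specProj_mem_smoothTorus (j : DualDeck M) {b : QuantumTorus θ} (hb : b ∈ smoothTorus θ) :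
    specProj M θ j b ∈ smoothTorus θ := by
  classical
  obtain ⟨α, hα, hαb⟩ := hb
  refine ⟨fun r => if Submodule.Quotient.mk r = j then α r else 0, hα.of_norm_le fun r => ?_, ?_⟩
  · by_cases h : Submodule.Quotient.mk r = j <;> simp [h]
  · have h := hαb.map (specProj M θ j) (continuous_specProj j)
    convert h using 2 with r
    rw [Function.comp_apply, map_smul, specProj_W]
    by_cases h : Submodule.Quotient.mk r = j <;> simp [h]

variable {K : Type*} [NormedAddCommGroup K] [InnerProductSpace ℂ K] [CompleteSpace K]
  (π₀ : fixedAlg M θ →⋆ₐ[ℂ] (K →L[ℂ] K))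

/-- The frame is smooth, so `a μ_j` is smooth whenever `a` is. Conversely, the coefficients `b_j
μ_j^*` of a smooth `b` are smooth because the spectral projections preserve `𝒯_B`. Closure under the
operations and density can then be read off from `𝒯_B`. -/
theorem crossedSmooth_eq (hπ₀ : Function.Injective π₀) :
    crossedSmooth (coveringPair M θ) π₀ (smoothFixed M θ) =
      (regEquiv π₀ hπ₀).symm ⁻¹' smoothTorus θ := by
  ext c
  constructor
  · rintro ⟨f, hf, rfl⟩
    change (regEquiv π₀ hπ₀).symm _ ∈ smoothSubalgebra θ
    rw [map_sum]
    refine sum_mem fun j _ => ?_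
    rw [regEquiv_symm_crossedElem]
    exact smoothTorus_mul_mem (hf j) (W_mem_smoothTorus θ _)
  · intro hc
    set b := (regEquiv π₀ hπ₀).symm c with hb
    have hc : b ∈ smoothTorus θ := hc
    have hcb : c = regEquiv π₀ hπ₀ b := by rw [hb, StarAlgEquiv.apply_symm_apply]
    refine ⟨fun j => frameCoeff M θ j (specProj M θ j b), fun j => ?_, ?_⟩
    · change (frameCoeff M θ j (specProj M θ j b) : QuantumTorus θ) ∈ smoothTorus θ
      rw [frameCoeff_of_mem (specProj_mem j b)]
      exact smoothTorus_mul_mem (specProj_mem_smoothTorus j hc)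
        (smoothTorus_star_mem (W_mem_smoothTorus θ _))
    · rw [hcb]
      conv_lhs => rw [← sum_specProj (M := M) b, map_sum]
      refine Finset.sum_congr rfl fun j _ => ?_
      rw [← regEquiv_mul_frame π₀ hπ₀, frameCoeff_of_mem (specProj_mem j b), mul_assoc,
        star_frame_mul_frame, mul_one]

end Schwartz

/-! ### The Dirac operator in coordinates -/

section DiracTilde

variable (M : Matrix (Fin 2) (Fin 2) ℤ) [hM : Fact (1 < M.det)] (θ : ℝ)

/-- The coordinates of `(L²(B) ⊗ ℓ²(Ĝ) ⊗ ℂ²)²`. -/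
def torusCoord : EquivHilb (DualDeck M) (L2B θ) ≃ₗᵢ[ℂ]
    Ell2 (Z2 × DualDeck M) (EuclideanSpace ℂ (Fin 2 ⊕ Fin 2)) :=
  coord (fourier θ)

/-- The blocks of `D̃`. -/
def torusBlock (i : Z2 × DualDeck M) :
    EuclideanSpace ℂ (Fin 2 ⊕ Fin 2) →L[ℂ] EuclideanSpace ℂ (Fin 2 ⊕ Fin 2) :=
  diracBlock (lengthFun M i.2) (2 * Real.pi * i.1.toComplex)

theorem diracTilde_eq : diracTilde M θ = blockOp (torusCoord M θ) (torusBlock M) := by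
  have h : ∀ n : Z2, (2 * Real.pi * star n.toComplex : ℂ) = star (2 * Real.pi * n.toComplex) :=
    fun n => by simp
  rw [diracTilde, diracPlus_eq, diracMinus_eq]
  simp only [h]
  exact equivDirac_eq_blockOp (fourier θ) _ _

/-- The blocks of `|D̃|`. -/
def torusAbs (i : Z2 × DualDeck M) : ℝ :=
  Real.sqrt (‖(sect M i.2).toComplex‖ ^ 2 + ‖(2 * Real.pi * i.1.toComplex : ℂ)‖ ^ 2)

theorem eps_isHermitian (x : Z2) : (eps x).IsHermitian := by
  ext i j
  fin_cases i <;> fin_cases j <;> simp [eps, sub_eq_add_neg]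

theorem eps_mul_self (x : Z2) :
    eps x * eps x = ((‖x.toComplex‖ ^ 2 : ℝ) : ℂ) • (1 : Matrix (Fin 2) (Fin 2) ℂ) := by
  have h : ((‖x.toComplex‖ ^ 2 : ℝ) : ℂ) =
      ((x 0 : ℂ) + Complex.I * x 1) * ((x 0 : ℂ) - Complex.I * x 1) := by
    rw [Complex.ofReal_pow, ← Complex.mul_conj']
    simp [Z2.toComplex, sub_eq_add_neg]
  rw [h]
  ext i j
  fin_cases i <;> fin_cases j <;> simp [eps, Matrix.mul_apply] <;> ring

theorem torusBlock_isSelfAdjoint (i : Z2 × DualDeck M) : IsSelfAdjoint (torusBlock M i) :=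
  diracBlock_isSelfAdjoint (eps_isHermitian _) _

theorem torusAbs_nonneg (i : Z2 × DualDeck M) : 0 ≤ torusAbs M i := Real.sqrt_nonneg _

theorem torusBlock_mul_self (i : Z2 × DualDeck M) :
    torusBlock M i * torusBlock M i = ((torusAbs M i ^ 2 : ℝ) : ℂ) • 1 := by
  rw [torusBlock, lengthFun, diracBlock_mul_self (eps_mul_self _), torusAbs, Real.sq_sqrt (by positivity)]
  congr 1
  rw [mul_comm (star _), Complex.star_def, Complex.mul_conj']
  push_cast
  rfl

/-- A bound on the eigenvalue confines the Fourier index to a finite box, and the group index ranges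
over a finite set. -/
theorem tendsto_torusAbs : Filter.Tendsto (torusAbs M) Filter.cofinite Filter.atTop := by
  rw [Filter.tendsto_atTop]
  intro C
  rw [Filter.eventually_cofinite]
  obtain ⟨N, hN⟩ := exists_int_gt C
  refine Set.Finite.subset (((Set.finite_Icc (fun _ => -N : Z2) (fun _ => N))).prod
    (Set.finite_univ (α := DualDeck M))) ?_
  rintro ⟨(m : Z2), g⟩ h
  have h : ¬ C ≤ torusAbs M (m, g) := h
  have hsq : ∀ k : Fin 2, (m k : ℝ) ^ 2 ≤ torusAbs M (m, g) ^ 2 := fun k => by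
    rw [torusAbs, Real.sq_sqrt (by positivity), norm_mul, mul_pow]
    have h1 : ‖Z2.toComplex m‖ ^ 2 = (m 0 : ℝ) ^ 2 + (m 1 : ℝ) ^ 2 := by
      rw [← Complex.normSq_eq_norm_sq, Complex.normSq_apply]
      simp [Z2.toComplex]
      ring
    -- Since `2π ≥ 1`, this factor may be dropped when bounding each coordinate by the eigenvalue.
    have h2 : 1 ≤ ‖(2 * Real.pi : ℂ)‖ ^ 2 := by
      have : ‖(2 * Real.pi : ℂ)‖ = 2 * Real.pi := by
        simp [abs_of_pos Real.pi_pos]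
      rw [this]
      nlinarith [Real.pi_gt_three]
    have h3 : (m k : ℝ) ^ 2 ≤ (m 0 : ℝ) ^ 2 + (m 1 : ℝ) ^ 2 := by
      fin_cases k
      · exact le_add_of_nonneg_right (sq_nonneg _)
      · exact le_add_of_nonneg_left (sq_nonneg _)
    simp only [h1]
    nlinarith [sq_nonneg ‖(sect M g).toComplex‖, sq_nonneg (m 0 : ℝ), sq_nonneg (m 1 : ℝ)]
  have hk : ∀ k : Fin 2, |m k| ≤ N := fun k => by
    have h1 := abs_le_of_sq_le_sq (hsq k) (torusAbs_nonneg M _)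
    have h2 : |(m k : ℝ)| ≤ N := by
      rw [abs_le]
      constructor <;> linarith [(abs_le.1 h1).1, (abs_le.1 h1).2]
    exact_mod_cast h2
  exact ⟨⟨fun k => (abs_le.1 (hk k)).1, fun k => (abs_le.1 (hk k)).2⟩, Set.mem_univ _⟩

/-- The permutation of the index set induced by `W_r`. -/
def shiftEquiv (r : Z2) : Z2 × DualDeck M ≃ Z2 × DualDeck M :=
  (Equiv.addLeft (-r)).prodCongr (Equiv.addLeft (-Submodule.Quotient.mk r))

/-- The shift moves the Fourier index by `r`, changing the eigenvalue parameter by `2π (r₁ + i r₂)`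
independently of `z`; the change of group index contributes a bounded amount. -/
theorem exists_torusBlock_sub_le : ∃ C, 0 ≤ C ∧ ∀ r z,
    ‖torusBlock M z - torusBlock M (shiftEquiv M r z)‖ ≤ C * wt r := by
  obtain ⟨C, hC, h⟩ := exists_diracBlock_sub_le (lengthFun M)
  refine ⟨C * (1 + 2 * Real.pi), by positivity, fun r z => ?_⟩
  refine (h _ _ _ _).trans ?_
  rw [mul_assoc C]
  refine mul_le_mul_of_nonneg_left ?_ hC
  have h1 : (2 * Real.pi * z.1.toComplex - 2 * Real.pi * (-r + z.1).toComplex : ℂ) =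
      2 * Real.pi * r.toComplex := by
    simp only [Z2.toComplex, Pi.add_apply, Pi.neg_apply]
    push_cast
    ring
  have h2 : ‖r.toComplex‖ ≤ wt r := by
    have h3 : ‖r.toComplex‖ ≤ |(r 0 : ℝ)| + |(r 1 : ℝ)| := by
      refine (norm_add_le _ _).trans_eq ?_
      simp
    rw [wt]
    nlinarith [sq_nonneg (|(r 0 : ℝ)| - 1), sq_nonneg (|(r 1 : ℝ)| - 1), sq_abs (r 0 : ℝ),
      sq_abs (r 1 : ℝ)]
  change 1 + ‖(2 * Real.pi * z.1.toComplex - 2 * Real.pi * (-r + z.1).toComplex : ℂ)‖ ≤ _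
  have h4 : ‖(2 * Real.pi : ℂ)‖ = 2 * Real.pi := by
    simp [abs_of_pos Real.pi_pos]
  rw [h1, norm_mul, h4]
  nlinarith [one_le_wt r, Real.pi_pos, mul_le_mul_of_nonneg_left h2 Real.two_pi_pos.le]

/-- Every block scales the norm of a fixed unit vector by its `torusAbs`, so the reverse triangle
inequality transfers the estimate from `D̃` to `|D̃|`. -/
theorem abs_torusAbs_sub_le (z w : Z2 × DualDeck M) :
    |torusAbs M z - torusAbs M w| ≤ ‖torusBlock M z - torusBlock M w‖ := by
  set v : EuclideanSpace ℂ (Fin 2 ⊕ Fin 2) := EuclideanSpace.single (Sum.inl 0) 1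
  have hv : ‖v‖ = 1 := by simp [v]
  have h : ∀ i, ‖torusBlock M i v‖ = torusAbs M i := fun i => by
    rw [norm_apply_of_sq_eq_smul (torusBlock_isSelfAdjoint M i) (torusAbs_nonneg M i)
      (torusBlock_mul_self M i), hv, mul_one]
  rw [← h z, ← h w]
  refine (abs_norm_sub_norm_le _ _).trans ?_
  have := (torusBlock M z - torusBlock M w).le_opNorm v
  rwa [hv, mul_one] at this

theorem fourier_repr_piTau_W (r n : Z2) (y : L2B θ) :
    (fourier θ).repr (piTau θ (W θ r) y) n = sigmaTheta θ r n * (fourier θ).repr y (-r + n) := by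
  rw [HilbertBasis.repr_apply_apply, HilbertBasis.repr_apply_apply,
    ← ContinuousLinearMap.adjoint_inner_left, ← ContinuousLinearMap.star_eq_adjoint, ← map_star,
    W_star, fourier_apply, fourier_apply, piTau_iotaB, W_mul, iotaB_smul, inner_smul_left]
  congr 1
  rw [← Complex.star_def, sigmaTheta_star, sigmaTheta, thetaForm_neg_left]
  push_cast
  ring_nf

/-- The bound 1 is written as a constant times a power of the weight, the common shape that the
commutator estimates iterate. -/
theorem norm_sigmaTheta_smul_one_le (r : Z2) (z : Z2 × DualDeck M) :
    ‖sigmaTheta θ r z.1 • (1 : EuclideanSpace ℂ (Fin 2 ⊕ Fin 2) →L[ℂ]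
      EuclideanSpace ℂ (Fin 2 ⊕ Fin 2))‖ ≤ 1 * wt r ^ 0 := by
  rw [norm_smul, norm_sigmaTheta, one_mul, pow_zero, mul_one]
  exact ContinuousLinearMap.norm_id_le

/-- `W_r` is homogeneous of degree the class of `r`, so the Fourier index and the group index are
translated together, and the weight is a phase acting as a scalar on the fibre. -/
theorem hatHom_W (r : Z2) : hatHom M θ (W θ r) = blockShift (torusCoord M θ) (shiftEquiv M r)
    (fun z => sigmaTheta θ r z.1 • 1) (1 * wt r ^ 0) (norm_sigmaTheta_smul_one_le M θ r) := by
  rw [hatHom_of_mem (W_mem_homog r)]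
  ext1 x
  refine lp_ext_of_isometry (torusCoord M θ) fun i => ?_
  rw [blockShift_apply]
  refine PiLp.ext fun k => ?_
  rcases k with k | k
  · exact fourier_repr_piTau_W θ r i.1 _
  · exact fourier_repr_piTau_W θ r i.1 _

end DiracTilde

/-! ### Regularity -/

section Regularity

theorem IsBddCommutator.smul {H : Type*} [NormedAddCommGroup H] [InnerProductSpace ℂ H]
    {D : H →ₗ.[ℂ] H} {S C : H →L[ℂ] H} (h : IsBddCommutator D S C) (a : ℂ) :
    IsBddCommutator D (a • S) (a • C) := by
  rw [isBddCommutator_iff] at h ⊢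
  intro x y hxy
  have := D.graph.smul_mem a (h x y hxy)
  rwa [Prod.smul_mk, smul_add] at this

variable {I K H : Type*} [NormedAddCommGroup K] [InnerProductSpace ℂ K]
  [NormedAddCommGroup H] [InnerProductSpace ℂ H] [CompleteSpace H] (U : H ≃ₗᵢ[ℂ] Ell2 I K)
  (e : Z2 → I ≃ I) {α : Z2 → ℂ}

/-- Polynomial growth of the shifts is absorbed by the rapid decay of the coefficients, giving
absolute convergence in operator norm. -/
theorem summable_blockShift (hα : IsSchwartz α) {Q : Z2 → I → K →L[ℂ] K} {C : ℝ} {p : ℕ}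
    (hQ : ∀ r z, ‖Q r z‖ ≤ C * wt r ^ p) :
    Summable fun r => α r • blockShift U (e r) (Q r) (C * wt r ^ p) (hQ r) := by
  refine Summable.of_norm_bounded ((isSchwartz_iff.1 hα p).mul_left |C|) fun r => ?_
  rw [norm_smul]
  refine (mul_le_mul_of_nonneg_left (norm_blockShift_le _ _ _ _ _) (norm_nonneg _)).trans_eq ?_
  rw [abs_mul, abs_of_pos (pow_pos (wt_pos r) p)]
  ring

/-- A rapidly convergent series of weighted shifts has a bounded commutator with a block diagonal
operator whose blocks vary at most polynomially. -/
theorem isBddCommutator_tsum_blockShift (hα : IsSchwartz α) {L : I → K →L[ℂ] K}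
    {Q Q' : Z2 → I → K →L[ℂ] K} {C C' : ℝ} {p p' : ℕ} (hQ : ∀ r z, ‖Q r z‖ ≤ C * wt r ^ p)
    (hQ' : ∀ r z, ‖Q' r z‖ ≤ C' * wt r ^ p')
    (h : ∀ r z, Q' r z = L z * Q r z - Q r z * L (e r z)) :
    IsBddCommutator (blockOp U L)
      (∑' r, α r • blockShift U (e r) (Q r) (C * wt r ^ p) (hQ r))
      (∑' r, α r • blockShift U (e r) (Q' r) (C' * wt r ^ p') (hQ' r)) :=
  IsBddCommutator.hasSum (blockOp_isClosed U L)
    (fun r => (isBddCommutator_blockShift U L (e r) (hQ r) (hQ' r) (h r)).smul (α r))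
    (summable_blockShift U e hα hQ).hasSum (summable_blockShift U e hα hQ').hasSum

/-- A rapidly convergent series of weighted shifts is smooth for the derivation given by a block
diagonal operator whose blocks are scalars varying at most polynomially. -/
theorem memDomDelta_tsum_blockShift (hα : IsSchwartz α) {lam : I → ℝ} {B : ℝ}
    (hlam : ∀ r z, |lam z - lam (e r z)| ≤ B * wt r) (k : ℕ) :
    ∀ {Q : Z2 → I → K →L[ℂ] K} {C : ℝ} {p : ℕ} (hQ : ∀ r z, ‖Q r z‖ ≤ C * wt r ^ p),
      MemDomDelta (blockOp U fun i => (lam i : ℂ) • 1) k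
        (∑' r, α r • blockShift U (e r) (Q r) (C * wt r ^ p) (hQ r)) := by
  induction k with
  | zero => exact fun _ => trivial
  | succ k ih =>
    intro Q C p hQ
    -- One commutator multiplies the weights by eigenvalue differences and so costs one power of `wt
    -- r`. The induction therefore has to range over all `Q`, `C` and `p`.
    have hQ' : ∀ r z, ‖((lam z - lam (e r z) : ℝ) : ℂ) • Q r z‖ ≤ (B * C) * wt r ^ (p + 1) :=
      fun r z => by
        rw [norm_smul, Complex.norm_real, Real.norm_eq_abs]
        refine (mul_le_mul (hlam r z) (hQ r z) (norm_nonneg _)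
          ((abs_nonneg _).trans (hlam r z))).trans_eq ?_
        ring
    refine ⟨_, isBddCommutator_tsum_blockShift U e hα hQ hQ' fun r z => ?_, ih hQ'⟩
    rw [smul_mul_assoc, one_mul, mul_smul_comm, mul_one, ← sub_smul, Complex.ofReal_sub]

end Regularity

/-! ### Commutators and smoothness for elements of the smooth torus -/

section Triple

theorem map_eq_tsum {θ : ℝ} {H : Type*} [NormedAddCommGroup H] [InnerProductSpace ℂ H]
    [CompleteSpace H] (π : QuantumTorus θ →⋆ₐ[ℂ] (H →L[ℂ] H)) {α : Z2 → ℂ} {b : QuantumTorus θ}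
    (h : HasSum (fun r => α r • W θ r) b) : π b = ∑' r, α r • π (W θ r) := by
  rw [← (h.map π (map_continuous π)).tsum_eq]
  refine tsum_congr fun r => ?_
  rw [Function.comp_apply, map_smul]

variable (M : Matrix (Fin 2) (Fin 2) ℤ) [hM : Fact (1 < M.det)] (θ : ℝ)

/-- Smooth elements of `B` have bounded commutator with `D̃`, and they and their commutators are
smooth for `[|D̃|, ·]`. -/
theorem hatHom_regular {b : QuantumTorus θ} (hb : b ∈ smoothTorus θ) :
    MemDomDeltaInf (blockOp (torusCoord M θ) fun i => (torusAbs M i : ℂ) • 1) (hatHom M θ b) ∧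
    ∃ E, IsBddCommutator (diracTilde M θ) (hatHom M θ b) E ∧
      MemDomDeltaInf (blockOp (torusCoord M θ) fun i => (torusAbs M i : ℂ) • 1) E := by
  obtain ⟨α, hα, hαb⟩ := hb
  obtain ⟨C, hC, hsub⟩ := exists_torusBlock_sub_le M
  have hlam : ∀ r z, |torusAbs M z - torusAbs M (shiftEquiv M r z)| ≤ C * wt r := fun r z =>
    (abs_torusAbs_sub_le M _ _).trans (hsub r z)
  have hQ := norm_sigmaTheta_smul_one_le M θ
  have hsum : hatHom M θ b = ∑' r, α r • blockShift (torusCoord M θ) (shiftEquiv M r)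
      (fun z => sigmaTheta θ r z.1 • 1) (1 * wt r ^ 0) (hQ r) := by
    rw [map_eq_tsum (hatHom M θ) hαb]
    refine tsum_congr fun r => ?_
    rw [hatHom_W]
  -- These are the weights of `[D̃, W_r]`: the phase is scalar and commutes with the blocks, leaving
  -- their difference.
  have hQ' : ∀ r z, ‖sigmaTheta θ r z.1 • (torusBlock M z - torusBlock M (shiftEquiv M r z))‖ ≤
      C * wt r ^ 1 := fun r z => by
    rw [norm_smul, norm_sigmaTheta, one_mul, pow_one]
    exact hsub r z
  rw [hsum]
  refine ⟨fun k => memDomDelta_tsum_blockShift _ _ hα hlam k hQ, _, ?_,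
    fun k => memDomDelta_tsum_blockShift _ _ hα hlam k hQ'⟩
  rw [diracTilde_eq]
  refine isBddCommutator_tsum_blockShift _ _ hα hQ hQ' fun r z => ?_
  rw [mul_smul_comm, mul_one, smul_mul_assoc, one_mul, smul_sub]

end Triple

/-! ### Elementary tensors -/

section Tensors

variable {G H : Type*} [AddCommGroup G] [Fintype G] [NormedAddCommGroup H] [InnerProductSpace ℂ H]

open Classical in
theorem tens_apply {G H : Type*} [Fintype G] [NormedAddCommGroup H] [InnerProductSpace ℂ H]
    (ξ : H) (g : G) (v : EuclideanSpace ℂ (Fin 2)) (p : G × Fin 2) :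
    tens ξ g v p = if p.1 = g then v p.2 • ξ else 0 := rfl

theorem tens_smul {G H : Type*} [Fintype G] [NormedAddCommGroup H] [InnerProductSpace ℂ H]
    (c : ℂ) (ξ : H) (g : G) (v : EuclideanSpace ℂ (Fin 2)) :
    tens (c • ξ) g v = c • tens ξ g v := by
  refine PiLp.ext fun p => ?_
  rw [PiLp.smul_apply, tens_apply, tens_apply, smul_ite, smul_zero, smul_comm]

theorem lengthMul_tens {G H : Type*} [Fintype G] [NormedAddCommGroup H] [InnerProductSpace ℂ H]
    (ℓ : G → Matrix (Fin 2) (Fin 2) ℂ) (ξ : H) (g : G)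
    (v : EuclideanSpace ℂ (Fin 2)) :
    lengthMul ℓ (tens ξ g v) = tens ξ g (WithLp.toLp 2 ((ℓ g).mulVec v)) := by
  refine PiLp.ext fun p => ?_
  change ∑ k, ℓ p.1 p.2 k • tens ξ g v (p.1, k) = _
  simp only [tens_apply]
  by_cases h : p.1 = g
  · simp only [h, if_true, smul_smul, ← Finset.sum_smul]
    rfl
  · simp [h]

theorem equivRep_tens (S T : H →L[ℂ] H) (j g h : G) (ξ η : H) (v w : EuclideanSpace ℂ (Fin 2)) :
    equivRep S T j (WithLp.toLp 2 (tens ξ g v, tens η h w)) =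
      WithLp.toLp 2 (tens (S ξ) (j + g) v, tens (T η) (j + h) w) := by
  have hg : ∀ p g : G, -j + p = g ↔ p = j + g := fun p g => neg_add_eq_iff_eq_add
  refine equivHilb_ext (fun p => ?_) fun p => ?_
  · rw [equivRep_fst]
    change S (tens ξ g v (-j + p.1, p.2)) = tens (S ξ) (j + g) v p
    rw [tens_apply, tens_apply]
    by_cases hp : p.1 = j + g
    · rw [if_pos ((hg _ _).2 hp), if_pos hp, map_smul]
    · rw [if_neg (mt (hg _ _).1 hp), if_neg hp, map_zero]
  · rw [equivRep_snd]
    change T (tens η h w (-j + p.1, p.2)) = tens (T η) (j + h) w p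
    rw [tens_apply, tens_apply]
    by_cases hp : p.1 = j + h
    · rw [if_pos ((hg _ _).2 hp), if_pos hp, map_smul]
    · rw [if_neg (mt (hg _ _).1 hp), if_neg hp, map_zero]

/-- Operators which agree on the vectors `(e_m ⊗ δ_g ⊗ v, e_m ⊗ δ_g ⊗ w)` are equal. -/
theorem equivHilb_clm_ext {ι G H : Type*} [Fintype G] [NormedAddCommGroup H]
    [InnerProductSpace ℂ H] (b : HilbertBasis ι ℂ H)
    {S T : EquivHilb G H →L[ℂ] EquivHilb G H}
    (h : ∀ m g v w, S (WithLp.toLp 2 (tens (b m) g v, tens (b m) g w)) =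
      T (WithLp.toLp 2 (tens (b m) g v, tens (b m) g w))) : S = T := by
  classical
  -- A vector supported in one block is a pair of elementary tensors over the same basis vector and
  -- group element, so agreement on such pairs suffices.
  have hs : ∀ (i : ι × G) (u : EuclideanSpace ℂ (Fin 2 ⊕ Fin 2)),
      (coord b).symm (lp.single 2 i u) = WithLp.toLp 2
        (tens (b i.1) i.2 (WithLp.toLp 2 fun k => u (Sum.inl k)),
          tens (b i.1) i.2 (WithLp.toLp 2 fun k => u (Sum.inr k))) := by
    rintro ⟨m, g⟩ u
    rw [LinearIsometryEquiv.symm_apply_eq]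
    refine lp.ext (funext fun n => ?_)
    obtain ⟨n, g'⟩ := n
    have key : ∀ c : ℂ, b.repr (if g' = g then c • b m else 0) n =
        if (n, g') = (m, g) then c else 0 := fun c => by
      by_cases hg : g' = g
      · subst hg
        rw [if_pos rfl, map_smul, HilbertBasis.repr_self]
        by_cases hn : n = m
        · subst hn; simp
        · simp [hn]
      · simp [hg]
    refine PiLp.ext fun k => ?_
    have hsing : (lp.single 2 (m, g) u : Ell2 (ι × G) (EuclideanSpace ℂ (Fin 2 ⊕ Fin 2))) (n, g') k =
        if (n, g') = (m, g) then u k else 0 := by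
      by_cases hn : (n, g') = (m, g)
      · rw [hn]; simp
      · rw [lp.single_apply_ne _ _ _ hn, if_neg hn]; rfl
    rw [hsing]
    rcases k with k | k
    · rw [coord_inl]
      refine (key _).symm.trans ?_
      change _ = b.repr (tens (b m) g (WithLp.toLp 2 fun k => u (Sum.inl k)) (g', k)) n
      rw [tens_apply]
    · rw [coord_inr]
      refine (key _).symm.trans ?_
      change _ = b.repr (tens (b m) g (WithLp.toLp 2 fun k => u (Sum.inr k)) (g', k)) n
      rw [tens_apply]
  ext1 x
  have hx := (((coord (G := G) b).symm.toContinuousLinearEquiv :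
    Ell2 (ι × G) (EuclideanSpace ℂ (Fin 2 ⊕ Fin 2)) →L[ℂ] EquivHilb G H)).hasSum
    (lp.hasSum_single (p := 2) (by norm_num) (coord b x))
  have hx' : ((coord (G := G) b).symm.toContinuousLinearEquiv :
      Ell2 (ι × G) (EuclideanSpace ℂ (Fin 2 ⊕ Fin 2)) →L[ℂ] EquivHilb G H) (coord b x) = x :=
    (coord b).symm_apply_apply x
  rw [hx'] at hx
  refine (S.hasSum hx).unique ?_
  refine (T.hasSum hx).congr_fun fun i => ?_
  change S ((coord b).symm (lp.single 2 i (coord b x i))) =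
    T ((coord b).symm (lp.single 2 i (coord b x i)))
  rw [hs]
  exact h _ _ _ _

end Tensors

/-! ### The representation of the crossed product and its spectral triple -/

section Main

variable {M : Matrix (Fin 2) (Fin 2) ℤ} [hM : Fact (1 < M.det)] {θ : ℝ}
  {K : Type*} [NormedAddCommGroup K] [InnerProductSpace ℂ K] [CompleteSpace K]
  (π₀ : fixedAlg M θ →⋆ₐ[ℂ] (K →L[ℂ] K)) (hπ₀ : Function.Injective π₀)

/-- The representation `π̂ × L̂` of `A ⋊_r Ĝ`. -/
def crossedRep : reducedCrossedProduct (coveringPair M θ) π₀ →⋆ₐ[ℂ]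
    (EquivHilb (DualDeck M) (L2B θ) →L[ℂ] EquivHilb (DualDeck M) (L2B θ)) :=
  (hatHom M θ).comp ((regEquiv π₀ hπ₀).symm : reducedCrossedProduct (coveringPair M θ) π₀ →⋆ₐ[ℂ]
    QuantumTorus θ)

theorem crossedRep_apply (c : reducedCrossedProduct (coveringPair M θ) π₀) :
    crossedRep π₀ hπ₀ c = hatHom M θ ((regEquiv π₀ hπ₀).symm c) := rfl

theorem crossedRep_crossedElem (a : fixedAlg M θ) (j : DualDeck M) :
    crossedRep π₀ hπ₀ (crossedElem (coveringPair M θ) π₀ a j) = hatRep M θ a j := by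
  rw [crossedRep_apply, regEquiv_symm_crossedElem, hatHom_mul_frame]

theorem sigmaTheta_mul_sigmaTheta (x s m : Z2) :
    sigmaTheta θ x s * sigmaTheta θ (x + s) m =
      Complex.exp (-(Real.pi * Complex.I) * ((thetaForm θ x s + thetaForm θ (x + s) m : ℝ) : ℂ)) := by
  rw [sigmaTheta, sigmaTheta, ← Complex.exp_add]
  push_cast
  ring_nf

theorem crossedRep_hasExplicitFormula : HasExplicitFormula M θ π₀ (crossedRep π₀ hπ₀) := by
  intro x j m n g h v w
  have key : ∀ m : Z2, (piTau θ (WA M θ x : QuantumTorus θ) *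
      piTau θ (frame M θ j : QuantumTorus θ)) (iotaB θ (W θ m)) =
      Complex.exp (-(Real.pi * Complex.I) *
        ((thetaForm θ (M.transpose.mulVec x) (sect M j) +
          thetaForm θ (M.transpose.mulVec x + sect M j) m : ℝ) : ℂ)) •
        iotaB θ (W θ (m + M.transpose.mulVec x + sect M j)) := fun m => by
    rw [← map_mul, piTau_iotaB]
    change iotaB θ (W θ (M.transpose.mulVec x) * W θ (sect M j) * W θ m) = _
    rw [W_mul, smul_mul_assoc, W_mul, smul_smul, iotaB_smul, sigmaTheta_mul_sigmaTheta]
    congr 3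
    abel
  rw [crossedRep_crossedElem, hatRep, equivRep_tens, key, key, tens_smul, tens_smul]

/-- With `j` the class of `y`, the difference `y - s(j)` lies in `Mᵀ ℤ²`, and `c` undoes the phase
of the product. Thus the elements covered by the explicit formula already reach all generators of
`B`. -/
theorem exists_W_eq (y : Z2) : ∃ (x : Z2) (j : DualDeck M) (c : ℂ),
    W θ y = c • ((WA M θ x : QuantumTorus θ) * (frame M θ j : QuantumTorus θ)) := by
  have h : (Submodule.Quotient.mk y : DualDeck M) =
    Submodule.Quotient.mk (sect M (Submodule.Quotient.mk y)) := (mk_sect M _).symm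
  obtain ⟨x, hx⟩ := (Submodule.Quotient.eq _).1 h
  refine ⟨x, Submodule.Quotient.mk y,
    star (sigmaTheta θ (M.transpose.mulVec x) (sect M (Submodule.Quotient.mk y))), ?_⟩
  change _ = _ • (W θ (M.transpose.mulVec x) * W θ (sect M (Submodule.Quotient.mk y)))
  rw [W_mul, smul_smul, (Unitary.mem_iff.1 (sigmaTheta_mem_unitary θ _ _)).1, one_smul]
  congr 1
  rw [Matrix.mulVecLin_apply] at hx
  rw [hx, sub_add_cancel]

theorem torus_starAlgHom_ext {H : Type*} [NormedAddCommGroup H] [InnerProductSpace ℂ H]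
    [CompleteSpace H] {S T : QuantumTorus θ →⋆ₐ[ℂ] (H →L[ℂ] H)}
    (h : ∀ y, S (W θ y) = T (W θ y)) : S = T := by
  ext1 b
  exact torus_ext (f := S.toAlgHom.toLinearMap) (g := T.toAlgHom.toLinearMap)
    (map_continuous S) (map_continuous T) h b

/-- The formula fixes the operators of `W_{Mᵀx} δ_j` on a total set of vectors. Pulled back to `B`,
this determines the representation on every `W_y`, hence everywhere by continuity. -/
theorem crossedRep_unique (R' : reducedCrossedProduct (coveringPair M θ) π₀ →⋆ₐ[ℂ]
      (EquivHilb (DualDeck M) (L2B θ) →L[ℂ] EquivHilb (DualDeck M) (L2B θ)))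
    (hR' : HasExplicitFormula M θ π₀ R') : R' = crossedRep π₀ hπ₀ := by
  have h1 : ∀ x j, R' (crossedElem (coveringPair M θ) π₀ (WA M θ x) j) =
      crossedRep π₀ hπ₀ (crossedElem (coveringPair M θ) π₀ (WA M θ x) j) := fun x j => by
    refine equivHilb_clm_ext (fourier θ) fun m g v w => ?_
    simp only [fourier_apply]
    rw [hR', crossedRep_hasExplicitFormula]
  have h2 : R'.comp (regEquiv π₀ hπ₀ : QuantumTorus θ →⋆ₐ[ℂ]
      reducedCrossedProduct (coveringPair M θ) π₀) = hatHom M θ := by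
    refine torus_starAlgHom_ext fun y => ?_
    obtain ⟨x, j, c, hy⟩ := exists_W_eq (M := M) (θ := θ) y
    rw [hy, map_smul, map_smul]
    congr 1
    change R' (regEquiv π₀ hπ₀ _) = _
    rw [regEquiv_mul_frame, h1, crossedRep_apply, regEquiv_symm_crossedElem]
  ext1 c
  rw [crossedRep_apply, ← h2]
  change _ = R' (regEquiv π₀ hπ₀ ((regEquiv π₀ hπ₀).symm c))
  rw [StarAlgEquiv.apply_symm_apply]

theorem blockOp_repr_basis_mem {ι H : Type*} [NormedAddCommGroup H] [InnerProductSpace ℂ H]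
    (b : HilbertBasis ι ℂ H) (c : ι → ℂ) (m : ι) :
    (b m, c m • b m) ∈ (blockOp b.repr fun n => c n • 1).graph := by
  classical
  rw [mem_graph_blockOp]
  intro n
  rw [map_smul, lp.coeFn_smul, Pi.smul_apply, HilbertBasis.repr_self]
  by_cases h : n = m
  · subst h; rfl
  · simp [h]

theorem tens_mem_graph {G H : Type*} [Fintype G] [NormedAddCommGroup H] [InnerProductSpace ℂ H]
    {D : H →ₗ.[ℂ] H} {ξ : H} {c : ℂ} (h : (ξ, c • ξ) ∈ D.graph) (g : G)
    (v : EuclideanSpace ℂ (Fin 2)) (p : G × Fin 2) :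
    (tens ξ g v p, c • tens ξ g v p) ∈ D.graph := by
  rw [tens_apply]
  split_ifs with hp
  · have := D.graph.smul_mem (v p.2) h
    rwa [Prod.smul_mk, smul_comm] at this
  · rw [smul_zero]
    exact D.graph.zero_mem

/-- In graph form, membership in the domain and the value are obtained together: both follow
componentwise from the eigenvector relations for `D^±`, once the length terms cancel. -/
theorem diracTilde_tens (m n : Z2) (g h : DualDeck M) (v w : EuclideanSpace ℂ (Fin 2)) :
    ((WithLp.toLp 2 (tens (iotaB θ (W θ m)) g v, tens (iotaB θ (W θ n)) h w) :
        EquivHilb (DualDeck M) (L2B θ)),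
      (WithLp.toLp 2
        (tens (iotaB θ (W θ m)) g (WithLp.toLp 2 ((lengthFun M g).mulVec v)) +
            (2 * Real.pi * ((n 0 : ℂ) - Complex.I * n 1)) • tens (iotaB θ (W θ n)) h w,
          (2 * Real.pi * ((m 0 : ℂ) + Complex.I * m 1)) • tens (iotaB θ (W θ m)) g v -
            tens (iotaB θ (W θ n)) h (WithLp.toLp 2 ((lengthFun M h).mulVec w))) :
        EquivHilb (DualDeck M) (L2B θ))) ∈ (diracTilde M θ).graph := by
  rw [diracTilde, mem_graph_equivDirac]
  have hp : ∀ m : Z2, (iotaB θ (W θ m), (2 * Real.pi * ((m 0 : ℂ) + Complex.I * m 1)) •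
      iotaB θ (W θ m)) ∈ (diracPlus θ).graph := fun m => by
    rw [diracPlus_eq, ← fourier_apply]
    exact blockOp_repr_basis_mem (fourier θ) _ m
  have hm : ∀ m : Z2, (iotaB θ (W θ m), (2 * Real.pi * ((m 0 : ℂ) - Complex.I * m 1)) •
      iotaB θ (W θ m)) ∈ (diracMinus θ).graph := fun m => by
    have hc : (m 0 : ℂ) - Complex.I * m 1 = star m.toComplex := by
      simp [Z2.toComplex, sub_eq_add_neg]
    rw [diracMinus_eq, ← fourier_apply, hc]
    exact blockOp_repr_basis_mem (fourier θ) (fun n : Z2 => 2 * Real.pi * star n.toComplex) m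
  constructor
  · intro p
    change (tens (iotaB θ (W θ m)) g v p,
      (2 * Real.pi * ((m 0 : ℂ) + Complex.I * m 1)) • tens (iotaB θ (W θ m)) g v p -
        tens (iotaB θ (W θ n)) h (WithLp.toLp 2 ((lengthFun M h).mulVec w)) p +
        lengthMul (lengthFun M) (tens (iotaB θ (W θ n)) h w) p) ∈ _
    rw [lengthMul_tens, sub_add_cancel]
    exact tens_mem_graph (hp m) g v p
  · intro p
    change (tens (iotaB θ (W θ n)) h w p,
      tens (iotaB θ (W θ m)) g (WithLp.toLp 2 ((lengthFun M g).mulVec v)) p +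
        (2 * Real.pi * ((n 0 : ℂ) - Complex.I * n 1)) • tens (iotaB θ (W θ n)) h w p -
        lengthMul (lengthFun M) (tens (iotaB θ (W θ m)) g v) p) ∈ _
    rw [lengthMul_tens, add_sub_cancel_left]
    exact tens_mem_graph (hm n) h w p

theorem isOddSpectralTriple_crossedRep :
    IsOddSpectralTriple (crossedSmooth (coveringPair M θ) π₀ (smoothFixed M θ))
      (crossedRep π₀ hπ₀) (diracTilde M θ) := by
  have hsa : IsSelfAdjoint (diracTilde M θ) := by
    rw [diracTilde_eq]
    exact blockOp_isSelfAdjoint _ (torusBlock_isSelfAdjoint M)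
  refine ⟨?_, ?_, hsa.dense_domain, hsa, ?_, ?_⟩
  · refine ⟨(smoothSubalgebra θ).comap ((regEquiv π₀ hπ₀).symm :
      reducedCrossedProduct (coveringPair M θ) π₀ →⋆ₐ[ℂ] QuantumTorus θ), ?_⟩
    rw [crossedSmooth_eq π₀ hπ₀]
    rfl
  · rw [crossedSmooth_eq π₀ hπ₀]
    have hc : Continuous (regEquiv π₀ hπ₀) :=
      (map_continuous (regHom π₀)).subtype_mk (regHom_mem π₀)
    have h := (EquivLike.surjective (regEquiv π₀ hπ₀)).denseRange.dense_image hc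
      (dense_smoothTorus θ)
    refine h.mono ?_
    rintro _ ⟨b, hb, rfl⟩
    rw [Set.mem_preimage, StarAlgEquiv.symm_apply_apply]
    exact hb
  · rw [diracTilde_eq]
    exact exists_isInvSqrtOneAddSq_blockOp _ (torusBlock_isSelfAdjoint M) (torusAbs_nonneg M)
      (torusBlock_mul_self M) (tendsto_torusAbs M)
  · intro a ha
    rw [crossedSmooth_eq π₀ hπ₀] at ha
    obtain ⟨-, E, hE, -⟩ := hatHom_regular M θ ha
    exact ⟨E, hE⟩

theorem isRegularTriple_crossedRep :
    IsRegularTriple (crossedSmooth (coveringPair M θ) π₀ (smoothFixed M θ))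
      (crossedRep π₀ hπ₀) (diracTilde M θ) := by
  refine ⟨blockOp (torusCoord M θ) fun i => (torusAbs M i : ℂ) • 1, ?_, fun a ha => ?_⟩
  · rw [diracTilde_eq]
    exact isAbs_blockOp _ (torusBlock_isSelfAdjoint M) (torusAbs_nonneg M) (torusBlock_mul_self M)
  · rw [crossedSmooth_eq π₀ hπ₀] at ha
    exact hatHom_regular M θ ha

end Main

end QTorus

end

theorem mainTheorem11 (θ : ℝ) (hθ : Irrational θ) (M : Matrix (Fin 2) (Fin 2) ℤ)
    [Fact (1 < M.det)] {K : Type*} [NormedAddCommGroup K] [InnerProductSpace ℂ K] [CompleteSpace K]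
    (π₀ : fixedAlg M θ →⋆ₐ[ℂ] (K →L[ℂ] K)) (hπ₀ : Function.Injective π₀) :
    (∃ Φ : reducedCrossedProduct (coveringPair M θ) π₀ ≃⋆ₐ[ℂ] QuantumTorus θ,
      ∀ (a : fixedAlg M θ) (j : DualDeck M),
        Φ (crossedElem (coveringPair M θ) π₀ a j) =
          (a : QuantumTorus θ) * (frame M θ j : QuantumTorus θ)) ∧
    ∃ R : reducedCrossedProduct (coveringPair M θ) π₀ →⋆ₐ[ℂ]
        (EquivHilb (DualDeck M) (L2B θ) →L[ℂ] EquivHilb (DualDeck M) (L2B θ)),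
      (∀ (a : fixedAlg M θ) (j : DualDeck M),
        R (crossedElem (coveringPair M θ) π₀ a j) = hatRep M θ a j) ∧
      HasExplicitFormula M θ π₀ R ∧
      (∀ R' : reducedCrossedProduct (coveringPair M θ) π₀ →⋆ₐ[ℂ]
          (EquivHilb (DualDeck M) (L2B θ) →L[ℂ] EquivHilb (DualDeck M) (L2B θ)),
        HasExplicitFormula M θ π₀ R' → R' = R) ∧
      (∀ (m n : Z2) (g h : DualDeck M) (v w : EuclideanSpace ℂ (Fin 2)),
        ((WithLp.toLp 2 (tens (iotaB θ (W θ m)) g v, tens (iotaB θ (W θ n)) h w) :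
            EquivHilb (DualDeck M) (L2B θ)),
          (WithLp.toLp 2
            (tens (iotaB θ (W θ m)) g (WithLp.toLp 2 ((lengthFun M g).mulVec v)) +
                (2 * Real.pi * ((n 0 : ℂ) - Complex.I * n 1)) • tens (iotaB θ (W θ n)) h w,
              (2 * Real.pi * ((m 0 : ℂ) + Complex.I * m 1)) • tens (iotaB θ (W θ m)) g v -
                tens (iotaB θ (W θ n)) h (WithLp.toLp 2 ((lengthFun M h).mulVec w))) :
            EquivHilb (DualDeck M) (L2B θ))) ∈ (diracTilde M θ).graph) ∧
      IsOddSpectralTriple (crossedSmooth (coveringPair M θ) π₀ (smoothFixed M θ)) R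
        (diracTilde M θ) ∧
      IsRegularTriple (crossedSmooth (coveringPair M θ) π₀ (smoothFixed M θ)) R
        (diracTilde M θ) := by
  exact ⟨⟨(regEquiv π₀ hπ₀).symm, regEquiv_symm_crossedElem π₀ hπ₀⟩, crossedRep π₀ hπ₀,
    crossedRep_crossedElem π₀ hπ₀, crossedRep_hasExplicitFormula π₀ hπ₀,
    crossedRep_unique π₀ hπ₀, diracTilde_tens, isOddSpectralTriple_crossedRep π₀ hπ₀,
    isRegularTriple_crossedRep π₀ hπ₀⟩
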